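/- Let $\Bbbk$ be an algebraically closed field of characteristic zero, $G$ a finite abelian group, $\chi: G\to\Bbbk^\times$ a character, $a\in G$ and $\alpha\in\Bbbk$. Put $\rho=\chi(a)$, let $n$ be the order of $\rho$, and assume that $\chi^n=1$ or $\alpha(a^n-1)=0$ in $\Bbbk G$. Let $H$ be the pointed rank one Hopf algebra generated by $G$ and $x$ subject to the group relations of $G$, $x^n=\alpha(a^n-1)$ and $xg=\chi(g)gx$ for $g\in G$, with $\Delta(g)=g\otimes g$ and $\Delta(x)=x\otimes a+1\otimes x$; it has the basis $\{gx^j\mid g\in G,\ 0\le j\le n-1\}$. Let $D(H)=H^{*\mathrm{cop}}\bowtie H$ be its Drinfeld double, i.e. the algebra generated by the algebras $H^*$ and $H$ subject to $\sum h_{(1)}\,p(h_{(2)}\,\cdot)=\sum p(\cdot\,h_{(1)})\,h_{(2)}$ for all $h\in H$, $p\in H^*$. Let $\Gamma=\mathrm{Hom}(G,\Bbbk^\times)$, and regard $\gamma\in\Gamma$ and $\xi$ as the elements of $H^*$ with $\gamma(gx^j)=\gamma(g)\delta_{j,0}$ and $\xi(gx^j)=\delta_{j,1}$ for $g\in G$,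 $0\le j\le n-1$. For a character $\lambda$ of $G\times\Gamma$, let $Z(\lambda)$ be the quotient of $D(H)$ by the left ideal generated by $\xi$ and the elements $g-\lambda(g)$ $(g\in G)$ and $\gamma-\lambda(\gamma)$ $(\gamma\in\Gamma)$. For $1\le l\le n-1$ let $I_l$ be the set of characters $\lambda$ of $G\times\Gamma$ with $\lambda(a\chi^{-1})=\rho^{\,l-1}$, and for $\lambda\in I_l$ let $V(l,\lambda)=Z(\lambda)/\mathrm{rad}\,Z(\lambda)$. For a finite-dimensional $D(H)$-module $M$, let $\Omega M$ be the kernel of a projective cover of $M$ and $\Omega^{-1}M$ the cokernel of an injective envelope of $M$; $\Omega^{i}$ and $\Omega^{-i}$ are the $i$-fold iterates, with $\Omega^0M=M$. A finite-dimensional indecomposable $D(H)$-module $M$ of Loewy length two is said to be of $(s,t)$-type if $M/\mathrm{rad}\,M$ has length $s$ and $\mathrm{soc}\,M$ has length $t$. Proposition. Let $M$ be a finite-dimensional indecomposable $D(H)$-module of Loewy length two and of $(s,t)$-type. (1) If $s<t$, then $t=s+1$ and $M\cong\Omega^{-s}V(l,\lambda)$ for some $1\le l\le n-1$ and $\lambda\in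 I_l$. (2) If $s>t$, then $s=t+1$ and $M\cong\Omega^{t}V(l,\lambda)$ for some $1\le l\le n-1$ and $\lambda\in I_l$. -/

import Mathlib

universe u v w

open scoped TensorProduct

/-! Representation-theoretic notions: radical, socle, Loewy length, (co)syzygies -/

section ModuleNotions

variable (R : Type u) [Ring R]

/-- The socle of a module: the sum of all its simple submodules. -/
def moduleSocle (M : Type w) [AddCommGroup M] [Module R M] : Submodule R M :=
  sSup {S : Submodule R M | IsSimpleModule R S}

/-- The radical series `M = rad⁰ M ⊇ rad M ⊇ rad² M ⊇ ⋯`, where `rad N = Module.jacobson R N` is the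
intersection of the maximal submodules of `N` and `radⁱ⁺¹ M = rad (radⁱ M)`. -/
def radicalSeries (M : Type w) [AddCommGroup M] [Module R M] : ℕ → Submodule R M
  | 0 => ⊤
  | i + 1 => (Module.jacobson R (radicalSeries M i)).map (radicalSeries M i).subtype

/-- `M` has radical length (Loewy length) `r`: `r` is the least `i` with `radⁱ M = 0`. -/
def HasLoewyLength (M : Type w) [AddCommGroup M] [Module R M] (r : ℕ) : Prop :=
  IsLeast {i : ℕ | radicalSeries R M i = ⊥} r

/-- A module is indecomposable if it is nonzero and not the direct sum of two nonzero submodules. -/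
def IsIndecomposableModule (M : Type w) [AddCommGroup M] [Module R M] : Prop :=
  Nontrivial M ∧ ∀ N K : Submodule R M, IsCompl N K → N = ⊥ ∨ K = ⊥

/-- An indecomposable module of Loewy length two is of `(s, t)`-type if its head `M / rad M` has
length `s` and its socle has length `t`. -/
structure IsOfType (M : Type w) [AddCommGroup M] [Module R M] (s t : ℕ) : Prop where
  indecomposable : IsIndecomposableModule R M
  loewy : HasLoewyLength R M 2
  length_head : Module.length R (M ⧸ Module.jacobson R M) = s
  length_socle : Module.length R (moduleSocle R M) = t

variable {R}

/-- `f : P → M` is a projective cover: `P` is projective and `f` is surjective with superfluous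
kernel. -/
structure IsProjectiveCover {P M : Type w} [AddCommGroup P] [Module R P] [AddCommGroup M]
    [Module R M] (f : P →ₗ[R] M) : Prop where
  projective : Module.Projective R P
  surjective : Function.Surjective f
  superfluous : ∀ N : Submodule R P, N ⊔ LinearMap.ker f = ⊤ → N = ⊤

/-- `f : M → I` is an injective envelope: `I` is injective and `f` is injective with essential
image. -/
structure IsInjectiveEnvelope {M I : Type w} [AddCommGroup M] [Module R M] [AddCommGroup I]
    [Module R I] (f : M →ₗ[R] I) : Prop where
  injective_module : Module.Injective R I
  injective : Function.Injective f
  essential : ∀ N : Submodule R I, N ⊓ LinearMap.range f = ⊥ → N = ⊥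

/-- `N ≅ Ω M`, the kernel of a projective cover of `M`. -/
def IsSyzygy (M N : ModuleCat.{w} R) : Prop :=
  ∃ (P : ModuleCat.{w} R) (f : P →ₗ[R] M),
    IsProjectiveCover f ∧ Nonempty (N ≃ₗ[R] LinearMap.ker f)

/-- `N ≅ Ω⁻¹ M`, the cokernel of an injective envelope of `M`. -/
def IsCosyzygy (M N : ModuleCat.{w} R) : Prop :=
  ∃ (I : ModuleCat.{w} R) (f : M →ₗ[R] I),
    IsInjectiveEnvelope f ∧ Nonempty (N ≃ₗ[R] I ⧸ LinearMap.range f)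

/-- `N ≅ Ωⁱ M`. -/
def IsIteratedSyzygy (M : ModuleCat.{w} R) : ℕ → ModuleCat.{w} R → Prop
  | 0, N => Nonempty (N ≃ₗ[R] M)
  | i + 1, N => ∃ K : ModuleCat.{w} R, IsIteratedSyzygy M i K ∧ IsSyzygy K N

/-- `N ≅ Ω⁻ⁱ M`. -/
def IsIteratedCosyzygy (M : ModuleCat.{w} R) : ℕ → ModuleCat.{w} R → Prop
  | 0, N => Nonempty (N ≃ₗ[R] M)
  | i + 1, N => ∃ K : ModuleCat.{w} R, IsIteratedCosyzygy M i K ∧ IsCosyzygy K N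

end ModuleNotions

/-! The Drinfeld double of a finite-dimensional Hopf algebra -/

section Double

variable (k : Type u) [Field k] (H : Type w) [Ring H] [HopfAlgebra k H]

/-- The product of the dual algebra `H^*`: `(p * q)(h) = ∑ p(h₁) q(h₂)`. -/
noncomputable def dualConv (p q : Module.Dual k H) : Module.Dual k H :=
  LinearMap.mul' k k ∘ₗ TensorProduct.map p q ∘ₗ Coalgebra.comul

/-- The generator of the double given by a functional `p ∈ H^*` (before imposing relations). -/
noncomputable def doublePreFun :
    Module.Dual k H →ₗ[k] TensorAlgebra k (Module.Dual k H × H) :=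
  TensorAlgebra.ι k ∘ₗ LinearMap.inl k (Module.Dual k H) H

/-- The generator of the double given by an element `h ∈ H` (before imposing relations). -/
noncomputable def doublePreElt : H →ₗ[k] TensorAlgebra k (Module.Dual k H × H) :=
  TensorAlgebra.ι k ∘ₗ LinearMap.inr k (Module.Dual k H) H

/-- The linear map `y ⊗ z ↦ y · p(z ?)`, where `p(z ?)` is the functional `w ↦ p (z * w)`. -/
noncomputable def doubleCrossLeft (p : Module.Dual k H) :
    H ⊗[k] H →ₗ[k] TensorAlgebra k (Module.Dual k H × H) :=
  TensorProduct.lift ((LinearMap.mul k _).compl₁₂ (doublePreElt k H)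
    (doublePreFun k H ∘ₗ (LinearMap.mul k H).compr₂ p))

/-- The linear map `y ⊗ z ↦ p(? y) · z`, where `p(? y)` is the functional `w ↦ p (w * y)`. -/
noncomputable def doubleCrossRight (p : Module.Dual k H) :
    H ⊗[k] H →ₗ[k] TensorAlgebra k (Module.Dual k H × H) :=
  TensorProduct.lift ((LinearMap.mul k _).compl₁₂
    (doublePreFun k H ∘ₗ (LinearMap.mul k H).flip.compr₂ p) (doublePreElt k H))

/-- The relations of the Drinfeld double: those of the algebra `H^*`, those of the algebra `H`, and
the cross relations `∑ h₁ · p(h₂ ?) = ∑ p(? h₁) · h₂` for `h ∈ H`, `p ∈ H^*`. -/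
inductive DoubleRel : TensorAlgebra k (Module.Dual k H × H) →
    TensorAlgebra k (Module.Dual k H × H) → Prop
  | fun_one : DoubleRel (doublePreFun k H Coalgebra.counit) 1
  | fun_mul (p q : Module.Dual k H) :
      DoubleRel (doublePreFun k H p * doublePreFun k H q) (doublePreFun k H (dualConv k H p q))
  | elt_one : DoubleRel (doublePreElt k H 1) 1
  | elt_mul (h h' : H) :
      DoubleRel (doublePreElt k H h * doublePreElt k H h') (doublePreElt k H (h * h'))
  | cross (h : H) (p : Module.Dual k H) :
      DoubleRel (doubleCrossLeft k H p (Coalgebra.comul h))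
        (doubleCrossRight k H p (Coalgebra.comul h))

/-- The Drinfeld double `D(H) = H^{*cop} ⋈ H` of a finite-dimensional Hopf algebra `H`: the algebra
generated by the algebras `H^*` and `H` subject to `∑ h₁ · p(h₂ ?) = ∑ p(? h₁) · h₂`.
Since the antipode `S` of `H` is bijective, these cross relations are equivalent to the usual
straightening rule `h · p = ∑ p(S⁻¹(h₃) ? h₁) · h₂`; so multiplication identifies this algebra with
the space `H^* ⊗ H` carrying the usual multiplication of the double. -/
def DrinfeldDouble : Type (max u w) := RingQuot (DoubleRel k H)

noncomputable instance : Ring (DrinfeldDouble k H) :=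
  inferInstanceAs (Ring (RingQuot (DoubleRel k H)))

noncomputable instance : Algebra k (DrinfeldDouble k H) :=
  inferInstanceAs (Algebra k (RingQuot (DoubleRel k H)))

/-- The quotient map onto `D(H)`. -/
noncomputable def DrinfeldDouble.mk :
    TensorAlgebra k (Module.Dual k H × H) →ₐ[k] DrinfeldDouble k H :=
  RingQuot.mkAlgHom k (DoubleRel k H)

/-- The canonical map `H^* → D(H)`. -/
noncomputable def DrinfeldDouble.ofFun : Module.Dual k H →ₗ[k] DrinfeldDouble k H :=
  (DrinfeldDouble.mk k H).toLinearMap ∘ₗ doublePreFun k H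

/-- The canonical map `H → D(H)`. -/
noncomputable def DrinfeldDouble.ofElt : H →ₗ[k] DrinfeldDouble k H :=
  (DrinfeldDouble.mk k H).toLinearMap ∘ₗ doublePreElt k H

end Double

/-! Group data and pointed rank one Hopf algebras -/

/-- A group datum `(G, χ, a, α)` with `G` abelian: `χ` is a character of `G`, `a ∈ G` and `α ∈ k`,
such that `χⁿ = 1` or `α (aⁿ - 1) = 0` (in the group algebra), where `n` is the order of `χ(a)`. -/
structure GroupDatum (k : Type u) (G : Type v) [Field k] [CommGroup G] where
  χ : G →* kˣ
  a : G
  α : k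
  compat : χ ^ orderOf (χ a) = 1 ∨
    α • (MonoidAlgebra.of k G (a ^ orderOf (χ a)) - 1) = 0

namespace GroupDatum

variable {k : Type u} {G : Type v} [Field k] [CommGroup G] (D : GroupDatum k G)

/-- `ρ = χ(a)`. -/
def ρ : k := (D.χ D.a : kˣ)

/-- `n`, the order of `ρ = χ(a)`. -/
noncomputable def n : ℕ := orderOf (D.χ D.a)

/-- Generators of `H_D`: the elements of `G` and `x`. -/
inductive Gen (G : Type v) : Type v
  | grp (g : G)
  | x

/-- Relations of `H_D`: the group relations of `G`, `x g = χ(g) g x` and `xⁿ = α (aⁿ - 1)`. -/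
inductive Rel : FreeAlgebra k (Gen G) → FreeAlgebra k (Gen G) → Prop
  | one : Rel (FreeAlgebra.ι k (Gen.grp 1)) 1
  | mul (g h : G) : Rel (FreeAlgebra.ι k (Gen.grp g) * FreeAlgebra.ι k (Gen.grp h))
      (FreeAlgebra.ι k (Gen.grp (g * h)))
  | comm (g : G) : Rel (FreeAlgebra.ι k Gen.x * FreeAlgebra.ι k (Gen.grp g))
      ((D.χ g : k) • (FreeAlgebra.ι k (Gen.grp g) * FreeAlgebra.ι k Gen.x))
  | pow : Rel (FreeAlgebra.ι k Gen.x ^ D.n)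
      (D.α • (FreeAlgebra.ι k (Gen.grp D.a) ^ D.n - 1))

/-- The algebra underlying the pointed rank one Hopf algebra `H_D`. -/
def RankOne : Type (max u v) := RingQuot D.Rel

noncomputable instance : Ring D.RankOne := inferInstanceAs (Ring (RingQuot D.Rel))

noncomputable instance : Algebra k D.RankOne := inferInstanceAs (Algebra k (RingQuot D.Rel))

/-- The group elements in `H_D`. -/
noncomputable def gp : G →* D.RankOne where
  toFun g := RingQuot.mkAlgHom k D.Rel (FreeAlgebra.ι k (Gen.grp g))
  map_one' := by
    rw [RingQuot.mkAlgHom_rel k Rel.one, map_one]; rfl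
  map_mul' g h := by
    rw [← RingQuot.mkAlgHom_rel k (Rel.mul g h), map_mul]; rfl

/-- The element `x` of `H_D`. -/
noncomputable def x : D.RankOne := RingQuot.mkAlgHom k D.Rel (FreeAlgebra.ι k Gen.x)

theorem x_mul_gp (g : G) : D.x * D.gp g = (D.χ g : k) • (D.gp g * D.x) := by
  have h := RingQuot.mkAlgHom_rel k (Rel.comm (D := D) g)
  rw [map_mul, map_smul, map_mul] at h
  exact h

theorem x_pow_n : D.x ^ D.n = D.α • (D.gp D.a ^ D.n - 1) := by
  have h := RingQuot.mkAlgHom_rel k (Rel.pow (D := D))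
  rw [map_pow, map_smul, map_sub, map_pow, map_one] at h
  exact h

/-- The universal property of `H_D`. -/
noncomputable def liftHom {A : Type*} [Ring A] [Algebra k A] (f : G →* A) (X : A)
    (h₁ : ∀ g, X * f g = (D.χ g : k) • (f g * X)) (h₂ : X ^ D.n = D.α • (f D.a ^ D.n - 1)) :
    D.RankOne →ₐ[k] A :=
  RingQuot.liftAlgHom k ⟨FreeAlgebra.lift k (fun i => match i with | .grp g => f g | .x => X), by
    intro p q h
    induction h with
    | one => simp
    | mul g h => simp
    | comm g => simpa using h₁ g
    | pow => simpa using h₂⟩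

section
variable {A : Type*} [Ring A] [Algebra k A] (f : G →* A) (X : A)
    (h₁ : ∀ g, X * f g = (D.χ g : k) • (f g * X)) (h₂ : X ^ D.n = D.α • (f D.a ^ D.n - 1))

@[simp] theorem liftHom_gp (g : G) : D.liftHom f X h₁ h₂ (D.gp g) = f g := by
  change RingQuot.liftAlgHom k _ (RingQuot.mkAlgHom k D.Rel _) = _
  rw [RingQuot.liftAlgHom_mkAlgHom_apply]; simp

@[simp] theorem liftHom_x : D.liftHom f X h₁ h₂ D.x = X := by
  change RingQuot.liftAlgHom k _ (RingQuot.mkAlgHom k D.Rel _) = _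
  rw [RingQuot.liftAlgHom_mkAlgHom_apply]; simp
end

theorem hom_ext {A : Type*} [Ring A] [Algebra k A] {f g : D.RankOne →ₐ[k] A}
    (h₁ : ∀ y, f (D.gp y) = g (D.gp y)) (h₂ : f D.x = g D.x) : f = g := by
  apply RingQuot.ringQuot_ext'
  apply FreeAlgebra.hom_ext
  funext i
  cases i with
  | grp y => exact h₁ y
  | x => exact h₂

/-- `H_D` is generated as an algebra by `G` and `x`. -/
theorem adjoin_eq_top : Algebra.adjoin k (Set.range D.gp ∪ {D.x}) = ⊤ := by
  set S := Algebra.adjoin k (Set.range D.gp ∪ {D.x}) with hS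
  have hg : ∀ g, D.gp g ∈ S := fun g => Algebra.subset_adjoin (Or.inl ⟨g, rfl⟩)
  have hx : D.x ∈ S := Algebra.subset_adjoin (Or.inr rfl)
  let f : G →* S := { toFun := fun g => ⟨D.gp g, hg g⟩
                      map_one' := by ext; simp
                      map_mul' := fun g h => by ext; simp }
  let F : D.RankOne →ₐ[k] S := D.liftHom f ⟨D.x, hx⟩
    (fun g => by ext; simpa [f] using D.x_mul_gp g)
    (by ext; simpa [f] using D.x_pow_n)
  have h : S.val.comp F = AlgHom.id k _ := by
    apply D.hom_ext
    · intro y; simp [F, f]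
    · simp [F]
  rw [eq_top_iff]
  intro y _
  have := congrArg (fun φ : D.RankOne →ₐ[k] D.RankOne => φ y) h
  simp only [AlgHom.comp_apply, AlgHom.id_apply] at this
  rw [← this]
  exact (F y).2

/-! The coalgebra structure of `H_D` -/

/-- Gaussian binomial coefficients evaluated at `q`. -/
def gaussBinom (q : k) : ℕ → ℕ → k
  | _, 0 => 1
  | 0, _ + 1 => 0
  | m + 1, j + 1 => gaussBinom q m j + q ^ (j + 1) * gaussBinom q m (j + 1)

theorem gaussBinom_eq_zero (q : k) (m j : ℕ) (h : m < j) : gaussBinom q m j = 0 := by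
  induction m generalizing j with
  | zero => cases j with
    | zero => omega
    | succ j => rfl
  | succ m ih => cases j with
    | zero => omega
    | succ j => simp [gaussBinom, ih j (by omega), ih (j + 1) (by omega)]

theorem gaussBinom_self (q : k) (m : ℕ) : gaussBinom q m m = 1 := by
  induction m with
  | zero => rfl
  | succ m ih => simp [gaussBinom, ih, gaussBinom_eq_zero q m (m + 1) (by omega)]

theorem gaussBinom_absorb (q : k) (m j : ℕ) :
    (∑ i ∈ Finset.range (j + 1), q ^ i) * gaussBinom q (m + 1) (j + 1) =
      (∑ i ∈ Finset.range (m + 1), q ^ i) * gaussBinom q m j := by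
  have key : ∀ r : ℕ, (∑ i ∈ Finset.range (r + 1), q ^ i) =
      1 + q * ∑ i ∈ Finset.range r, q ^ i := by
    intro r
    rw [Finset.sum_range_succ', Finset.mul_sum]
    simp only [pow_succ', pow_zero]
    ring
  induction m generalizing j with
  | zero => cases j with
    | zero => simp [gaussBinom]
    | succ j => simp [gaussBinom]
  | succ m ih =>
    have e1 : gaussBinom q (m + 1 + 1) (j + 1) =
        gaussBinom q (m + 1) j + q ^ (j + 1) * gaussBinom q (m + 1) (j + 1) := rfl
    have e2 := ih j
    cases j with
    | zero =>
      have e3 : gaussBinom q (m + 1) 0 = 1 := rfl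
      have e4 : gaussBinom q m 0 = 1 := by cases m <;> rfl
      rw [e4] at e2
      rw [e1, e3, key (m + 1)]
      simp only [zero_add, Finset.range_one, Finset.sum_singleton, pow_zero, one_mul, pow_one,
        mul_one] at e2 ⊢
      rw [e2]
    | succ j =>
      have e3 := ih j
      have e4 : gaussBinom q (m + 1) (j + 1) =
        gaussBinom q m j + q ^ (j + 1) * gaussBinom q m (j + 1) := rfl
      rw [e1, key (m + 1), mul_add, mul_left_comm, e2]
      rw [key (j + 1)]
      linear_combination q * e3 - q * (∑ i ∈ Finset.range (m + 1), q ^ i) * e4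

theorem gaussBinom_middle (q : k) (N j : ℕ) (hN : orderOf q = N) (h0 : 0 < j) (hj : j < N) :
    gaussBinom q N j = 0 := by
  obtain ⟨j, rfl⟩ : ∃ i, j = i + 1 := ⟨j - 1, by omega⟩
  obtain ⟨N, rfl⟩ : ∃ i, N = i + 1 := ⟨N - 1, by omega⟩
  have hq : q ≠ 1 := by
    rintro rfl
    rw [orderOf_one] at hN
    omega
  have h := gaussBinom_absorb q N j
  rw [geom_sum_eq hq, geom_sum_eq hq, ← hN, pow_orderOf_eq_one, hN] at h
  simp only [sub_self, zero_div, zero_mul, mul_eq_zero, div_eq_zero_iff, sub_eq_zero, hq,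
    or_false] at h
  refine h.resolve_left fun h' => ?_
  have := orderOf_le_of_pow_eq_one (by omega) h'
  omega

theorem add_pow_of_skew {A : Type*} [Ring A] [Algebra k A] (q : k) (X Y : A)
    (h : Y * X = q • (X * Y)) (m : ℕ) :
    (X + Y) ^ m = ∑ j ∈ Finset.range (m + 1), gaussBinom q m j • (X ^ j * Y ^ (m - j)) := by
  have hp : ∀ j : ℕ, Y * X ^ j = q ^ j • (X ^ j * Y) := by
    intro j
    induction j with
    | zero => simp
    | succ j ih =>
      rw [pow_succ, ← mul_assoc, ih, smul_mul_assoc, mul_assoc, h, mul_smul_comm, smul_smul,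
        pow_succ, mul_assoc]
  induction m with
  | zero => simp [gaussBinom]
  | succ m ih =>
    rw [pow_succ', ih, add_mul, Finset.mul_sum, Finset.mul_sum]
    have hY : ∀ j ∈ Finset.range (m + 1), Y * gaussBinom q m j • (X ^ j * Y ^ (m - j)) =
        (q ^ j * gaussBinom q m j) • (X ^ j * Y ^ (m + 1 - j)) := by
      intro j hj
      rw [Finset.mem_range] at hj
      rw [mul_smul_comm, ← mul_assoc, hp, smul_mul_assoc, mul_assoc, ← pow_succ', smul_smul,
        mul_comm (q ^ j), show m - j + 1 = m + 1 - j by omega]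
    rw [Finset.sum_congr rfl hY]
    rw [Finset.sum_range_succ' (fun j => (q ^ j * gaussBinom q m j) • (X ^ j * Y ^ (m + 1 - j)))]
    rw [Finset.sum_range_succ' (fun j => gaussBinom q (m + 1) j • (X ^ j * Y ^ (m + 1 - j)))]
    have e : ∀ j, gaussBinom q (m + 1) (j + 1) • (X ^ (j + 1) * Y ^ (m + 1 - (j + 1))) =
        X * gaussBinom q m j • (X ^ j * Y ^ (m - j)) +
        (q ^ (j + 1) * gaussBinom q m (j + 1)) • (X ^ (j + 1) * Y ^ (m + 1 - (j + 1))) := by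
      intro j
      rw [gaussBinom, add_smul, mul_smul_comm, ← mul_assoc, ← pow_succ',
        Nat.add_sub_add_right]
    rw [Finset.sum_congr rfl fun j _ => e j, Finset.sum_add_distrib,
      Finset.sum_range_succ (fun j => (q ^ (j + 1) * gaussBinom q m (j + 1)) •
        (X ^ (j + 1) * Y ^ (m + 1 - (j + 1)))) m,
      gaussBinom_eq_zero q m (m + 1) (by omega)]
    have e4 : gaussBinom q m 0 = 1 := by cases m <;> rfl
    have e5 : gaussBinom q (m + 1) 0 = 1 := rfl
    simp [e4, e5, add_assoc]

/-- If `Y X = q X Y` with `q` of order `N > 0`, then `(X + Y)ᴺ = Xᴺ + Yᴺ`. -/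
theorem add_pow_orderOf {A : Type*} [Ring A] [Algebra k A] (q : k) (X Y : A)
    (h : Y * X = q • (X * Y)) (N : ℕ) (hN : orderOf q = N) (h0 : 0 < N) :
    (X + Y) ^ N = X ^ N + Y ^ N := by
  rw [add_pow_of_skew q X Y h N, Finset.sum_range_succ, gaussBinom_self]
  obtain ⟨M, rfl⟩ : ∃ i, N = i + 1 := ⟨N - 1, by omega⟩
  rw [Finset.sum_range_succ', Finset.sum_eq_zero]
  · have e5 : gaussBinom q (M + 1) 0 = 1 := rfl
    simp [e5, add_comm]
  · intro j hj
    rw [Finset.mem_range] at hj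
    rw [gaussBinom_middle q _ _ hN (by omega) (by omega), zero_smul]

theorem orderOf_ρ : orderOf D.ρ = D.n := orderOf_units

theorem ρ_pow_n : D.ρ ^ D.n = 1 := by rw [← D.orderOf_ρ, pow_orderOf_eq_one]

/-- The map `g ↦ g ⊗ g`. -/
noncomputable def diag : G →* D.RankOne ⊗[k] D.RankOne where
  toFun g := D.gp g ⊗ₜ D.gp g
  map_one' := by rw [map_one, Algebra.TensorProduct.one_def]
  map_mul' g h := by rw [map_mul, Algebra.TensorProduct.tmul_mul_tmul]

theorem diag_apply (g : G) : D.diag g = D.gp g ⊗ₜ D.gp g := rfl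

theorem x_mul_gp_pow (m : ℕ) : (D.x * D.gp D.a⁻¹) ^ m =
    D.ρ ^ (m * (m - 1) / 2) • (D.x ^ m * D.gp D.a⁻¹ ^ m) := by
  have h1 : D.gp D.a⁻¹ * D.x = D.ρ • (D.x * D.gp D.a⁻¹) := by
    rw [x_mul_gp, smul_smul, map_inv D.χ]
    simp [ρ]
  have h2 : ∀ m : ℕ, D.gp D.a⁻¹ ^ m * D.x = D.ρ ^ m • (D.x * D.gp D.a⁻¹ ^ m) := by
    intro m
    induction m with
    | zero => simp
    | succ m ih =>
      rw [pow_succ, mul_assoc, h1, mul_smul_comm, ← mul_assoc, ih, smul_mul_assoc, smul_smul,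
        mul_assoc, pow_succ' D.ρ]
  induction m with
  | zero => simp
  | succ m ih =>
    have e : (m + 1) * (m + 1 - 1) / 2 = m * (m - 1) / 2 + m := by
      rw [← Finset.sum_range_id_mul_two, ← Finset.sum_range_id_mul_two, Nat.mul_div_cancel _ two_pos,
        Nat.mul_div_cancel _ two_pos, Finset.sum_range_succ]
    rw [pow_succ, ih, smul_mul_assoc, mul_assoc, ← mul_assoc (D.gp D.a⁻¹ ^ m), h2, e,
      smul_mul_assoc, mul_smul_comm, smul_smul, pow_add, pow_succ D.x, pow_succ (D.gp D.a⁻¹)]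
    simp only [mul_assoc]

/-- The map `g ↦ g⁻¹` into the opposite algebra. -/
noncomputable def invHom : G →* D.RankOneᵐᵒᵖ where
  toFun g := MulOpposite.op (D.gp g⁻¹)
  map_one' := by simp
  map_mul' g h := by
    rw [← MulOpposite.op_mul, ← map_mul, mul_inv_rev]

theorem invHom_apply (g : G) : D.invHom g = MulOpposite.op (D.gp g⁻¹) := rfl

/-- Left multiplication by group elements in the coordinates of the basis `g xʲ`. -/
noncomputable def regG : G →* Module.End k (G × Fin D.n →₀ k) where
  toFun g := Finsupp.lmapDomain k k fun p => (g * p.1, p.2)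
  map_one' := by ext; simp
  map_mul' g h := by
    apply Finsupp.lhom_ext
    intro p c
    simp [Finsupp.mapDomain_single, mul_assoc]

theorem regG_single (g h : G) (j : Fin D.n) (c : k) :
    D.regG g (Finsupp.single (h, j) c) = Finsupp.single (g * h, j) c := by
  simp [regG, Finsupp.mapDomain_single]

theorem χ_a_pow_n : (D.χ (D.a ^ D.n) : k) = 1 := by
  rw [map_pow]; exact D.ρ_pow_n

theorem single_compat (g : G) (j : Fin D.n) (c : k) :
    Finsupp.single (g * D.a ^ D.n, j) ((D.χ g : k) ^ D.n * D.α * c) -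
      Finsupp.single (g, j) ((D.χ g : k) ^ D.n * D.α * c) =
    Finsupp.single (g * D.a ^ D.n, j) (D.α * c) - Finsupp.single (g, j) (D.α * c) := by
  rcases D.compat with h | h
  · have : (D.χ g : k) ^ D.n = 1 := by
      have := DFunLike.congr_fun h g
      rw [MonoidHom.pow_apply] at this
      rw [← Units.val_pow_eq_pow_val]
      exact congrArg Units.val this
    simp [this]
  · rcases smul_eq_zero.mp h with h | h
    · simp [h]
    · have : D.a ^ D.n = 1 := by
        apply MonoidAlgebra.of_injective (R := k)
        rw [map_one]
        exact sub_eq_zero.mp h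
      simp [this]

/-- The set `Λ` of characters of `G × Γ`, where `Γ = Hom(G, kˣ)`. -/
abbrev Weight (_D : GroupDatum k G) : Type (max u v) := G × (G →* kˣ) →* kˣ

variable [Finite G]

theorem n_pos : 0 < D.n := by
  have h : IsOfFinOrder (D.χ D.a) := D.χ.isOfFinOrder (isOfFinOrder_of_finite D.a)
  exact h.orderOf_pos

/-- The comultiplication: `Δ(g) = g ⊗ g`, `Δ(x) = x ⊗ a + 1 ⊗ x`. -/
noncomputable def comulHom : D.RankOne →ₐ[k] D.RankOne ⊗[k] D.RankOne :=
  D.liftHom D.diag (D.x ⊗ₜ D.gp D.a + 1 ⊗ₜ D.x)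
    (fun g => by
      simp only [diag_apply, add_mul, mul_add,
        Algebra.TensorProduct.tmul_mul_tmul, x_mul_gp, one_mul, mul_one, smul_add,
        TensorProduct.tmul_smul, TensorProduct.smul_tmul']
      rw [← map_mul, ← map_mul, mul_comm])
    (by
      rw [add_pow_orderOf D.ρ _ _ ?_ D.n D.orderOf_ρ D.n_pos]
      · simp only [diag_apply, Algebra.TensorProduct.tmul_pow, x_pow_n,
          one_pow, Algebra.TensorProduct.one_def, smul_sub, TensorProduct.sub_tmul,
          TensorProduct.tmul_sub, TensorProduct.smul_tmul', TensorProduct.tmul_smul]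
        abel
      · simp only [Algebra.TensorProduct.tmul_mul_tmul, one_mul, mul_one, x_mul_gp,
          TensorProduct.tmul_smul]
        rfl)

/-- The counit: `ε(g) = 1`, `ε(x) = 0`. -/
noncomputable def counitHom : D.RankOne →ₐ[k] k :=
  D.liftHom 1 0 (by simp) (by simp [D.n_pos.ne'])

noncomputable instance : Bialgebra k D.RankOne :=
  Bialgebra.ofAlgHom D.comulHom D.counitHom
    (by
      apply D.hom_ext
      · intro y; simp [comulHom, diag_apply]
      · simp [comulHom, diag_apply, TensorProduct.add_tmul, TensorProduct.tmul_add,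
          Algebra.TensorProduct.one_def, add_assoc])
    (by
      apply D.hom_ext
      · intro y; simp [comulHom, counitHom, diag_apply]
      · simp [comulHom, counitHom])
    (by
      apply D.hom_ext
      · intro y; simp [comulHom, counitHom, diag_apply]
      · simp [comulHom, counitHom])

theorem comul_gp (g : G) : Coalgebra.comul (R := k) (D.gp g) = D.gp g ⊗ₜ D.gp g :=
  D.liftHom_gp _ _ _ _ g

theorem comul_x : Coalgebra.comul (R := k) D.x = D.x ⊗ₜ D.gp D.a + 1 ⊗ₜ D.x :=
  D.liftHom_x _ _ _ _

theorem counit_gp (g : G) : Coalgebra.counit (R := k) (D.gp g) = 1 := D.liftHom_gp _ _ _ _ g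

theorem counit_x : Coalgebra.counit (R := k) D.x = 0 := D.liftHom_x _ _ _ _

/-! The antipode of `H_D` -/

theorem neg_one_pow_mul_ρ_pow : (-1 : k) ^ D.n * D.ρ ^ (D.n * (D.n - 1) / 2) = -1 := by
  have h1 := D.ρ_pow_n
  have h0 := D.n_pos
  rcases Nat.even_or_odd D.n with h | h
  · obtain ⟨r, hr⟩ := h
    have hr' : D.ρ ^ r = -1 := by
      have h2 : (D.ρ ^ r) ^ 2 = 1 := by rw [← pow_mul, mul_two, ← hr, h1]
      rcases (mul_self_eq_one_iff.mp ((pow_two _).symm.trans h2)) with h3 | h3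
      · have := orderOf_le_of_pow_eq_one (by omega) h3
        rw [D.orderOf_ρ] at this
        omega
      · exact h3
    have e : D.n * (D.n - 1) / 2 = r * (2 * (r - 1) + 1) := by
      rw [hr]
      have : (r + r) * (r + r - 1) = 2 * (r * (2 * (r - 1) + 1)) := by
        have : r + r - 1 = 2 * (r - 1) + 1 := by omega
        rw [this]; ring
      omega
    rw [e, pow_mul, hr', pow_succ, pow_mul, hr, ← two_mul, pow_mul]
    simp
  · obtain ⟨r, hr⟩ := h
    have e : D.n * (D.n - 1) / 2 = D.n * r := by
      have : D.n * (D.n - 1) = 2 * (D.n * r) := by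
        rw [hr]; simp; ring
      omega
    rw [e, pow_mul, h1, one_pow, hr, pow_succ, pow_mul]
    simp

/-- The antipode `S(g) = g⁻¹`, `S(x) = -x a⁻¹`, as a homomorphism to the opposite algebra. -/
noncomputable def antipodeHom : D.RankOne →ₐ[k] D.RankOneᵐᵒᵖ :=
  D.liftHom D.invHom (MulOpposite.op (-(D.x * D.gp D.a⁻¹)))
    (fun g => by
      rw [invHom_apply, ← MulOpposite.op_mul, ← MulOpposite.op_mul, ← MulOpposite.op_smul]
      congr 1
      rw [mul_neg, neg_mul, smul_neg, mul_assoc, ← map_mul, mul_comm D.a⁻¹, map_mul, ← mul_assoc,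
        ← mul_assoc, x_mul_gp, smul_mul_assoc, smul_smul, map_inv D.χ]
      simp)
    (by
      rw [invHom_apply, ← MulOpposite.op_pow, ← MulOpposite.op_pow, ← MulOpposite.op_one,
        ← MulOpposite.op_sub, ← MulOpposite.op_smul]
      congr 1
      have h1 : D.gp D.a ^ D.n * D.gp D.a⁻¹ ^ D.n = 1 := by
        rw [← map_pow, ← map_pow, ← map_mul, ← mul_pow]; simp
      rw [neg_pow, x_mul_gp_pow, x_pow_n, smul_mul_assoc, sub_mul, h1, one_mul, mul_smul_comm]
      have h2 := D.neg_one_pow_mul_ρ_pow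
      have h3 : (-1 : D.RankOne) ^ D.n = ((-1 : k) ^ D.n) • 1 := by
        rw [← Algebra.algebraMap_eq_smul_one]; simp
      rw [h3, smul_mul_assoc, one_mul, smul_smul, smul_smul, mul_comm (D.ρ ^ _), h2, neg_one_mul,
        neg_smul, ← smul_neg, neg_sub])

/-- The antipode of `H_D`. -/
noncomputable def antipodeMap : D.RankOne →ₗ[k] D.RankOne :=
  (MulOpposite.opLinearEquiv k).symm.toLinearMap ∘ₗ D.antipodeHom.toLinearMap

theorem antipodeMap_mul (y z : D.RankOne) :
    D.antipodeMap (y * z) = D.antipodeMap z * D.antipodeMap y := by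
  simp [antipodeMap]

theorem antipodeMap_one : D.antipodeMap 1 = 1 := by simp [antipodeMap]

theorem antipodeMap_gp (g : G) : D.antipodeMap (D.gp g) = D.gp g⁻¹ := by
  simp [antipodeMap, antipodeHom, invHom_apply]

theorem antipodeMap_x : D.antipodeMap D.x = -(D.x * D.gp D.a⁻¹) := by
  simp [antipodeMap, antipodeHom]

theorem antipode_left (h : D.RankOne) :
    LinearMap.mul' k D.RankOne (D.antipodeMap.rTensor D.RankOne (Coalgebra.comul h)) =
      algebraMap k D.RankOne (Coalgebra.counit h) := by
  have hh : h ∈ Algebra.adjoin k (Set.range D.gp ∪ {D.x}) := by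
    rw [D.adjoin_eq_top]; trivial
  induction hh using Algebra.adjoin_induction with
  | mem y hy =>
    rcases hy with ⟨g, rfl⟩ | rfl
    · simp [comul_gp, counit_gp, antipodeMap_gp, ← map_mul]
    · simp [comul_x, counit_x, antipodeMap_x, antipodeMap_one, mul_assoc, ← map_mul]
  | algebraMap r =>
    simp [Algebra.algebraMap_eq_smul_one,
      Algebra.TensorProduct.one_def, antipodeMap_one]
  | add y z _ _ hy hz => simp [hy, hz]
  | mul y z _ _ hy hz =>
    have key : ∀ z' w : D.RankOne ⊗[k] D.RankOne, ∀ c : k,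
        LinearMap.mul' k D.RankOne (D.antipodeMap.rTensor D.RankOne z') = algebraMap k _ c →
        LinearMap.mul' k D.RankOne (D.antipodeMap.rTensor D.RankOne (z' * w)) =
          c • LinearMap.mul' k D.RankOne (D.antipodeMap.rTensor D.RankOne w) := by
      intro z' w c hc
      induction w with
      | zero => simp
      | add p q hp hq => simp only [mul_add, map_add, hp, hq, smul_add]
      | tmul p q =>
        have e : LinearMap.mul' k D.RankOne (D.antipodeMap.rTensor D.RankOne (z' * p ⊗ₜ q)) =
            D.antipodeMap p *
              LinearMap.mul' k D.RankOne (D.antipodeMap.rTensor D.RankOne z') * q := by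
          clear hc
          induction z' with
          | zero => simp
          | add p q hp hq => simp only [add_mul, mul_add, map_add, hp, hq]
          | tmul r s => simp [antipodeMap_mul, mul_assoc]
        rw [e, hc, ← Algebra.commutes, mul_assoc, ← Algebra.smul_def]
        simp
    rw [Bialgebra.comul_mul, key _ _ _ hy, hz, Bialgebra.counit_mul, map_mul, Algebra.smul_def]

theorem antipode_right (h : D.RankOne) :
    LinearMap.mul' k D.RankOne (D.antipodeMap.lTensor D.RankOne (Coalgebra.comul h)) =
      algebraMap k D.RankOne (Coalgebra.counit h) := by
  have hh : h ∈ Algebra.adjoin k (Set.range D.gp ∪ {D.x}) := by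
    rw [D.adjoin_eq_top]; trivial
  induction hh using Algebra.adjoin_induction with
  | mem y hy =>
    rcases hy with ⟨g, rfl⟩ | rfl
    · simp [comul_gp, counit_gp, antipodeMap_gp, ← map_mul]
    · simp [comul_x, counit_x, antipodeMap_x, antipodeMap_gp]
  | algebraMap r =>
    simp [Algebra.algebraMap_eq_smul_one,
      Algebra.TensorProduct.one_def, antipodeMap_one]
  | add y z _ _ hy hz => simp [hy, hz]
  | mul y z _ _ hy hz =>
    have key : ∀ z' w : D.RankOne ⊗[k] D.RankOne, ∀ c : k,
        LinearMap.mul' k D.RankOne (D.antipodeMap.lTensor D.RankOne w) = algebraMap k _ c →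
        LinearMap.mul' k D.RankOne (D.antipodeMap.lTensor D.RankOne (z' * w)) =
          c • LinearMap.mul' k D.RankOne (D.antipodeMap.lTensor D.RankOne z') := by
      intro z' w c hc
      induction z' with
      | zero => simp
      | add p q hp hq => simp only [add_mul, map_add, hp, hq, smul_add]
      | tmul p q =>
        have e : LinearMap.mul' k D.RankOne (D.antipodeMap.lTensor D.RankOne (p ⊗ₜ q * w)) =
            p * LinearMap.mul' k D.RankOne (D.antipodeMap.lTensor D.RankOne w) *
              D.antipodeMap q := by
          clear hc
          induction w with
          | zero => simp
          | add p q hp hq => simp only [add_mul, mul_add, map_add, hp, hq]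
          | tmul r s => simp [antipodeMap_mul, mul_assoc]
        rw [e, hc, ← Algebra.commutes, mul_assoc, ← Algebra.smul_def]
        simp
    rw [Bialgebra.comul_mul, key _ _ _ hz, hy, Bialgebra.counit_mul, map_mul, ← map_mul,
      mul_comm, map_mul, Algebra.smul_def]

/-- The pointed rank one Hopf algebra `H_D`. -/
noncomputable instance : HopfAlgebra k D.RankOne where
  antipode := D.antipodeMap
  mul_antipode_rTensor_comul := LinearMap.ext D.antipode_left
  mul_antipode_lTensor_comul := LinearMap.ext D.antipode_right

/-! The basis `{g xʲ | g ∈ G, 0 ≤ j < n}` of `H_D` -/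

/-- Left multiplication by `x` in the coordinates of the basis `g xʲ`. -/
noncomputable def regX : Module.End k (G × Fin D.n →₀ k) :=
  Finsupp.linearCombination k fun p : G × Fin D.n =>
    if h : (p.2 : ℕ) + 1 < D.n then
      Finsupp.single (p.1, (⟨p.2 + 1, h⟩ : Fin D.n)) (D.χ p.1 : k)
    else
      Finsupp.single (p.1 * D.a ^ D.n, (⟨0, D.n_pos⟩ : Fin D.n)) ((D.χ p.1 : k) * D.α) -
        Finsupp.single (p.1, (⟨0, D.n_pos⟩ : Fin D.n)) ((D.χ p.1 : k) * D.α)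

theorem regX_single_lt (g : G) (j : ℕ) (hj : j + 1 < D.n) (c : k) :
    D.regX (Finsupp.single (g, (⟨j, by omega⟩ : Fin D.n)) c) =
      Finsupp.single (g, (⟨j + 1, hj⟩ : Fin D.n)) ((D.χ g : k) * c) := by
  simp [regX, hj, mul_comm]

theorem regX_single_last (g : G) (j : ℕ) (hj : j + 1 = D.n) (c : k) :
    D.regX (Finsupp.single (g, (⟨j, by omega⟩ : Fin D.n)) c) =
      Finsupp.single (g * D.a ^ D.n, (⟨0, D.n_pos⟩ : Fin D.n)) ((D.χ g : k) * D.α * c) -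
        Finsupp.single (g, (⟨0, D.n_pos⟩ : Fin D.n)) ((D.χ g : k) * D.α * c) := by
  rw [regX, Finsupp.linearCombination_single, dif_neg (by simp only; omega), smul_sub,
    Finsupp.smul_single, Finsupp.smul_single, smul_eq_mul, mul_comm c]

theorem regX_pow_single (g : G) (j : ℕ) (hj : j < D.n) (c : k) :
    (D.regX ^ j) (Finsupp.single (g, (⟨0, D.n_pos⟩ : Fin D.n)) c) =
      Finsupp.single (g, (⟨j, hj⟩ : Fin D.n)) ((D.χ g : k) ^ j * c) := by
  induction j with
  | zero => simp
  | succ j ih =>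
    rw [pow_succ', Module.End.mul_apply, ih (by omega), regX_single_lt _ _ _ hj, pow_succ',
      mul_assoc]

theorem regX_pow_n : D.regX ^ D.n = D.α • (D.regG D.a ^ D.n - 1) := by
  have h0 : ∀ (g : G) (c : k), (D.regX ^ D.n) (Finsupp.single (g, (⟨0, D.n_pos⟩ : Fin D.n)) c) =
      Finsupp.single (g * D.a ^ D.n, (⟨0, D.n_pos⟩ : Fin D.n)) (D.α * c) -
        Finsupp.single (g, (⟨0, D.n_pos⟩ : Fin D.n)) (D.α * c) := by
    intro g c
    obtain ⟨N, hN⟩ : ∃ N, N + 1 = D.n := ⟨D.n - 1, by have := D.n_pos; omega⟩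
    have e : D.regX ^ D.n = D.regX * D.regX ^ N := by
      rw [← pow_succ']
      exact congrArg (fun i => D.regX ^ i) hN.symm
    have e' : (D.χ g : k) ^ D.n = (D.χ g : k) * (D.χ g : k) ^ N := by
      rw [← pow_succ']
      exact congrArg (fun i => (D.χ g : k) ^ i) hN.symm
    rw [e, Module.End.mul_apply, regX_pow_single _ _ _ (by omega), regX_single_last _ _ _ hN,
      ← single_compat, e']
    congr 2 <;> ring
  apply Finsupp.lhom_ext
  rintro ⟨g, j, hj⟩ c
  have e : Finsupp.single (g, (⟨j, hj⟩ : Fin D.n)) c =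
      (D.regX ^ j) (Finsupp.single (g, (⟨0, D.n_pos⟩ : Fin D.n)) (((D.χ g : k) ^ j)⁻¹ * c)) := by
    rw [regX_pow_single _ _ _ hj, mul_inv_cancel_left₀ (pow_ne_zero _ (Units.ne_zero _))]
  rw [e, ← Module.End.mul_apply, ← pow_add, add_comm, pow_add, Module.End.mul_apply, h0, map_sub,
    regX_pow_single _ _ _ hj, regX_pow_single _ _ _ hj, regX_pow_single _ _ _ hj,
    ← map_pow, LinearMap.smul_apply, LinearMap.sub_apply, regG_single, Module.End.one_apply,
    smul_sub, Finsupp.smul_single, Finsupp.smul_single, map_mul, Units.val_mul, χ_a_pow_n,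
    mul_one, mul_comm g]
  simp only [smul_eq_mul]
  congr 2 <;> ring

theorem regX_mul_regG (g : G) : D.regX * D.regG g = (D.χ g : k) • (D.regG g * D.regX) := by
  apply Finsupp.lhom_ext
  rintro ⟨h, j, hj⟩ c
  rw [LinearMap.smul_apply, Module.End.mul_apply, Module.End.mul_apply, regG_single]
  rcases lt_or_eq_of_le (Nat.succ_le_of_lt hj) with h' | h'
  · rw [regX_single_lt _ _ _ h', regX_single_lt _ _ _ h', regG_single, Finsupp.smul_single]
    simp [mul_assoc]
  · rw [regX_single_last _ _ _ h', regX_single_last _ _ _ h', map_sub, regG_single,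
      regG_single, smul_sub, Finsupp.smul_single, Finsupp.smul_single]
    simp [mul_assoc]

/-- The regular representation of `H_D` in coordinates. -/
noncomputable def reg : D.RankOne →ₐ[k] Module.End k (G × Fin D.n →₀ k) :=
  D.liftHom D.regG D.regX (fun g => by rw [regX_mul_regG]) (by rw [regX_pow_n])

theorem reg_gp_mul_x_pow (g : G) (j : Fin D.n) :
    D.reg (D.gp g * D.x ^ (j : ℕ)) (Finsupp.single (1, (⟨0, D.n_pos⟩ : Fin D.n)) 1) =
      Finsupp.single (g, j) 1 := by
  obtain ⟨j, hj⟩ := j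
  simp only [reg, map_mul, map_pow, liftHom_gp, liftHom_x]
  rw [Module.End.mul_apply, regX_pow_single _ _ _ hj, regG_single]
  simp

theorem linearIndependent_gp_mul_x_pow :
    LinearIndependent k fun p : G × Fin D.n => D.gp p.1 * D.x ^ (p.2 : ℕ) := by
  apply LinearIndependent.of_comp
    ((LinearMap.applyₗ (Finsupp.single (1, (⟨0, D.n_pos⟩ : Fin D.n)) (1 : k))) ∘ₗ
      D.reg.toLinearMap)
  have : (((LinearMap.applyₗ (Finsupp.single (1, (⟨0, D.n_pos⟩ : Fin D.n)) (1 : k))) ∘ₗ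
      D.reg.toLinearMap) ∘ fun p : G × Fin D.n => D.gp p.1 * D.x ^ (p.2 : ℕ)) =
      fun p => Finsupp.single p (1 : k) := by
    funext p
    exact D.reg_gp_mul_x_pow p.1 p.2
  rw [this]
  exact Finsupp.linearIndependent_single_one k _

theorem span_gp_mul_x_pow :
    ⊤ ≤ Submodule.span k (Set.range fun p : G × Fin D.n => D.gp p.1 * D.x ^ (p.2 : ℕ)) := by
  set W := Submodule.span k (Set.range fun p : G × Fin D.n => D.gp p.1 * D.x ^ (p.2 : ℕ)) with hW
  have hmem : ∀ (g : G) (j : ℕ), j < D.n → D.gp g * D.x ^ j ∈ W := fun g j hj =>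
    Submodule.subset_span ⟨(g, ⟨j, hj⟩), rfl⟩
  have hstab : ∀ h : D.RankOne, ∀ w ∈ W, h * w ∈ W := by
    intro h
    have hh : h ∈ Algebra.adjoin k (Set.range D.gp ∪ {D.x}) := by
      rw [D.adjoin_eq_top]; trivial
    induction hh using Algebra.adjoin_induction with
    | mem y hy =>
      intro w hw
      induction hw using Submodule.span_induction with
      | zero => simp
      | add _ _ _ _ h1 h2 => rw [mul_add]; exact W.add_mem h1 h2
      | smul c _ _ h1 => rw [mul_smul_comm]; exact W.smul_mem c h1
      | mem w hw =>
        obtain ⟨⟨g, j, hj⟩, rfl⟩ := hw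
        rcases hy with ⟨g', rfl⟩ | rfl
        · simp only
          rw [← mul_assoc, ← map_mul]
          exact hmem _ _ hj
        · simp only
          rw [← mul_assoc, x_mul_gp, smul_mul_assoc, mul_assoc, ← pow_succ']
          apply W.smul_mem
          rcases lt_or_eq_of_le (Nat.succ_le_of_lt hj) with h' | h'
          · exact hmem _ _ h'
          · rw [show j + 1 = D.n from h', x_pow_n, mul_smul_comm, mul_sub, ← map_pow, ← map_mul,
              mul_one]
            apply W.smul_mem
            apply W.sub_mem
            · simpa using hmem (g * D.a ^ D.n) 0 D.n_pos
            · simpa using hmem g 0 D.n_pos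
    | algebraMap r =>
      intro w hw
      rw [← Algebra.smul_def]; exact W.smul_mem r hw
    | add y z _ _ hy hz => intro w hw; rw [add_mul]; exact W.add_mem (hy w hw) (hz w hw)
    | mul y z _ _ hy hz => intro w hw; rw [mul_assoc]; exact hy _ (hz w hw)
  intro h _
  have h1 : (1 : D.RankOne) ∈ W := by simpa using hmem 1 0 D.n_pos
  simpa using hstab h 1 h1

/-- The basis `{g xʲ | g ∈ G, 0 ≤ j < n}` of `H_D`. -/
noncomputable def basis : Module.Basis (G × Fin D.n) k D.RankOne :=
  Module.Basis.mk D.linearIndependent_gp_mul_x_pow D.span_gp_mul_x_pow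

theorem basis_apply (g : G) (j : Fin D.n) : D.basis (g, j) = D.gp g * D.x ^ (j : ℕ) := by
  simp [basis]

/-! The Drinfeld double of `H_D` and its simple modules -/

/-- The element `γ ∈ H_D^*` attached to a character `γ` of `G`: `γ(g xʲ) = γ(g)` if `j = 0`, and
`γ(g xʲ) = 0` if `0 < j < n`. -/
noncomputable def chFun (γ : G →* kˣ) : Module.Dual k D.RankOne :=
  D.basis.constr k fun p => if (p.2 : ℕ) = 0 then (γ p.1 : k) else 0

/-- The element `ξ ∈ H_D^*`: `ξ(g xʲ) = 1` if `j = 1`, and `ξ(g xʲ) = 0` for the other `j < n`. -/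
noncomputable def ξFun : Module.Dual k D.RankOne :=
  D.basis.constr k fun p => if (p.2 : ℕ) = 1 then 1 else 0

/-- The Drinfeld double `D(H_D)`. -/
abbrev Double : Type (max u v) := DrinfeldDouble k D.RankOne

/-- `g ∈ G` as an element of `D(H_D)`. -/
noncomputable def dG (g : G) : D.Double := DrinfeldDouble.ofElt k D.RankOne (D.gp g)

/-- `x` as an element of `D(H_D)`. -/
noncomputable def dX : D.Double := DrinfeldDouble.ofElt k D.RankOne D.x

/-- `γ ∈ Γ = Hom(G, kˣ)` as an element of `D(H_D)`. -/
noncomputable def dΓ (γ : G →* kˣ) : D.Double := DrinfeldDouble.ofFun k D.RankOne (D.chFun γ)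

/-- `ξ` as an element of `D(H_D)`. -/
noncomputable def dΞ : D.Double := DrinfeldDouble.ofFun k D.RankOne D.ξFun

/-- The left ideal of `D(H_D)` generated by `ξ`, the `g - λ(g)` and the `γ - λ(γ)`. -/
noncomputable def vermaIdeal (wt : D.Weight) : Ideal D.Double :=
  Ideal.span ({D.dΞ} ∪ (Set.range fun g : G => D.dG g - algebraMap k _ (wt (g, 1) : k)) ∪
    (Set.range fun γ : G →* kˣ => D.dΓ γ - algebraMap k _ (wt (1, γ) : k)))

/-- `Z(λ) = D(H_D) ⊗_B k_λ`, where `B` is the subalgebra generated by `H_D^*` and `G` and `k_λ` is the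
one-dimensional `B`-module on which `ξ` acts as zero and `G × Γ` through `λ`. As the kernel of
`B → k_λ` is generated by `ξ`, the `g - λ(g)` and the `γ - λ(γ)`, this is the quotient of `D(H_D)` by
the left ideal generated by these elements. -/
abbrev Verma (wt : D.Weight) : Type (max u v) := D.Double ⧸ D.vermaIdeal wt

/-- `L(λ) = Z(λ) / rad Z(λ)`. For `λ ∈ I_l` this is the simple module `V(l, λ)`. -/
abbrev simpleModule (wt : D.Weight) : Type (max u v) :=
  D.Verma wt ⧸ Module.jacobson D.Double (D.Verma wt)

/-- `I_l = {λ ∈ Λ | λ(a χ⁻¹) = ρ^(l-1)}`, for `1 ≤ l ≤ n - 1`. -/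
def weightSet (l : ℕ) : Set D.Weight := {wt | (wt (D.a, D.χ⁻¹) : k) = D.ρ ^ (l - 1)}

/-- `V(l, λ)` for `1 ≤ l ≤ n - 1` and `λ ∈ I_l`, as an object of the category of modules. -/
noncomputable def V (l : ℕ) (wt : D.weightSet l) : ModuleCat.{max u v} D.Double :=
  ModuleCat.of D.Double (D.simpleModule wt.1)

end GroupDatum

/-! The proof has a homological half and a representation-theoretic half, joined by `HasDiamonds`.

Homological half. Suppose that over an artinian ring every nonprojective simple module is both the
head and the socle of a projective and injective module of length four whose middle radical layer
has length two. Finite sums of such modules are the diamonds of `IsDiamond`. Let `M` be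
indecomposable of Loewy length two with head of length `s` and socle of length `t`; here socle and
radical coincide. Its projective cover `P` is a diamond with `rad² P ≤ ΩM ≤ rad P`. Counting
lengths, `ΩM` has length `3s - t`, and if it is not simple its radical is `rad² P`, so it has type
`(2s - t, s)`. It is again indecomposable, and `P` is its injective envelope, so `M` is the cosyzygy
of `ΩM`. If `s < t`, passing to `ΩM` keeps the difference `t - s` and lowers `s`, so the descent
must stop at a simple module. There `s = 1` and `t = 2`, so the difference was always one and `M` is
the `s`-th cosyzygy of a simple module (`HasDiamonds.isIteratedCosyzygy_of_lt`). The case `t < s` is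
dual, with injective envelopes.

Representation-theoretic half. Adding to `x` a suitable multiple of a correction term divisible by
`ξⁿ⁻¹` gives a weight vector `y` with `yⁿ = 0`, and the double becomes an algebra of the shape
`SkewSl2`, generated by `G × Γ`, `y` and `ξ`. The monomials `yʲ ξⁱ e_λ` span it. The action of the
double on `End H` shows that its dimension is large enough for them to be a basis
(`finrank_double_ge`). The basis provides a nondegenerate Frobenius form, so the algebra is
self-injective (`injective_self`).

A polynomial in the central Casimir element cuts an idempotent `E` out of each `e_λ`
(`exists_idempotent`). The chain of left ideals generated by the `ξⁱ E` can drop only where the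
Casimir value of `λ` recurs: at `i = 0` and, when `λ(a) = ρ^(l-1) λ(χ)` with `1 ≤ l < n`, at `i = n
- l`. Without such an `l` the left ideal of `E` is a simple projective module. With such an `l` it
is an extension of two highest weight modules of dimension `n`, and its submodules are computed to
form a diamond (`IsLinkedGenerator.exists_isDiamond`). Hence the nonprojective simple modules are
among the `V(l, λ)`, and each of them has a diamond. -/

set_option linter.unusedSectionVars false

/-! ### Radical and socle over an artinian ring. -/

section ArtinianModules

variable {R : Type u} [Ring R]

/-- The submodule `J M`, where `J` is the Jacobson radical of the ring. -/
def jacobsonSMulTop (R : Type u) [Ring R] (M : Type w) [AddCommGroup M] [Module R M] :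
    Submodule R M :=
  Ring.jacobson R • ⊤

/-- The submodule `J² M`, where `J` is the Jacobson radical of the ring. -/
def jacobsonSqSMulTop (R : Type u) [Ring R] (M : Type w) [AddCommGroup M] [Module R M] :
    Submodule R M :=
  Ring.jacobson R • jacobsonSMulTop R M

section

variable {M N : Type*} [AddCommGroup M] [Module R M] [AddCommGroup N] [Module R N]

theorem map_jacobsonSMulTop_le (f : M →ₗ[R] N) :
    (jacobsonSMulTop R M).map f ≤ jacobsonSMulTop R N := by
  rw [jacobsonSMulTop, Submodule.map_smul'']
  exact smul_mono_right _ le_top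

theorem map_jacobsonSMulTop (f : M →ₗ[R] N) (hf : Function.Surjective f) :
    (jacobsonSMulTop R M).map f = jacobsonSMulTop R N := by
  rw [jacobsonSMulTop, Submodule.map_smul'', Submodule.map_top, LinearMap.range_eq_top.mpr hf]
  rfl

theorem map_jacobsonSqSMulTop_le (f : M →ₗ[R] N) :
    (jacobsonSqSMulTop R M).map f ≤ jacobsonSqSMulTop R N := by
  rw [jacobsonSqSMulTop, Submodule.map_smul'']
  exact smul_mono_right _ (map_jacobsonSMulTop_le f)

theorem map_jacobsonSqSMulTop (f : M →ₗ[R] N) (hf : Function.Surjective f) :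
    (jacobsonSqSMulTop R M).map f = jacobsonSqSMulTop R N := by
  rw [jacobsonSqSMulTop, Submodule.map_smul'', map_jacobsonSMulTop f hf]
  rfl

theorem map_subtype_jacobsonSMulTop (K : Submodule R M) :
    (jacobsonSMulTop R K).map K.subtype = Ring.jacobson R • K := by
  rw [jacobsonSMulTop, Submodule.map_smul'', Submodule.map_subtype_top]

theorem smul_mem_jacobsonSMulTop {a : R} (ha : a ∈ Ring.jacobson R) (x : M) :
    a • x ∈ jacobsonSMulTop R M :=
  Submodule.smul_mem_smul ha trivial

theorem smul_smul_mem_jacobsonSqSMulTop {a b : R} (ha : a ∈ Ring.jacobson R)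
    (hb : b ∈ Ring.jacobson R) (x : M) : a • b • x ∈ jacobsonSqSMulTop R M :=
  Submodule.smul_mem_smul ha (smul_mem_jacobsonSMulTop hb x)

/-- The largest submodule annihilated by the Jacobson radical of the ring. -/
def jacobsonTorsion (R : Type u) [Ring R] (M : Type w) [AddCommGroup M] [Module R M] :
    Submodule R M where
  carrier := {x | ∀ a ∈ Ring.jacobson R, a • x = 0}
  add_mem' := fun hx hy a ha => by rw [smul_add, hx a ha, hy a ha, add_zero]
  zero_mem' := fun a _ => smul_zero a
  smul_mem' := fun c x hx a ha => by
    rw [smul_smul]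
    exact hx _ (Ideal.mul_mem_right c _ ha)

theorem le_jacobsonTorsion_iff {K : Submodule R M} :
    K ≤ jacobsonTorsion R M ↔ Ring.jacobson R • K = ⊥ := by
  rw [← le_bot_iff, Submodule.smul_le]
  exact ⟨fun h a ha x hx => (Submodule.mem_bot R).mpr (h hx a ha),
    fun h x hx a ha => (Submodule.mem_bot R).mp (h a ha x hx)⟩

theorem le_jacobsonTorsion_of_isSemisimpleModule (K : Submodule R M) [IsSemisimpleModule R K] :
    K ≤ jacobsonTorsion R M := by
  intro x hx a ha
  have := IsSemisimpleModule.jacobson_le_annihilator R K ha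
  have := Module.mem_annihilator.mp this ⟨x, hx⟩
  simpa using congrArg Subtype.val this

theorem le_of_forall_isSimpleModule_le {K L : Submodule R M} [IsSemisimpleModule R K]
    (h : ∀ S ≤ K, IsSimpleModule R S → S ≤ L) : K ≤ L := by
  rw [← Submodule.map_subtype_top K, ← IsSemisimpleModule.sSup_simples_eq_top R K,
    Submodule.map_le_iff_le_comap]
  refine sSup_le fun S hS => ?_
  rw [← Submodule.map_le_iff_le_comap]
  have : IsSimpleModule R S := hS
  exact h _ (Submodule.map_subtype_le K S)
    (IsSimpleModule.congr (Submodule.equivMapOfInjective K.subtype K.subtype_injective S).symm)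

/-- Nakayama's lemma for `M ⧸ K`. -/
theorem eq_top_of_sup_jacobsonSMulTop [Module.Finite R M] {K : Submodule R M}
    (h : K ⊔ jacobsonSMulTop R M = ⊤) : K = ⊤ := by
  have h1 : jacobsonSMulTop R (M ⧸ K) = ⊤ := by
    rw [← map_jacobsonSMulTop K.mkQ K.mkQ_surjective]
    apply Submodule.comap_injective_of_surjective K.mkQ_surjective
    rw [Submodule.comap_map_mkQ, Submodule.comap_top, h]
  have h2 : (⊤ : Submodule R (M ⧸ K)) = ⊥ :=
    Submodule.FG.eq_bot_of_le_jacobson_smul Module.Finite.fg_top h1.ge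
  rw [← Submodule.ker_mkQ K, LinearMap.ker_eq_top]
  ext x
  have : K.mkQ x ∈ (⊤ : Submodule R (M ⧸ K)) := trivial
  rw [h2, Submodule.mem_bot] at this
  simp [this]

variable [IsArtinianRing R]

/-- Such a module is a module over the quotient of `R` by its Jacobson radical, which is a
semisimple ring because `R` is artinian. -/
theorem isSemisimpleModule_of_jacobsonSMulTop_eq_bot (h : jacobsonSMulTop R M = ⊥) :
    IsSemisimpleModule R M := by
  have ht : Module.IsTorsionBySet R M (Ring.jacobson R : Set R) := by
    intro x a
    have : (a : R) • x ∈ jacobsonSMulTop R M := smul_mem_jacobsonSMulTop a.2 x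
    rwa [h, Submodule.mem_bot] at this
  let _ := ht.module
  exact (ht.semilinearMap.isSemisimpleModule_iff_of_bijective Function.bijective_id).2
    inferInstance

theorem isSemisimpleModule_of_le_jacobsonTorsion {K : Submodule R M}
    (h : K ≤ jacobsonTorsion R M) : IsSemisimpleModule R K := by
  apply isSemisimpleModule_of_jacobsonSMulTop_eq_bot
  apply Submodule.map_injective_of_injective K.subtype_injective
  rw [map_subtype_jacobsonSMulTop, Submodule.map_bot]
  exact le_jacobsonTorsion_iff.mp h

theorem isSemisimpleModule_quotient {K : Submodule R M} (h : jacobsonSMulTop R M ≤ K) :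
    IsSemisimpleModule R (M ⧸ K) := by
  apply isSemisimpleModule_of_jacobsonSMulTop_eq_bot
  rw [← map_jacobsonSMulTop K.mkQ K.mkQ_surjective, ← le_bot_iff, Submodule.map_le_iff_le_comap]
  simpa using h

theorem moduleJacobson_eq : Module.jacobson R M = jacobsonSMulTop R M := by
  refine le_antisymm ?_ (Ring.jacobson_smul_top_le R M)
  have := isSemisimpleModule_quotient (le_refl (jacobsonSMulTop R M))
  exact Module.jacobson_le_of_eq_bot (IsSemisimpleModule.jacobson_eq_bot R _)

theorem moduleSocle_eq : moduleSocle R M = jacobsonTorsion R M := by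
  apply le_antisymm
  · refine sSup_le fun S hS => ?_
    have : IsSimpleModule R S := hS
    exact le_jacobsonTorsion_of_isSemisimpleModule S
  · have := isSemisimpleModule_of_le_jacobsonTorsion (le_refl (jacobsonTorsion R M))
    exact le_of_forall_isSimpleModule_le fun S _ hS => le_sSup hS

/-- The socle is essential: the Jacobson radical `J` is nilpotent, and the last nonzero term of `K,
JK, J²K, …` is killed by `J`. -/
theorem inf_jacobsonTorsion_ne_bot {K : Submodule R M} (h : K ≠ ⊥) :
    K ⊓ jacobsonTorsion R M ≠ ⊥ := by
  obtain ⟨m, hm⟩ := IsSemiprimaryRing.isNilpotent (R := R)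
  have hm' : (Ring.jacobson R) ^ m • K = ⊥ := by rw [hm]; exact Submodule.bot_smul K
  clear hm
  induction m generalizing K with
  | zero => exact absurd (by rwa [Submodule.pow_zero, Ideal.one_eq_top, Submodule.top_smul] at hm') h
  | succ m ih =>
    by_cases h1 : Ring.jacobson R • K = ⊥
    · rwa [inf_eq_left.mpr (le_jacobsonTorsion_iff.mpr h1)]
    · have h2 := ih h1 (by rw [← hm', ← Submodule.mul_smul, Submodule.pow_succ])
      have h3 : Ring.jacobson R • K ≤ K := Submodule.smul_le.mpr fun a _ x hx => K.smul_mem a hx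
      intro h4
      exact h2 (le_bot_iff.mp ((inf_le_inf_right _ h3).trans h4.le))

/-- A simple submodule `S` outside `J M` embeds in the semisimple module `M / J M`. The preimage of
a complement there is a complement of `S` in `M`, so indecomposability forces `M = S`. -/
theorem jacobsonTorsion_le_of_isIndecomposable (hM : IsIndecomposableModule R M)
    (hs : ¬ IsSimpleModule R M) : jacobsonTorsion R M ≤ jacobsonSMulTop R M := by
  have := isSemisimpleModule_of_le_jacobsonTorsion (le_refl (jacobsonTorsion R M))
  refine le_of_forall_isSimpleModule_le fun S _ hS => ?_
  by_contra hle
  have hS1 : IsAtom S := isSimpleModule_iff_isAtom.mp hS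
  have hdis : S ⊓ jacobsonSMulTop R M = ⊥ :=
    (hS1.le_iff.mp inf_le_left).resolve_right fun h => hle (inf_eq_left.mp h)
  have := isSemisimpleModule_quotient (le_refl (jacobsonSMulTop R M))
  obtain ⟨C, hC⟩ := exists_isCompl (S.map (jacobsonSMulTop R M).mkQ)
  have hcompl : IsCompl S (C.comap (jacobsonSMulTop R M).mkQ) := by
    constructor
    · rw [disjoint_iff, eq_bot_iff, ← hdis]
      rintro x ⟨hx, hx'⟩
      refine ⟨hx, ?_⟩
      have : (jacobsonSMulTop R M).mkQ x ∈ S.map (jacobsonSMulTop R M).mkQ ⊓ C :=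
        ⟨Submodule.mem_map_of_mem hx, hx'⟩
      rw [hC.disjoint.eq_bot, Submodule.mem_bot] at this
      simpa using this
    · rw [codisjoint_iff, eq_top_iff]
      intro x _
      have : (jacobsonSMulTop R M).mkQ x ∈ S.map (jacobsonSMulTop R M).mkQ ⊔ C := by
        rw [hC.codisjoint.eq_top]; trivial
      obtain ⟨y, ⟨z, hz, rfl⟩, c, hc, hyc⟩ := Submodule.mem_sup.mp this
      rw [show x = z + (x - z) by abel]
      refine Submodule.add_mem_sup hz ?_
      change (jacobsonSMulTop R M).mkQ (x - z) ∈ C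
      rw [map_sub, ← hyc, add_sub_cancel_left]
      exact hc
  rcases hM.2 _ _ hcompl with h | h
  · exact hS1.1 h
  · have hT : S = ⊤ := by simpa [h] using hcompl.codisjoint.eq_top
    apply hs
    subst hT
    exact IsSimpleModule.congr (Submodule.topEquiv (R := R) (M := M)).symm

/-- Fitting's lemma for indecomposable modules. -/
theorem IsIndecomposableModule.bijective_or_pow_eq_zero [Module.Finite R M]
    (hM : IsIndecomposableModule R M) (f : Module.End R M) :
    Function.Bijective f ∨ ∃ m, f ^ (m + 1) = 0 := by
  have : IsNoetherian R M := inferInstance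
  have : IsArtinian R M := inferInstance
  obtain ⟨m, hm⟩ := Filter.eventually_atTop.mp f.eventually_isCompl_ker_pow_range_pow
  -- The exponent is made positive so that injectivity and surjectivity of the power pass to `f`.
  have h := hm (m + 1) (by omega)
  rcases hM.2 _ _ h with h1 | h1
  · left
    have h2 : LinearMap.range (f ^ (m + 1)) = ⊤ := by simpa [h1] using h.codisjoint.eq_top
    rw [LinearMap.ker_eq_bot] at h1
    rw [LinearMap.range_eq_top] at h2
    constructor
    · rw [pow_succ] at h1
      exact Function.Injective.of_comp (f := ⇑(f ^ m)) h1
    · rw [pow_succ'] at h2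
      exact Function.Surjective.of_comp (g := ⇑(f ^ m)) h2
  · right
    exact ⟨m, LinearMap.range_eq_bot.mp h1⟩

end

end ArtinianModules

/-! ### Projective-injective modules of Loewy length three. -/

section Diamonds

variable {R : Type u} [Ring R]

/-- A projective and injective module `P` whose head and socle are identified with the same
semisimple module `S`, and which has Loewy length three and four times the length of `S`. -/
structure IsDiamond {S P : Type u} [AddCommGroup S] [Module R S] [AddCommGroup P] [Module R P]
    (π : P →ₗ[R] S) (ι : S →ₗ[R] P) : Prop where
  projective : Module.Projective R P
  injective : Module.Injective R P
  finite : Module.Finite R P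
  surjective : Function.Surjective π
  ker_eq : LinearMap.ker π = jacobsonSMulTop R P
  injective_ι : Function.Injective ι
  range_eq : LinearMap.range ι = jacobsonSqSMulTop R P
  torsion_le : jacobsonTorsion R P ≤ jacobsonSqSMulTop R P
  mem_of_smul_smul : ∀ x : P, (∀ a ∈ Ring.jacobson R, ∀ b ∈ Ring.jacobson R, a • b • x = 0) →
    x ∈ jacobsonSMulTop R P
  length_eq : Module.length R P = 4 * Module.length R S

section Pi

variable {ι : Type*} [Fintype ι] {P : ι → Type*} [∀ i, AddCommGroup (P i)] [∀ i, Module R (P i)]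

theorem mem_jacobsonSMulTop_pi (x : ∀ i, P i) :
    x ∈ jacobsonSMulTop R (∀ i, P i) ↔ ∀ i, x i ∈ jacobsonSMulTop R (P i) := by
  classical
  refine ⟨fun h i => map_jacobsonSMulTop_le (LinearMap.proj i) (Submodule.mem_map_of_mem h),
    fun h => ?_⟩
  rw [← Finset.univ_sum_single x]
  exact Submodule.sum_mem _ fun i _ =>
    map_jacobsonSMulTop_le (LinearMap.single R P i) (Submodule.mem_map_of_mem (h i))

theorem mem_jacobsonSqSMulTop_pi (x : ∀ i, P i) :
    x ∈ jacobsonSqSMulTop R (∀ i, P i) ↔ ∀ i, x i ∈ jacobsonSqSMulTop R (P i) := by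
  classical
  refine ⟨fun h i => map_jacobsonSqSMulTop_le (LinearMap.proj i) (Submodule.mem_map_of_mem h),
    fun h => ?_⟩
  rw [← Finset.univ_sum_single x]
  exact Submodule.sum_mem _ fun i _ =>
    map_jacobsonSqSMulTop_le (LinearMap.single R P i) (Submodule.mem_map_of_mem (h i))

end Pi

/-- The submodules `J P` and `J² P` of a finite product are computed coordinatewise. This is how
diamonds over simple modules give diamonds over semisimple ones. -/
theorem IsDiamond.pi {n : ℕ} {S P : Fin n → Type u} [∀ i, AddCommGroup (S i)]
    [∀ i, Module R (S i)] [∀ i, AddCommGroup (P i)] [∀ i, Module R (P i)]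
    {π : ∀ i, P i →ₗ[R] S i} {ι : ∀ i, S i →ₗ[R] P i} (h : ∀ i, IsDiamond (π i) (ι i)) :
    IsDiamond (LinearMap.pi fun i => π i ∘ₗ LinearMap.proj i)
      (LinearMap.pi fun i => ι i ∘ₗ LinearMap.proj i) where
  projective := by
    have := fun i => (h i).projective
    exact Module.Projective.of_equiv (DFinsupp.linearEquivFunOnFintype (R := R) (M := P))
  injective := by
    have := fun i => (h i).injective
    infer_instance
  finite := by
    have := fun i => (h i).finite
    infer_instance
  surjective := fun y => by
    choose x hx using fun i => (h i).surjective (y i)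
    exact ⟨x, funext hx⟩
  ker_eq := by
    ext x
    rw [mem_jacobsonSMulTop_pi, LinearMap.mem_ker, funext_iff]
    refine forall_congr' fun i => ?_
    rw [← (h i).ker_eq]
    rfl
  injective_ι := fun x y hxy => funext fun i => (h i).injective_ι (congrFun hxy i)
  range_eq := by
    ext x
    rw [mem_jacobsonSqSMulTop_pi]
    constructor
    · rintro ⟨y, rfl⟩ i
      rw [← (h i).range_eq]
      exact ⟨y i, rfl⟩
    · intro hx
      have hx' : ∀ i, ∃ y, ι i y = x i := fun i => by
        have := hx i
        rwa [← (h i).range_eq] at this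
      choose y hy using hx'
      exact ⟨y, funext hy⟩
  torsion_le := fun x hx => (mem_jacobsonSqSMulTop_pi x).mpr fun i =>
    (h i).torsion_le fun a ha => congrFun (hx a ha) i
  mem_of_smul_smul := fun x hx => (mem_jacobsonSMulTop_pi x).mpr fun i =>
    (h i).mem_of_smul_smul (x i) fun a ha b hb => congrFun (hx a ha b hb) i
  length_eq := by
    rw [Module.length_pi_of_fintype, Module.length_pi_of_fintype, Finset.mul_sum]
    exact Finset.sum_congr rfl fun i _ => (h i).length_eq

theorem IsDiamond.congr {S S' P : Type u} [AddCommGroup S] [Module R S] [AddCommGroup S']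
    [Module R S'] [AddCommGroup P] [Module R P] {π : P →ₗ[R] S} {ι : S →ₗ[R] P}
    (h : IsDiamond π ι) (e : S ≃ₗ[R] S') :
    IsDiamond (e.toLinearMap ∘ₗ π) (ι ∘ₗ e.symm.toLinearMap) where
  projective := h.projective
  injective := h.injective
  finite := h.finite
  surjective := e.surjective.comp h.surjective
  ker_eq := by rw [← h.ker_eq]; ext; simp
  injective_ι := h.injective_ι.comp e.symm.injective
  range_eq := by
    rw [← h.range_eq, LinearMap.range_comp_of_range_eq_top _ (LinearEquiv.range _)]
  torsion_le := h.torsion_le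
  mem_of_smul_smul := h.mem_of_smul_smul
  length_eq := by rw [h.length_eq, e.length_eq]

theorem length_eq_add {M : Type w} [AddCommGroup M] [Module R M] (K : Submodule R M) :
    Module.length R M = Module.length R K + Module.length R (M ⧸ K) :=
  Module.length_eq_add_of_exact K.subtype K.mkQ K.subtype_injective K.mkQ_surjective
    (LinearMap.exact_subtype_mkQ K)

section

variable {S P : Type u} [AddCommGroup S] [Module R S] [AddCommGroup P] [Module R P]
  {π : P →ₗ[R] S} {ι : S →ₗ[R] P}

theorem IsDiamond.sq_ne_bot (h : IsDiamond π ι) [Nontrivial S] :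
    jacobsonSqSMulTop R P ≠ ⊥ := by
  rw [← h.range_eq, Ne, LinearMap.range_eq_bot]
  rintro rfl
  obtain ⟨x, hx⟩ := exists_ne (0 : S)
  exact hx (h.injective_ι (by simp))

theorem IsDiamond.jacobsonSMulTop_ne_top (h : IsDiamond π ι) [Nontrivial S] :
    jacobsonSMulTop R P ≠ ⊤ := by
  rw [← h.ker_eq, Ne, LinearMap.ker_eq_top]
  rintro rfl
  obtain ⟨x, hx⟩ := exists_ne (0 : S)
  obtain ⟨y, hy⟩ := h.surjective x
  exact hx (by rw [← hy]; rfl)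

theorem IsDiamond.length_sq (h : IsDiamond π ι) :
    Module.length R (jacobsonSqSMulTop R P) = Module.length R S := by
  rw [← h.range_eq]
  exact (LinearEquiv.ofInjective ι h.injective_ι).length_eq.symm

theorem IsDiamond.length_head (h : IsDiamond π ι) :
    Module.length R (P ⧸ jacobsonSMulTop R P) = Module.length R S := by
  rw [← h.ker_eq]
  exact (π.quotKerEquivOfSurjective h.surjective).length_eq

theorem IsDiamond.smul_sq (h : IsDiamond π ι) [IsSemisimpleModule R S] :
    Ring.jacobson R • jacobsonSqSMulTop R P = ⊥ := by
  have := IsSemisimpleModule.range ι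
  rw [← le_jacobsonTorsion_iff, ← h.range_eq]
  exact le_jacobsonTorsion_of_isSemisimpleModule _

end

variable (R) in
/-- Every simple module is projective and injective, or it is the head and the socle of a
diamond. -/
structure HasDiamonds : Prop where
  injective_of_projective : ∀ (S : Type u) [AddCommGroup S] [Module R S], IsSimpleModule R S →
    Module.Projective R S → Module.Injective R S
  exists_diamond : ∀ (S : Type u) [AddCommGroup S] [Module R S], IsSimpleModule R S →
    ¬ Module.Projective R S →
      ∃ (P : Type u) (_ : AddCommGroup P) (_ : Module R P) (π : P →ₗ[R] S) (ι : S →ₗ[R] P),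
        IsDiamond π ι

theorem HasDiamonds.exists_diamond_of_isSemisimpleModule (hR : HasDiamonds R) (S : Type u)
    [AddCommGroup S] [Module R S] [IsSemisimpleModule R S] [Module.Finite R S]
    (hS : ∀ T : Submodule R S, IsSimpleModule R T → ¬ Module.Projective R T) :
    ∃ (P : Type u) (_ : AddCommGroup P) (_ : Module R P) (π : P →ₗ[R] S) (ι : S →ₗ[R] P),
      IsDiamond π ι := by
  obtain ⟨n, T, e, hT⟩ := IsSemisimpleModule.exists_linearEquiv_fin_dfinsupp R S
  choose P h1 h2 π ι h using fun i => hR.exists_diamond (T i) (hT i) (hS _ (hT i))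
  exact ⟨∀ i, P i, _, _, _, _, (IsDiamond.pi h).congr
    (e.trans (DFinsupp.linearEquivFunOnFintype (R := R) (M := fun i => T i))).symm⟩

section Indecomposable

variable {M N P : Type*} [AddCommGroup M] [Module R M] [AddCommGroup N] [Module R N]
  [AddCommGroup P] [Module R P]

theorem IsIndecomposableModule.congr (e : M ≃ₗ[R] N) (h : IsIndecomposableModule R M) :
    IsIndecomposableModule R N := by
  obtain ⟨h1, h2⟩ := h
  refine ⟨e.symm.toEquiv.nontrivial, fun K L hKL => ?_⟩
  have := h2 _ _ ((Submodule.orderIsoMapComap e.symm).isCompl hKL)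
  simpa [Submodule.orderIsoMapComap] using this

/-- The surjection splits, and its section has a nonzero direct summand of `M` as image, hence all
of `M`. -/
theorem IsIndecomposableModule.injective_of_projective (hM : IsIndecomposableModule R M)
    [Module.Projective R N] [Nontrivial N] (f : M →ₗ[R] N) (hf : Function.Surjective f) :
    Function.Injective f := by
  obtain ⟨g, hg⟩ := Module.projective_lifting_property f LinearMap.id hf
  have hgf : ∀ x, f (g x) = x := fun x => LinearMap.congr_fun hg x
  rcases hM.2 _ _ (LinearMap.isCompl_of_proj (p := LinearMap.range g)
    (f := LinearMap.rangeRestrict g ∘ₗ f) (by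
      rintro ⟨_, x, rfl⟩
      ext
      simp [hgf])) with h | h
  · obtain ⟨x, hx⟩ := exists_ne (0 : N)
    refine absurd ?_ hx
    rw [← hgf x, LinearMap.range_eq_bot.mp h]
    simp
  · rw [← LinearMap.ker_eq_bot, eq_bot_iff, ← h]
    intro x hx
    rw [LinearMap.mem_ker] at hx
    simp [hx]

theorem IsIndecomposableModule.surjective_of_retraction (hM : IsIndecomposableModule R M)
    [Nontrivial N] (f : N →ₗ[R] M) (g : M →ₗ[R] N) (hgf : ∀ x, g (f x) = x) :
    Function.Surjective f := by
  rcases hM.2 _ _ (LinearMap.isCompl_of_proj (p := LinearMap.range f)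
    (f := LinearMap.rangeRestrict f ∘ₗ g) (by
      rintro ⟨_, x, rfl⟩
      ext
      simp [hgf])) with h | h
  · obtain ⟨x, hx⟩ := exists_ne (0 : N)
    refine absurd ?_ hx
    rw [← hgf x, LinearMap.range_eq_bot.mp h]
    simp
  · intro x
    refine ⟨g x, ?_⟩
    have : x - f (g x) ∈ LinearMap.ker (LinearMap.rangeRestrict f ∘ₗ g) := by
      rw [LinearMap.mem_ker]
      ext
      simp [hgf]
    rw [h, Submodule.mem_bot] at this
    exact (sub_eq_zero.mp this).symm

/-- A nonzero direct summand is never contained in the radical: `q` is idempotent with image `K`, so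
`P = ker q + K`, and Nakayama's lemma discards `K`. -/
theorem eq_bot_of_retraction [Module.Finite R P] {K : Submodule R P}
    (hK : K ≤ jacobsonSMulTop R P) (q : P →ₗ[R] P) (hq : ∀ x, q x ∈ K) (hq' : ∀ x ∈ K, q x = x) :
    K = ⊥ := by
  have : LinearMap.ker q = ⊤ := by
    apply eq_top_of_sup_jacobsonSMulTop
    rw [eq_top_iff]
    intro x _
    rw [show x = (x - q x) + q x by abel]
    refine Submodule.add_mem_sup ?_ (hK (hq x))
    rw [LinearMap.mem_ker, map_sub, hq' _ (hq x), sub_self]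
  rw [LinearMap.ker_eq_top] at this
  rw [eq_bot_iff]
  intro x hx
  rw [← hq' x hx, this]
  simp

theorem exists_idempotent_of_isCompl {K L : Submodule R M} (h : IsCompl K L) :
    ∃ e : Module.End R M, (∀ x, e x ∈ K) ∧ (∀ x ∈ K, e x = x) ∧ ∀ x ∈ L, e x = 0 := by
  refine ⟨K.subtype ∘ₗ K.projectionOnto L h, fun x => Subtype.prop _, fun x hx => ?_,
    fun x hx => ?_⟩
  · exact congrArg Subtype.val (Submodule.projectionOnto_apply_left h ⟨x, hx⟩)
  · rw [LinearMap.comp_apply, Submodule.projectionOnto_apply_eq_zero_iff h |>.mpr hx, map_zero]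

end Indecomposable

end Diamonds

/-! ### Indecomposability of syzygies and cosyzygies. -/

section LoewyLengthTwo

variable {R : Type u} [Ring R] [IsArtinianRing R]

section

variable {P : Type u} [AddCommGroup P] [Module R P] [Module.Finite R P]

/-- A decomposition of `K` is an idempotent `e`, which extends to an endomorphism `E` of the
injective module `P` and so descends to `P ⧸ K`. By Fitting's lemma the descended map is bijective
or nilpotent. If it is bijective, `E` is surjective by Nakayama's lemma, hence injective, although
it kills `N'`. If it is nilpotent, a power of `E` maps `P` into `K` and is the identity on `N`, so
`N` is a direct summand of `P` inside the radical. -/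
theorem isIndecomposableModule_submodule [Module.Injective R P] {K : Submodule R P}
    (hK : K ≤ jacobsonSMulTop R P) (hK0 : K ≠ ⊥) (hM : IsIndecomposableModule R (P ⧸ K)) :
    IsIndecomposableModule R K := by
  refine ⟨(Submodule.nontrivial_iff_ne_bot).mpr hK0, fun N N' hN => ?_⟩
  obtain ⟨e, he1, he2, he3⟩ := exists_idempotent_of_isCompl hN
  obtain ⟨E, hE⟩ := Module.Injective.out K.subtype K.subtype_injective (K.subtype ∘ₗ e)
  have hE' : ∀ x : K, E x = e x := hE
  have hle : K ≤ K.comap E := fun x hx => by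
    change E x ∈ K
    rw [hE' ⟨x, hx⟩]
    exact (e ⟨x, hx⟩).2
  rcases hM.bijective_or_pow_eq_zero (K.mapQ K E hle) with h | ⟨m, hm⟩
  · right
    have hEs : Function.Surjective E := by
      rw [← LinearMap.range_eq_top]
      apply eq_top_of_sup_jacobsonSMulTop
      rw [eq_top_iff]
      intro x _
      obtain ⟨y, hy⟩ := h.2 (K.mkQ x)
      obtain ⟨y, rfl⟩ := K.mkQ_surjective y
      rw [show x = E y + (x - E y) by abel]
      refine Submodule.add_mem_sup ⟨y, rfl⟩ (hK ?_)
      rw [← Submodule.ker_mkQ K, LinearMap.mem_ker, map_sub, ← hy]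
      simp
    have hEi := IsNoetherian.injective_of_surjective_endomorphism E hEs
    rw [eq_bot_iff]
    intro x hx
    have : E x = 0 := by rw [hE', he3 x hx]; rfl
    rw [Submodule.mem_bot]
    ext
    exact hEi (by simpa using this)
  · left
    have hmem : ∀ x, (E ^ (m + 1)) x ∈ K := by
      intro x
      have h1 : ∀ i, (K.mapQ K E hle ^ i) (K.mkQ x) = K.mkQ ((E ^ i) x) := by
        intro i
        induction i with
        | zero => rfl
        | succ i ih =>
          rw [pow_succ', Module.End.mul_apply, ih, pow_succ', Module.End.mul_apply]
          rfl
      have h2 := h1 (m + 1)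
      rw [hm] at h2
      rw [← Submodule.ker_mkQ K, LinearMap.mem_ker, ← h2]
      rfl
    have hN : ∀ x : K, x ∈ N → ∀ i, (E ^ i) (x : P) = x := by
      intro x hx i
      induction i with
      | zero => rfl
      | succ i ih => rw [pow_succ', Module.End.mul_apply, ih, hE', he2 x hx]
    have hbot : N.map K.subtype = ⊥ := by
      apply eq_bot_of_retraction ((Submodule.map_subtype_le K N).trans hK)
        (K.subtype ∘ₗ e ∘ₗ LinearMap.codRestrict K (E ^ (m + 1)) hmem)
      · intro x
        exact Submodule.mem_map_of_mem (he1 _)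
      · rintro _ ⟨x, hx, rfl⟩
        have : LinearMap.codRestrict K (E ^ (m + 1)) hmem (K.subtype x) = x := by
          ext
          exact hN x hx (m + 1)
        rw [LinearMap.comp_apply, LinearMap.comp_apply, this, he2 x hx]
    exact Submodule.map_injective_of_injective K.subtype_injective (by rw [hbot, Submodule.map_bot])

/-- Dually, an idempotent of `P ⧸ K` lifts to an endomorphism `E` of the projective module `P`,
which restricts to `K`. If the restriction is bijective, `E` is injective because `K` is essential,
hence surjective, and `N` is everything. If it is nilpotent, a power of `E` factors through `P ⧸ K`
and gives a section over `N`, whose image meets the essential submodule `K` trivially. -/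
theorem isIndecomposableModule_quotient [Module.Projective R P] {K : Submodule R P}
    (hK : ∀ L : Submodule R P, L ⊓ K = ⊥ → L = ⊥) (hK' : K ≠ ⊤)
    (hM : IsIndecomposableModule R K) : IsIndecomposableModule R (P ⧸ K) := by
  have hnt : Nontrivial (P ⧸ K) := Submodule.Quotient.nontrivial_iff.mpr hK'
  refine ⟨hnt, fun N N' hN => ?_⟩
  obtain ⟨e, he1, he2, he3⟩ := exists_idempotent_of_isCompl hN
  obtain ⟨E, hE⟩ := Module.projective_lifting_property K.mkQ (e ∘ₗ K.mkQ) K.mkQ_surjective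
  have hE' : ∀ x : P, K.mkQ (E x) = e (K.mkQ x) := fun x => LinearMap.congr_fun hE x
  have hle : ∀ x ∈ K, E x ∈ K := fun x hx => by
    rw [← Submodule.ker_mkQ K, LinearMap.mem_ker] at hx ⊢
    rw [hE', hx, map_zero]
  rcases hM.bijective_or_pow_eq_zero (E.restrict hle) with h | ⟨m, hm⟩
  · right
    have hEi : Function.Injective E := by
      rw [← LinearMap.ker_eq_bot]
      apply hK
      rw [eq_bot_iff]
      rintro x ⟨hx, hx'⟩
      have : (⟨x, hx'⟩ : K) = 0 := h.1 (by ext; simpa using hx)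
      simpa using this
    have hEs := IsArtinian.surjective_of_injective_endomorphism E hEi
    have htop : N = ⊤ := by
      rw [eq_top_iff]
      intro x _
      obtain ⟨x, rfl⟩ := K.mkQ_surjective x
      obtain ⟨y, rfl⟩ := hEs x
      rw [hE']
      exact he1 _
    simpa [htop] using hN.disjoint.eq_bot
  · left
    have hzero : K ≤ LinearMap.ker (E ^ (m + 1)) := by
      intro x hx
      have h1 : ∀ i, ((E.restrict hle ^ i) ⟨x, hx⟩ : P) = (E ^ i) x := by
        intro i
        induction i with
        | zero => rfl
        | succ i ih =>
          rw [pow_succ', Module.End.mul_apply, pow_succ', Module.End.mul_apply, ← ih]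
          rfl
      rw [LinearMap.mem_ker, ← h1, hm]
      rfl
    have hs : ∀ x ∈ N, K.mkQ (K.liftQ (E ^ (m + 1)) hzero x) = x := by
      intro x hx
      obtain ⟨x, rfl⟩ := K.mkQ_surjective x
      have h1 : ∀ i, K.mkQ ((E ^ i) x) = K.mkQ x := by
        intro i
        induction i with
        | zero => rfl
        | succ i ih => rw [pow_succ', Module.End.mul_apply, hE', ih, he2 _ hx]
      exact h1 (m + 1)
    have hbot : N.map (K.liftQ (E ^ (m + 1)) hzero) = ⊥ := by
      apply hK
      rw [eq_bot_iff]
      rintro _ ⟨⟨x, hx, rfl⟩, hx'⟩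
      have h0 : K.mkQ (K.liftQ (E ^ (m + 1)) hzero x) = 0 := by
        rw [← LinearMap.mem_ker, Submodule.ker_mkQ]
        exact hx'
      rw [hs x hx] at h0
      rw [h0, map_zero]
      exact Submodule.zero_mem _
    rw [eq_bot_iff]
    intro x hx
    have h0 : K.liftQ (E ^ (m + 1)) hzero x ∈ (⊥ : Submodule R P) :=
      hbot ▸ Submodule.mem_map_of_mem hx
    rw [Submodule.mem_bot] at h0 ⊢
    rw [← hs x hx, h0, map_zero]

end

/-- Indecomposable modules of Loewy length two. -/
structure IsLoewyTwo (R : Type u) [Ring R] (M : Type w) [AddCommGroup M] [Module R M] : Prop where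
  indecomposable : IsIndecomposableModule R M
  not_isSimpleModule : ¬ IsSimpleModule R M
  sq_eq_bot : jacobsonSqSMulTop R M = ⊥

/-- The vanishing of `J² M` puts the radical into the socle; the reverse inclusion is where
indecomposability enters. -/
theorem IsLoewyTwo.torsion_eq {M : Type w} [AddCommGroup M] [Module R M] (h : IsLoewyTwo R M) :
    jacobsonTorsion R M = jacobsonSMulTop R M :=
  le_antisymm (jacobsonTorsion_le_of_isIndecomposable h.indecomposable h.not_isSimpleModule)
    (le_jacobsonTorsion_iff.mpr h.sq_eq_bot)

section

variable {S P : Type u} [AddCommGroup S] [Module R S] [AddCommGroup P] [Module R P]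
  {π : P →ₗ[R] S} {ι : S →ₗ[R] P}

theorem IsDiamond.essential (h : IsDiamond π ι) {K : Submodule R P}
    (hK : jacobsonSqSMulTop R P ≤ K) (L : Submodule R P) (hL : L ⊓ K = ⊥) : L = ⊥ := by
  by_contra h0
  apply inf_jacobsonTorsion_ne_bot h0
  rw [eq_bot_iff, ← hL]
  exact inf_le_inf_left _ (h.torsion_le.trans hK)

end

end LoewyLengthTwo

/-! ### Descent along syzygies and cosyzygies to a simple module. -/

section Classification

variable {R : Type u} [Ring R]

theorem IsLoewyTwo.congr {M : Type w} {N : Type*} [AddCommGroup M] [Module R M] [AddCommGroup N]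
    [Module R N] (h : IsLoewyTwo R M) (e : M ≃ₗ[R] N) : IsLoewyTwo R N :=
  ⟨h.indecomposable.congr e, fun _ => h.not_isSimpleModule (IsSimpleModule.congr e), by
    rw [← map_jacobsonSqSMulTop e.toLinearMap e.surjective, h.sq_eq_bot, Submodule.map_bot]⟩

theorem isIteratedCosyzygy_of_equiv {S S' : ModuleCat.{v} R} (e : S ≃ₗ[R] S') :
    ∀ (i : ℕ) (N : ModuleCat.{v} R), IsIteratedCosyzygy S i N → IsIteratedCosyzygy S' i N
  | 0, _, ⟨f⟩ => ⟨f.trans e⟩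
  | i + 1, _, ⟨K, hK, hN⟩ => ⟨K, isIteratedCosyzygy_of_equiv e i K hK, hN⟩

theorem isIteratedSyzygy_of_equiv {S S' : ModuleCat.{v} R} (e : S ≃ₗ[R] S') :
    ∀ (i : ℕ) (N : ModuleCat.{v} R), IsIteratedSyzygy S i N → IsIteratedSyzygy S' i N
  | 0, _, ⟨f⟩ => ⟨f.trans e⟩
  | i + 1, _, ⟨K, hK, hN⟩ => ⟨K, isIteratedSyzygy_of_equiv e i K hK, hN⟩

variable [IsArtinianRing R]

/-- A projective simple summand of the head would split off from `M`, and `M` would be simple. So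
all simple summands of the head have diamonds. -/
theorem HasDiamonds.exists_diamond_head (hR : HasDiamonds R) {M : Type u} [AddCommGroup M]
    [Module R M] [Module.Finite R M] (hM : IsLoewyTwo R M) :
    ∃ (P : Type u) (_ : AddCommGroup P) (_ : Module R P)
      (π : P →ₗ[R] M ⧸ jacobsonSMulTop R M) (ι : M ⧸ jacobsonSMulTop R M →ₗ[R] P),
      IsDiamond π ι := by
  have := isSemisimpleModule_quotient (le_refl (jacobsonSMulTop R M))
  refine hR.exists_diamond_of_isSemisimpleModule _ fun T hT hT' => hM.not_isSimpleModule ?_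
  obtain ⟨C, hC⟩ := exists_isCompl T
  have := IsSimpleModule.nontrivial R T
  have hs : Function.Surjective (T.projectionOnto C hC ∘ₗ (jacobsonSMulTop R M).mkQ) :=
    (Submodule.projectionOnto_surjective hC).comp (Submodule.mkQ_surjective _)
  have hi := hM.indecomposable.injective_of_projective _ hs
  exact IsSimpleModule.congr (LinearEquiv.ofBijective _ ⟨hi, hs⟩)

/-- A projective simple submodule is injective by hypothesis on `R`, so it would be a direct summand
of `M`. -/
theorem HasDiamonds.exists_diamond_socle (hR : HasDiamonds R) {M : Type u} [AddCommGroup M]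
    [Module R M] [Module.Finite R M] (hM : IsLoewyTwo R M) :
    ∃ (P : Type u) (_ : AddCommGroup P) (_ : Module R P)
      (π : P →ₗ[R] jacobsonSMulTop R M) (ι : jacobsonSMulTop R M →ₗ[R] P),
      IsDiamond π ι := by
  have := isSemisimpleModule_of_le_jacobsonTorsion hM.torsion_eq.ge
  refine hR.exists_diamond_of_isSemisimpleModule _ fun T hT hT' => hM.not_isSimpleModule ?_
  have := IsSimpleModule.nontrivial R T
  have := hR.injective_of_projective T hT hT'
  have hi : Function.Injective ((jacobsonSMulTop R M).subtype ∘ₗ T.subtype) :=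
    (Submodule.subtype_injective _).comp (Submodule.subtype_injective _)
  obtain ⟨g, hg⟩ := Module.Injective.out ((jacobsonSMulTop R M).subtype ∘ₗ T.subtype) hi
    LinearMap.id
  have hs := hM.indecomposable.surjective_of_retraction _ g hg
  exact IsSimpleModule.congr (LinearEquiv.ofBijective _ ⟨hi, hs⟩).symm

/-- An indecomposable module of Loewy length two whose head is shorter than its socle is an iterated
cosyzygy of a simple module. -/
theorem HasDiamonds.isIteratedCosyzygy_of_lt (hR : HasDiamonds R) (s : ℕ) :
    ∀ (t : ℕ) (M : Type u) [AddCommGroup M] [Module R M] [Module.Finite R M],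
      IsLoewyTwo R M → Module.length R (M ⧸ jacobsonSMulTop R M) = s →
      Module.length R (jacobsonSMulTop R M) = t → s < t →
      t = s + 1 ∧ ∃ S : ModuleCat.{u} R, IsSimpleModule R S ∧ ¬ Module.Projective R S ∧
        IsIteratedCosyzygy S s (ModuleCat.of R M) := by
  induction s using Nat.strong_induction_on with
  | _ s ih =>
  intro t M _ _ _ hM hs ht hst
  obtain ⟨P, _, _, π, ι, h⟩ := hR.exists_diamond_head hM
  have := h.projective
  have := h.injective
  have := h.finite
  have := hM.indecomposable.1
  have hss := isSemisimpleModule_quotient (le_refl (jacobsonSMulTop R M))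
  have hSnt : Nontrivial (M ⧸ jacobsonSMulTop R M) := by
    refine Submodule.Quotient.nontrivial_iff.mpr fun h0 => ?_
    have : (⊥ : Submodule R M) = ⊤ := eq_top_of_sup_jacobsonSMulTop (by simp [h0])
    exact bot_ne_top this
  -- The projective cover `P → M` is obtained by lifting the map onto the head; it is surjective by
  -- Nakayama's lemma.
  obtain ⟨g, hg⟩ := Module.projective_lifting_property (jacobsonSMulTop R M).mkQ π
    (Submodule.mkQ_surjective _)
  have hg' : ∀ x, (jacobsonSMulTop R M).mkQ (g x) = π x := fun x => LinearMap.congr_fun hg x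
  have hgs : Function.Surjective g := by
    rw [← LinearMap.range_eq_top]
    apply eq_top_of_sup_jacobsonSMulTop
    rw [eq_top_iff]
    intro x _
    obtain ⟨y, hy⟩ := h.surjective ((jacobsonSMulTop R M).mkQ x)
    rw [show x = g y + (x - g y) by abel]
    refine Submodule.add_mem_sup ⟨y, rfl⟩ ?_
    rw [← Submodule.ker_mkQ (jacobsonSMulTop R M), LinearMap.mem_ker, map_sub, hg', hy, sub_self]
  set K := LinearMap.ker g with hKdef
  have eM : (P ⧸ K) ≃ₗ[R] M := g.quotKerEquivOfSurjective hgs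
  have hKJ : K ≤ jacobsonSMulTop R P := by
    rw [← h.ker_eq]
    intro x hx
    rw [LinearMap.mem_ker] at hx ⊢
    rw [← hg', hx, map_zero]
  have hZK : jacobsonSqSMulTop R P ≤ K := by
    intro x hx
    have := map_jacobsonSqSMulTop_le g (Submodule.mem_map_of_mem hx)
    rwa [hM.sq_eq_bot] at this
  have hK0 : K ≠ ⊥ := fun h0 => h.sq_ne_bot (le_bot_iff.mp (h0 ▸ hZK))
  have hKi : IsIndecomposableModule R K :=
    isIndecomposableModule_submodule hKJ hK0 (hM.indecomposable.congr eM.symm)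
  have hlen : (4 * s : ℕ∞) = Module.length R K + (t + s) := by
    rw [← hs, ← h.length_eq, length_eq_add K, eM.length_eq, length_eq_add (jacobsonSMulTop R M), ht]
  have hcos : IsCosyzygy (ModuleCat.of R K) (ModuleCat.of R M) := by
    refine ⟨ModuleCat.of R P, K.subtype, ⟨h.injective, K.subtype_injective, fun N hN => ?_⟩,
      ⟨?_⟩⟩
    · rw [Submodule.range_subtype] at hN
      exact h.essential hZK N hN
    · exact eM.symm.trans (Submodule.quotEquivOfEq _ _ (Submodule.range_subtype K).symm)
  -- If `K` is simple it equals `J² P`, whose length is `s`; so `s = 1` and `4 = 1 + (t + 1)`. This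
  -- is the end of the descent.
  by_cases hKs : IsSimpleModule R K
  · have hZ : jacobsonSqSMulTop R P = K :=
      ((isSimpleModule_iff_isAtom.mp hKs).le_iff.mp hZK).resolve_left h.sq_ne_bot
    have hs1 : (s : ℕ∞) = 1 := by
      rw [← hs, ← h.length_sq, hZ]
      exact Module.length_eq_one R K
    have hs1 : s = 1 := by exact_mod_cast hs1
    subst hs1
    rw [Module.length_eq_one R K] at hlen
    have hlen : 4 = 1 + (t + 1) := by exact_mod_cast hlen
    refine ⟨by omega, ModuleCat.of R K, hKs, fun hp => hK0 ?_, ModuleCat.of R K,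
      ⟨LinearEquiv.refl R _⟩, hcos⟩
    -- A projective simple `K` would be injective, hence a direct summand of `P` inside its radical.
    have := hR.injective_of_projective K hKs hp
    obtain ⟨q, hq⟩ := Module.Injective.out K.subtype K.subtype_injective LinearMap.id
    exact eq_bot_of_retraction hKJ (K.subtype ∘ₗ q) (fun x => (q x).2)
      fun x hx => congrArg Subtype.val (hq ⟨x, hx⟩)
  · have hrK : Ring.jacobson R • K ≤ jacobsonSqSMulTop R P := smul_mono_right _ hKJ
    have hKl : IsLoewyTwo R K := by
      refine ⟨hKi, hKs, ?_⟩
      apply Submodule.map_injective_of_injective K.subtype_injective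
      rw [Submodule.map_bot, jacobsonSqSMulTop, Submodule.map_smul'',
        map_subtype_jacobsonSMulTop, ← le_bot_iff, ← h.smul_sq]
      exact smul_mono_right _ hrK
    -- The radical of `K` lies in `J² P` because `K ≤ J P`. Conversely `J² P` is contained in `K`
    -- and killed by `J`, so it lies in the socle of `K`, which is the radical of `K`.
    have hrad : (jacobsonSMulTop R K).map K.subtype = jacobsonSqSMulTop R P := by
      apply le_antisymm
      · rwa [map_subtype_jacobsonSMulTop]
      · rw [← hKl.torsion_eq]
        intro x hx
        refine ⟨⟨x, hZK hx⟩, fun a ha => ?_, rfl⟩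
        ext
        exact (le_jacobsonTorsion_iff.mpr h.smul_sq) hx a ha
    have hlr : Module.length R (jacobsonSMulTop R K) = s := by
      rw [(Submodule.equivMapOfInjective K.subtype K.subtype_injective _).length_eq, hrad,
        h.length_sq, hs]
    rw [length_eq_add (jacobsonSMulTop R K), hlr] at hlen
    obtain ⟨l, hl⟩ : ∃ l : ℕ, Module.length R (K ⧸ jacobsonSMulTop R K) = l :=
      ENat.ne_top_iff_exists.mp (Module.length_ne_top) |>.imp fun _ h => h.symm
    rw [hl] at hlen
    -- So `l = 2s - t`, which is less than `s`, and `s - l = t - s`: the module `K` satisfies the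
    -- same hypothesis with `(l, s)` in place of `(s, t)`.
    have hlen : 4 * s = s + l + (t + s) := by exact_mod_cast hlen
    obtain ⟨h1, S, h2, h3, h4⟩ := ih l (by omega) s K hKl hl hlr (by omega)
    refine ⟨by omega, S, h2, h3, ?_⟩
    subst h1
    exact ⟨_, h4, hcos⟩

/-- An indecomposable module of Loewy length two whose socle is shorter than its head is an iterated
syzygy of a simple module. -/
theorem HasDiamonds.isIteratedSyzygy_of_lt (hR : HasDiamonds R) (t : ℕ) :
    ∀ (s : ℕ) (M : Type u) [AddCommGroup M] [Module R M] [Module.Finite R M],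
      IsLoewyTwo R M → Module.length R (M ⧸ jacobsonSMulTop R M) = s →
      Module.length R (jacobsonSMulTop R M) = t → t < s →
      s = t + 1 ∧ ∃ S : ModuleCat.{u} R, IsSimpleModule R S ∧ ¬ Module.Projective R S ∧
        IsIteratedSyzygy S t (ModuleCat.of R M) := by
  induction t using Nat.strong_induction_on with
  | _ t ih =>
  intro s M _ _ _ hM hs ht hst
  obtain ⟨P, _, _, π, ι, h⟩ := hR.exists_diamond_socle hM
  have := h.projective
  have := h.injective
  have := h.finite
  have := hM.indecomposable.1
  have hss := isSemisimpleModule_of_le_jacobsonTorsion hM.torsion_eq.ge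
  have hSnt : Nontrivial (jacobsonSMulTop R M) := by
    rw [Submodule.nontrivial_iff_ne_bot, ← hM.torsion_eq]
    intro h0
    refine inf_jacobsonTorsion_ne_bot (R := R) (M := M) (K := ⊤) top_ne_bot ?_
    rw [h0, inf_bot_eq]
  -- The embedding of the socle extends to `M`, and the extension is injective because the socle is
  -- essential.
  obtain ⟨g, hg⟩ := Module.Injective.out (jacobsonSMulTop R M).subtype
    (Submodule.subtype_injective _) ι
  have hgi : Function.Injective g := by
    rw [← LinearMap.ker_eq_bot]
    by_contra h0
    apply inf_jacobsonTorsion_ne_bot h0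
    rw [hM.torsion_eq, eq_bot_iff]
    rintro x ⟨hx, hx'⟩
    have h1 : ι ⟨x, hx'⟩ = 0 := by rw [← hg]; exact hx
    have h2 := h.injective_ι (h1.trans (map_zero ι).symm)
    exact congrArg Subtype.val h2
  set K := LinearMap.range g with hKdef
  have eM : M ≃ₗ[R] K := LinearEquiv.ofInjective g hgi
  -- `J²` kills `M`, and in a diamond only elements of the radical are killed by `J²`.
  have hKJ : K ≤ jacobsonSMulTop R P := by
    rintro _ ⟨x, rfl⟩
    refine h.mem_of_smul_smul _ fun a ha b hb => ?_
    rw [← map_smul, ← map_smul]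
    have := smul_smul_mem_jacobsonSqSMulTop ha hb x
    rw [hM.sq_eq_bot, Submodule.mem_bot] at this
    rw [this, map_zero]
  have hZK : jacobsonSqSMulTop R P ≤ K := by
    rw [← h.range_eq]
    rintro _ ⟨x, rfl⟩
    exact ⟨x, hg x⟩
  have hKt : K ≠ ⊤ := fun h0 => h.jacobsonSMulTop_ne_top (top_le_iff.mp (h0 ▸ hKJ))
  have hCi : IsIndecomposableModule R (P ⧸ K) :=
    isIndecomposableModule_quotient (h.essential hZK) hKt (hM.indecomposable.congr eM)
  have hlen : (4 * t : ℕ∞) = (t + s) + Module.length R (P ⧸ K) := by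
    rw [← ht, ← h.length_eq, length_eq_add K, ← eM.length_eq,
      length_eq_add (jacobsonSMulTop R M), hs]
  have hsyz : IsSyzygy (ModuleCat.of R (P ⧸ K)) (ModuleCat.of R M) := by
    refine ⟨ModuleCat.of R P, K.mkQ, ⟨h.projective, K.mkQ_surjective, fun N hN => ?_⟩, ⟨?_⟩⟩
    · rw [Submodule.ker_mkQ] at hN
      exact eq_top_of_sup_jacobsonSMulTop (top_le_iff.mp (hN ▸ sup_le_sup_left hKJ N))
    · exact eM.trans (LinearEquiv.ofEq _ _ (Submodule.ker_mkQ K).symm)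
  have hlh : Module.length R ((P ⧸ K) ⧸ jacobsonSMulTop R (P ⧸ K)) = t := by
    rw [← ht, ← h.length_head, ← map_jacobsonSMulTop K.mkQ K.mkQ_surjective]
    exact (Submodule.quotientQuotientEquivQuotient K _ hKJ).length_eq
  by_cases hCs : IsSimpleModule R (P ⧸ K)
  · have hr0 : jacobsonSMulTop R (P ⧸ K) = ⊥ := by
      rw [← moduleJacobson_eq]
      exact IsSimpleModule.jacobson_eq_bot R _
    have ht1 : (t : ℕ∞) = 1 := by
      rw [← hlh, hr0, (Submodule.quotEquivOfEqBot _ rfl).length_eq]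
      exact Module.length_eq_one R (P ⧸ K)
    have ht1 : t = 1 := by exact_mod_cast ht1
    subst ht1
    rw [Module.length_eq_one R (P ⧸ K)] at hlen
    have hlen : 4 = 1 + s + 1 := by exact_mod_cast hlen
    refine ⟨by omega, ModuleCat.of R (P ⧸ K), hCs, fun hp => ?_, ModuleCat.of R (P ⧸ K),
      ⟨LinearEquiv.refl R _⟩, hsyz⟩
    -- If `P ⧸ K` were projective, the image of a section would meet the essential submodule `K`
    -- trivially.
    obtain ⟨q, hq⟩ := Module.projective_lifting_property K.mkQ LinearMap.id K.mkQ_surjective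
    have hq' : ∀ x, K.mkQ (q x) = x := fun x => LinearMap.congr_fun hq x
    have hbot : LinearMap.range q = ⊥ := by
      apply h.essential hZK
      rw [eq_bot_iff]
      rintro _ ⟨⟨x, rfl⟩, hx⟩
      have hx0 : x = 0 := (hq' x).symm.trans ((Submodule.Quotient.mk_eq_zero K).mpr hx)
      simp [hx0]
    obtain ⟨x, hx⟩ := @exists_ne _ hCi.1 0
    refine hx ?_
    rw [← hq' x, LinearMap.range_eq_bot.mp hbot]
    simp
  · have hCl : IsLoewyTwo R (P ⧸ K) := by
      refine ⟨hCi, hCs, ?_⟩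
      rw [← map_jacobsonSqSMulTop K.mkQ K.mkQ_surjective, ← le_bot_iff,
        Submodule.map_le_iff_le_comap]
      simpa using hZK
    rw [length_eq_add (jacobsonSMulTop R (P ⧸ K)), hlh] at hlen
    obtain ⟨l, hl⟩ : ∃ l : ℕ, Module.length R (jacobsonSMulTop R (P ⧸ K)) = l :=
      ENat.ne_top_iff_exists.mp (Module.length_ne_top) |>.imp fun _ h => h.symm
    rw [hl] at hlen
    -- So `l = 2t - s` and `t - l = s - t`: the quotient has type `(t, l)`, with the same
    -- difference.
    have hlen : 4 * t = t + s + (l + t) := by exact_mod_cast hlen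
    obtain ⟨h1, S, h2, h3, h4⟩ := ih l (by omega) t (P ⧸ K) hCl hlh hl (by omega)
    refine ⟨by omega, S, h2, h3, ?_⟩
    subst h1
    exact ⟨_, h4, hsyz⟩

theorem map_subtype_moduleJacobson {M : Type w} [AddCommGroup M] [Module R M]
    (K : Submodule R M) : (Module.jacobson R K).map K.subtype = Ring.jacobson R • K := by
  rw [moduleJacobson_eq, map_subtype_jacobsonSMulTop]

theorem IsOfType.isLoewyTwo {M : Type w} [AddCommGroup M] [Module R M] {s t : ℕ}
    (h : IsOfType R M s t) : IsLoewyTwo R M := by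
  have h1 : radicalSeries R M 1 = jacobsonSMulTop R M := map_subtype_moduleJacobson _
  have h2 : radicalSeries R M 2 = jacobsonSqSMulTop R M := by
    rw [jacobsonSqSMulTop, ← h1]
    exact map_subtype_moduleJacobson _
  refine ⟨h.indecomposable, fun hs => ?_, h2 ▸ h.loewy.1⟩
  have h3 : (1 : ℕ) ∈ {i : ℕ | radicalSeries R M i = ⊥} := by
    change radicalSeries R M 1 = ⊥
    rw [h1, ← moduleJacobson_eq]
    exact IsSimpleModule.jacobson_eq_bot R M
  exact absurd (h.loewy.2 h3) (by norm_num)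

/-- Over an artinian ring all of whose nonprojective simple modules occur in diamonds, an
indecomposable module of `(s, t)`-type with `s ≠ t` is an iterated syzygy or cosyzygy of a
nonprojective simple module. -/
theorem HasDiamonds.isIteratedCosyzygy_or_isIteratedSyzygy (hR : HasDiamonds R) {M : Type w}
    [AddCommGroup M] [Module R M] [Module.Finite R M] (s t : ℕ) (h : IsOfType R M s t) :
    (s < t → t = s + 1 ∧ ∃ S N : ModuleCat.{u} R, IsSimpleModule R S ∧ ¬ Module.Projective R S ∧
      IsIteratedCosyzygy S s N ∧ Nonempty (M ≃ₗ[R] N)) ∧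
    (t < s → s = t + 1 ∧ ∃ S N : ModuleCat.{u} R, IsSimpleModule R S ∧ ¬ Module.Projective R S ∧
      IsIteratedSyzygy S t N ∧ Nonempty (M ≃ₗ[R] N)) := by
  obtain ⟨m, f, hf⟩ := Module.Finite.exists_fin' R M
  -- A copy of `M` in the universe of `R`, in which the diamonds live.
  let N := (Fin m → R) ⧸ LinearMap.ker f
  let e : M ≃ₗ[R] N := (f.quotKerEquivOfSurjective hf).symm
  have hM := h.isLoewyTwo
  have hN : IsLoewyTwo R N := hM.congr e
  have hrad : (jacobsonSMulTop R M).map e.toLinearMap = jacobsonSMulTop R N :=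
    map_jacobsonSMulTop e.toLinearMap e.surjective
  have hs : Module.length R (N ⧸ jacobsonSMulTop R N) = s := by
    rw [← h.length_head, moduleJacobson_eq]
    exact (Submodule.Quotient.equiv _ _ e hrad).length_eq.symm
  have ht : Module.length R (jacobsonSMulTop R N) = t := by
    rw [← h.length_socle, moduleSocle_eq, hM.torsion_eq, ← hrad]
    exact (e.submoduleMap _).length_eq.symm
  constructor
  · intro hst
    obtain ⟨h1, S, h2, h3, h4⟩ := hR.isIteratedCosyzygy_of_lt s t N hN hs ht hst
    exact ⟨h1, S, _, h2, h3, h4, ⟨e⟩⟩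
  · intro hst
    obtain ⟨h1, S, h2, h3, h4⟩ := hR.isIteratedSyzygy_of_lt t s N hN hs ht hst
    exact ⟨h1, S, _, h2, h3, h4, ⟨e⟩⟩

end Classification

/-! ### Weights and character idempotents of a finite abelian group. -/

section CharacterIdempotents

variable {k : Type*} [Field k] {T : Type*} [CommGroup T] [Fintype T]
  {A : Type*} [Ring A] [Algebra k A] (τ : T →* A)

/-- The vector `v` has weight `wt`. -/
def HasWeight {M : Type*} [AddCommGroup M] [Module k M] [Module A M] (wt : T →* kˣ) (v : M) :
    Prop :=
  ∀ t, τ t • v = (wt t : k) • v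

/-- The idempotent attached to a character of a finite abelian group. -/
noncomputable def charIdem (wt : T →* kˣ) : A :=
  (Fintype.card T : k)⁻¹ • ∑ t, (wt t⁻¹ : k) • τ t

theorem mul_charIdem (wt : T →* kˣ) (s : T) :
    τ s * charIdem τ wt = (wt s : k) • charIdem τ wt := by
  rw [charIdem, mul_smul_comm, smul_comm (wt s : k)]
  congr 1
  rw [Finset.mul_sum, Finset.smul_sum]
  refine Fintype.sum_equiv (Equiv.mulLeft s) (fun t => τ s * (wt t⁻¹ : k) • τ t)
    (fun t => (wt s : k) • (wt t⁻¹ : k) • τ t) fun t => ?_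
  rw [Equiv.coe_mulLeft, mul_smul_comm, smul_smul, ← Units.val_mul, ← map_mul wt, ← map_mul τ,
    mul_inv_rev, mul_comm t⁻¹, mul_inv_cancel_left]

section

variable {M : Type*} [AddCommGroup M] [Module k M] [Module A M] [IsScalarTower k A M]

theorem hasWeight_charIdem_smul (wt : T →* kˣ) (v : M) :
    HasWeight τ wt (charIdem τ wt • v) := by
  intro t
  rw [smul_smul, mul_charIdem, smul_assoc]

theorem hasWeight_charIdem (wt : T →* kˣ) : HasWeight τ wt (charIdem τ wt) :=
  fun t => mul_charIdem τ wt t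

variable {τ}

/-- Orthogonality of characters: the values of `wt⁻¹ wt'`, a nontrivial character, sum to zero. -/
theorem HasWeight.charIdem_smul_of_ne {wt wt' : T →* kˣ} {v : M} (h : HasWeight τ wt' v)
    (hne : wt ≠ wt') : charIdem τ wt • v = 0 := by
  rw [charIdem, smul_assoc, Finset.sum_smul]
  have : ∀ t ∈ Finset.univ, ((wt t⁻¹ : k) • τ t) • v =
      (((Units.coeHom k).comp (wt⁻¹ * wt')) t) • v := fun t _ => by
    rw [smul_assoc, h t, smul_smul]
    simp
  rw [Finset.sum_congr rfl this, ← Finset.sum_smul, sum_hom_units_eq_zero, zero_smul, smul_zero]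
  intro h0
  apply hne
  ext t
  have := DFunLike.congr_fun h0 t
  simp only [MonoidHom.comp_apply, MonoidHom.mul_apply, MonoidHom.inv_apply, Units.coeHom_apply,
    MonoidHom.one_apply] at this
  rw [Units.val_eq_one, inv_mul_eq_one] at this
  rw [this]

end

variable [CharZero k]

variable {τ} in
theorem HasWeight.charIdem_smul {M : Type*} [AddCommGroup M] [Module k M] [Module A M]
    [IsScalarTower k A M] {wt : T →* kˣ} {v : M} (h : HasWeight τ wt v) :
    charIdem τ wt • v = v := by
  rw [charIdem, smul_assoc, Finset.sum_smul]
  have : ∀ t ∈ Finset.univ, ((wt t⁻¹ : k) • τ t) • v = v := fun t _ => by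
    rw [smul_assoc, h t, smul_smul]
    simp
  rw [Finset.sum_congr rfl this, Finset.sum_const, Finset.card_univ, ← Nat.cast_smul_eq_nsmul k,
    smul_smul, inv_mul_cancel₀ (Nat.cast_ne_zero.mpr Fintype.card_ne_zero), one_smul]

variable [IsAlgClosed k] [Fintype (T →* kˣ)]

theorem card_characters (k : Type*) [Field k] [CharZero k] [IsAlgClosed k] (T : Type*)
    [CommGroup T] [Finite T] : Nat.card (T →* kˣ) = Nat.card T := by
  have : NeZero ((Monoid.exponent T : ℕ) : k) :=
    ⟨Nat.cast_ne_zero.mpr Monoid.exponent_ne_zero_of_finite⟩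
  exact CommGroup.card_monoidHom_of_hasEnoughRootsOfUnity T k

theorem exists_character_ne_one (k : Type*) [Field k] [CharZero k] [IsAlgClosed k] {T : Type*}
    [CommGroup T] [Finite T] {t : T} (ht : t ≠ 1) : ∃ wt : T →* kˣ, wt t ≠ 1 := by
  have : NeZero ((Monoid.exponent T : ℕ) : k) :=
    ⟨Nat.cast_ne_zero.mpr Monoid.exponent_ne_zero_of_finite⟩
  exact CommGroup.exists_apply_ne_one_of_hasEnoughRootsOfUnity T k ht

/-- The dual orthogonality relation. For `t ≠ 1` evaluation at `t` is a nontrivial character of the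
dual group, since characters separate points over an algebraically closed field of characteristic
zero. -/
theorem sum_character_apply (t : T) [DecidableEq T] :
    ∑ wt : T →* kˣ, (wt t : k) = if t = 1 then (Fintype.card T : k) else 0 := by
  split_ifs with h
  · subst h
    have := card_characters k T
    rw [Nat.card_eq_fintype_card, Nat.card_eq_fintype_card] at this
    simp [this]
  · obtain ⟨wt, hwt⟩ := exists_character_ne_one k h
    exact sum_hom_units_eq_zero ((Units.coeHom k).comp (MonoidHom.eval t)) fun h0 => hwt (by
      have := DFunLike.congr_fun h0 wt
      simpa using this)

theorem sum_charIdem : ∑ wt : T →* kˣ, charIdem τ wt = 1 := by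
  classical
  simp only [charIdem]
  rw [← Finset.smul_sum, Finset.sum_comm]
  have : ∀ t ∈ Finset.univ, ∑ wt : T →* kˣ, (wt t⁻¹ : k) • τ t =
      if t = 1 then (Fintype.card T : k) • (1 : A) else 0 := fun t _ => by
    rw [← Finset.sum_smul, sum_character_apply]
    by_cases h : t = 1 <;> simp [h]
  rw [Finset.sum_congr rfl this]
  simp [smul_smul, Fintype.card_ne_zero]

variable {M : Type*} [AddCommGroup M] [Module A M]

theorem sum_charIdem_smul (v : M) : ∑ wt : T →* kˣ, charIdem τ wt • v = v := by
  rw [← Finset.sum_smul, sum_charIdem, one_smul]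

theorem exists_charIdem_smul_notMem (L : Submodule A M) {v : M} (hv : v ∉ L) :
    ∃ wt : T →* kˣ, charIdem τ wt • v ∉ L := by
  by_contra! h
  exact hv (by rw [← sum_charIdem_smul (k := k) τ v]; exact Submodule.sum_mem _ fun wt _ => h wt)

end CharacterIdempotents

/-! ### Algebras of `sl₂` type with nilpotent operators. -/

/-- An algebra generated by a finite abelian group of semisimple elements and by a raising and a
lowering operator, which is nilpotent of order `n` and skew-commutes with the group, such that the
commutator of the two operators is a difference of group elements. -/
structure SkewSl2 (k : Type*) [Field k] (T : Type*) [CommGroup T] (A : Type*) [Ring A]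
    [Algebra k A] where
  τ : T →* A
  y : A
  ξ : A
  σ : T →* kˣ
  a : T
  b : T
  n : ℕ
  two_le : 2 ≤ n
  orderOf_σ_b : orderOf (σ b) = n
  σ_a : σ a = (σ b)⁻¹
  τ_mul_y : ∀ t, τ t * y = (σ t : k) • (y * τ t)
  τ_mul_ξ : ∀ t, τ t * ξ = ((σ t)⁻¹ : k) • (ξ * τ t)
  y_mul_ξ : y * ξ = ξ * y + τ a - τ b
  y_pow : y ^ n = 0
  ξ_pow : ξ ^ n = 0
  adjoin_eq_top : Algebra.adjoin k (Set.range τ ∪ {y, ξ}) = ⊤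

namespace SkewSl2

variable {k : Type*} [Field k] {T : Type*} [CommGroup T] {A : Type*} [Ring A]
  [Algebra k A] (S : SkewSl2 k T A)

/-- The root of unity `σ b`. -/
def ρ : k := (S.σ S.b : kˣ)

theorem ρ_ne_zero : S.ρ ≠ 0 := Units.ne_zero _

theorem ρ_pow_eq_one_iff (j : ℕ) : S.ρ ^ j = 1 ↔ S.n ∣ j := by
  rw [← S.orderOf_σ_b, orderOf_dvd_iff_pow_eq_one, ρ, ← Units.val_pow_eq_pow_val,
    Units.val_eq_one]

theorem ρ_pow_n : S.ρ ^ S.n = 1 := (S.ρ_pow_eq_one_iff _).mpr dvd_rfl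

theorem ρ_pow_ne_one {j : ℕ} (h0 : 0 < j) (hj : j < S.n) : S.ρ ^ j ≠ 1 := fun h =>
  absurd (Nat.le_of_dvd h0 ((S.ρ_pow_eq_one_iff j).mp h)) (by omega)

theorem ρ_ne_one : S.ρ ≠ 1 := by
  have := S.ρ_pow_ne_one one_pos S.two_le
  rwa [pow_one] at this

theorem σ_a_val : (S.σ S.a : k) = S.ρ⁻¹ := by rw [S.σ_a, Units.val_inv_eq_inv_val]; rfl

theorem ρ_pow_injOn {i j : ℕ} (hi : i < S.n) (hj : j < S.n) (h : S.ρ ^ i = S.ρ ^ j) : i = j := by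
  wlog hij : i ≤ j generalizing i j
  · exact (this hj hi h.symm (by omega)).symm
  by_contra hne
  apply S.ρ_pow_ne_one (j := j - i) (by omega) (by omega)
  have h1 : S.ρ ^ i * S.ρ ^ (j - i) = S.ρ ^ i * 1 := by
    rw [← pow_add, mul_one, h]
    congr 1
    omega
  exact mul_left_cancel₀ (pow_ne_zero _ S.ρ_ne_zero) h1

/-- The weight `wt σⁱ`. -/
def shift (wt : T →* kˣ) (i : ℤ) : T →* kˣ := wt * S.σ ^ i

theorem shift_apply (wt : T →* kˣ) (i : ℤ) (t : T) : S.shift wt i t = wt t * S.σ t ^ i := rfl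

theorem shift_zero (wt : T →* kˣ) : S.shift wt 0 = wt := by
  ext t
  simp [shift_apply]

theorem shift_shift (wt : T →* kˣ) (i j : ℤ) : S.shift (S.shift wt i) j = S.shift wt (i + j) := by
  ext t
  simp [shift_apply, zpow_add, mul_assoc]

/-- Evaluate at `b`, where `σ` has order `n`. In particular, `n` consecutive shifts of a weight are
distinct. -/
theorem dvd_of_shift_eq {wt : T →* kˣ} {i j : ℤ} (h : S.shift wt i = S.shift wt j) :
    (S.n : ℤ) ∣ i - j := by
  have h1 := DFunLike.congr_fun h S.b
  rw [shift_apply, shift_apply] at h1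
  rw [← S.orderOf_σ_b, orderOf_dvd_iff_zpow_eq_one, zpow_sub, mul_inv_eq_one]
  exact mul_left_cancel h1

theorem shift_b (wt : T →* kˣ) (i : ℤ) :
    (S.shift wt i S.b : k) = (wt S.b : k) * S.ρ ^ i := by
  simp [shift_apply, ρ]

theorem shift_a (wt : T →* kˣ) (i : ℤ) :
    (S.shift wt i S.a : k) = (wt S.a : k) * (S.ρ ^ i)⁻¹ := by
  simp [shift_apply, ρ, S.σ_a]

/-- The coefficient in `ξ yʲ v = yʲ ξ v + c yʲ⁻¹ v` for a vector `v` of weight `wt`. -/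
def coeff (wt : T →* kˣ) (j : ℕ) : k :=
  ∑ i ∈ Finset.range j, ((wt S.b : k) * S.ρ ^ i - (wt S.a : k) * S.ρ⁻¹ ^ i)

/-- Closed form of two geometric sums with denominators cleared, from which the zeros of `coeff` can
be read off. -/
theorem coeff_succ_mul (wt : T →* kˣ) (j : ℕ) :
    (S.ρ - 1) * S.ρ ^ j * S.coeff wt (j + 1) =
      (S.ρ ^ (j + 1) - 1) * ((wt S.b : k) * S.ρ ^ j - (wt S.a : k)) := by
  induction j with
  | zero => simp [coeff]
  | succ j ih =>
    have h1 : S.ρ ^ (j + 1) * S.ρ⁻¹ ^ (j + 1) = 1 := by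
      rw [← mul_pow, mul_inv_cancel₀ S.ρ_ne_zero, one_pow]
    rw [coeff, Finset.sum_range_succ, ← coeff]
    linear_combination S.ρ * ih - (S.ρ - 1) * (wt S.a : k) * h1

/-- In this range `ρ ^ j ≠ 1`, so only the factor that depends on the weight can vanish. The
resulting equation is the linkage condition for `j`. -/
theorem coeff_eq_zero_iff (wt : T →* kˣ) {j : ℕ} (h0 : 0 < j) (hj : j < S.n) :
    S.coeff wt j = 0 ↔ (wt S.a : k) = S.ρ ^ (j - 1) * (wt S.b : k) := by
  obtain ⟨j, rfl⟩ : ∃ i, j = i + 1 := ⟨j - 1, by omega⟩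
  have h1 := S.coeff_succ_mul wt j
  have h2 : (S.ρ - 1) * S.ρ ^ j ≠ 0 :=
    mul_ne_zero (sub_ne_zero.mpr S.ρ_ne_one) (pow_ne_zero _ S.ρ_ne_zero)
  have h3 : S.ρ ^ (j + 1) - 1 ≠ 0 := sub_ne_zero.mpr (S.ρ_pow_ne_one h0 hj)
  rw [Nat.add_sub_cancel]
  constructor
  · intro h
    rw [h, mul_zero, eq_comm, mul_eq_zero, or_iff_right h3, sub_eq_zero] at h1
    rw [← h1, mul_comm]
  · intro h
    rw [h, mul_comm (wt S.b : k), sub_self, mul_zero] at h1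
    exact (mul_eq_zero.mp h1).resolve_left h2

section Module

variable {M : Type*} [AddCommGroup M] [Module k M] [Module A M] [IsScalarTower k A M]

/-- A subspace that is stable under the generators is a submodule. -/
theorem smul_mem_of_stable (W : Submodule k M) (hτ : ∀ t, ∀ w ∈ W, S.τ t • w ∈ W)
    (hy : ∀ w ∈ W, S.y • w ∈ W) (hξ : ∀ w ∈ W, S.ξ • w ∈ W) (x : A) :
    ∀ w ∈ W, x • w ∈ W := by
  have hx : x ∈ Algebra.adjoin k (Set.range S.τ ∪ {S.y, S.ξ}) := by
    rw [S.adjoin_eq_top]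
    trivial
  induction hx using Algebra.adjoin_induction with
  | mem x hx =>
    rcases hx with ⟨t, rfl⟩ | rfl | rfl
    · exact hτ t
    · exact hy
    · exact hξ
  | algebraMap r =>
    intro w hw
    rw [algebraMap_smul]
    exact W.smul_mem r hw
  | add x z _ _ hx hz =>
    intro w hw
    rw [add_smul]
    exact W.add_mem (hx w hw) (hz w hw)
  | mul x z _ _ hx hz =>
    intro w hw
    rw [mul_smul]
    exact hx _ (hz w hw)

variable {S} {wt : T →* kˣ} {v : M}

theorem _root_.HasWeight.y_smul (h : HasWeight S.τ wt v) :
    HasWeight S.τ (S.shift wt 1) (S.y • v) := fun t => by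
  rw [smul_smul, S.τ_mul_y, smul_assoc, mul_smul, h t, smul_comm S.y, smul_smul]
  simp [mul_comm, shift_apply]

theorem _root_.HasWeight.ξ_smul (h : HasWeight S.τ wt v) :
    HasWeight S.τ (S.shift wt (-1)) (S.ξ • v) := fun t => by
  rw [smul_smul, S.τ_mul_ξ, smul_assoc, mul_smul, h t, smul_comm S.ξ, smul_smul]
  simp [mul_comm, shift_apply]

theorem _root_.HasWeight.y_pow_smul (h : HasWeight S.τ wt v) (j : ℕ) :
    HasWeight S.τ (S.shift wt j) (S.y ^ j • v) := by
  induction j with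
  | zero => rwa [Nat.cast_zero, shift_zero, pow_zero, one_smul]
  | succ j ih =>
    rw [Nat.cast_succ, ← shift_shift, pow_succ', mul_smul]
    exact ih.y_smul

theorem _root_.HasWeight.ξ_pow_smul (h : HasWeight S.τ wt v) (j : ℕ) :
    HasWeight S.τ (S.shift wt (-j)) (S.ξ ^ j • v) := by
  induction j with
  | zero => rwa [Nat.cast_zero, neg_zero, shift_zero, pow_zero, one_smul]
  | succ j ih =>
    rw [Nat.cast_succ, neg_add, ← shift_shift, pow_succ', mul_smul]
    exact ih.ξ_smul

theorem _root_.HasWeight.ξ_smul_y_smul (h : HasWeight S.τ wt v) :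
    S.ξ • S.y • v = S.y • S.ξ • v + ((wt S.b : k) - (wt S.a : k)) • v := by
  rw [smul_smul, smul_smul, S.y_mul_ξ, sub_smul, add_smul, h, h, sub_smul]
  abel

theorem _root_.HasWeight.ξ_smul_y_pow_smul (h : HasWeight S.τ wt v) (j : ℕ) :
    S.ξ • S.y ^ (j + 1) • v =
      S.y ^ (j + 1) • S.ξ • v + S.coeff wt (j + 1) • S.y ^ j • v := by
  induction j with
  | zero =>
    rw [zero_add, pow_one, pow_zero, one_smul, h.ξ_smul_y_smul]
    simp [coeff]
  | succ j ih =>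
    have hc : S.coeff wt (j + 1) + ((S.shift wt (j + 1 : ℕ) S.b : k) - S.shift wt (j + 1 : ℕ) S.a) =
        S.coeff wt (j + 1 + 1) := by
      rw [shift_a, shift_b, coeff, coeff, Finset.sum_range_succ _ (j + 1), inv_pow, zpow_natCast]
    rw [pow_succ' S.y (j + 1), mul_smul, (h.y_pow_smul (j + 1)).ξ_smul_y_smul, ih, smul_add,
      smul_comm S.y (S.coeff wt (j + 1)), ← mul_smul S.y, ← mul_smul S.y, ← pow_succ',
      ← pow_succ', add_assoc, ← add_smul, hc]

theorem y_pow_smul_eq_zero {j : ℕ} (hj : S.n ≤ j) (v : M) : S.y ^ j • v = 0 := by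
  obtain ⟨i, rfl⟩ := Nat.exists_eq_add_of_le hj
  rw [pow_add, S.y_pow, zero_mul, zero_smul]

theorem ξ_pow_smul_eq_zero {j : ℕ} (hj : S.n ≤ j) (v : M) : S.ξ ^ j • v = 0 := by
  obtain ⟨i, rfl⟩ := Nat.exists_eq_add_of_le hj
  rw [pow_add, S.ξ_pow, zero_mul, zero_smul]

end Module

end SkewSl2

/-! ### Modules generated by a highest weight vector, that is, a weight vector killed by `ξ`. -/

namespace SkewSl2

variable {k : Type*} [Field k] {T : Type*} [CommGroup T] {A : Type*} [Ring A]
  [Algebra k A] {S : SkewSl2 k T A}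
  {M : Type*} [AddCommGroup M] [Module k M] [Module A M] [IsScalarTower k A M]
  {wt : T →* kˣ} {v : M}

theorem ξ_pow_smul_y_pow_smul_of_lt (h : HasWeight S.τ wt v) (hξ : S.ξ • v = 0) {i j : ℕ}
    (hij : i < j) : S.ξ ^ j • S.y ^ i • v = 0 := by
  induction i generalizing j with
  | zero =>
    obtain ⟨j, rfl⟩ : ∃ l, j = l + 1 := ⟨j - 1, by omega⟩
    rw [pow_zero, one_smul, pow_succ, mul_smul, hξ, smul_zero]
  | succ i ih =>
    obtain ⟨j, rfl⟩ : ∃ l, j = l + 1 := ⟨j - 1, by omega⟩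
    rw [pow_succ, mul_smul, h.ξ_smul_y_pow_smul, hξ, smul_zero, zero_add, smul_comm,
      ih (by omega), smul_zero]

theorem ξ_pow_smul_y_pow_smul_self (h : HasWeight S.τ wt v) (hξ : S.ξ • v = 0) (j : ℕ) :
    S.ξ ^ j • S.y ^ j • v = (∏ i ∈ Finset.range j, S.coeff wt (i + 1)) • v := by
  induction j with
  | zero => simp
  | succ j ih =>
    rw [pow_succ, mul_smul, h.ξ_smul_y_pow_smul, hξ, smul_zero, zero_add, smul_comm, ih,
      smul_smul, Finset.prod_range_succ, mul_comm]

/-- The submodule generated by a highest weight vector `v` is spanned by the `yʲ v`. -/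
theorem exists_eq_sum_of_mem_span (h : HasWeight S.τ wt v) (hξ : S.ξ • v = 0) {x : M}
    (hx : x ∈ Submodule.span A {v}) :
    ∃ α : ℕ → k, x = ∑ j ∈ Finset.range S.n, α j • S.y ^ j • v := by
  set W := Submodule.span k (Set.range fun j : ℕ => S.y ^ j • v) with hW
  have hmem : ∀ j, S.y ^ j • v ∈ W := fun j => Submodule.subset_span ⟨j, rfl⟩
  have hstab : ∀ a : A, ∀ w ∈ W, a • w ∈ W := by
    have aux : ∀ a : A, (∀ j, a • S.y ^ j • v ∈ W) → ∀ w ∈ W, a • w ∈ W := by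
      intro a ha w hw
      induction hw using Submodule.span_induction with
      | mem w hw =>
        obtain ⟨j, rfl⟩ := hw
        exact ha j
      | zero => rw [smul_zero]; exact W.zero_mem
      | add _ _ _ _ h1 h2 => rw [smul_add]; exact W.add_mem h1 h2
      | smul c _ _ h1 => rw [smul_comm]; exact W.smul_mem c h1
    refine fun a => S.smul_mem_of_stable W (fun t => aux _ fun j => ?_) (aux _ fun j => ?_)
      (aux _ fun j => ?_) a
    · rw [h.y_pow_smul j t]
      exact W.smul_mem _ (hmem j)
    · rw [smul_smul, ← pow_succ']
      exact hmem _
    · cases j with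
      | zero =>
        rw [pow_zero, one_smul, hξ]
        exact W.zero_mem
      | succ j =>
        rw [h.ξ_smul_y_pow_smul, hξ, smul_zero, zero_add]
        exact W.smul_mem _ (hmem j)
  have hxW : x ∈ W := by
    obtain ⟨a, rfl⟩ := Submodule.mem_span_singleton.mp hx
    exact hstab a v (by simpa using hmem 0)
  have hW' : W ≤ Submodule.span k (Set.range fun j : Fin S.n => S.y ^ (j : ℕ) • v) := by
    rw [hW, Submodule.span_le]
    rintro _ ⟨j, rfl⟩
    by_cases hj : j < S.n
    · exact Submodule.subset_span ⟨⟨j, hj⟩, rfl⟩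
    · simp only
      rw [y_pow_smul_eq_zero (by omega)]
      exact Submodule.zero_mem _
  obtain ⟨c, rfl⟩ := (Submodule.mem_span_range_iff_exists_fun k).mp (hW' hxW)
  refine ⟨fun j => if hj : j < S.n then c ⟨j, hj⟩ else 0, ?_⟩
  rw [Finset.sum_range]
  refine Finset.sum_congr rfl fun j _ => ?_
  simp

/-- The submodule generated by a highest weight vector is simple if no coefficient vanishes. -/
theorem mem_span_of_mem_span (h : HasWeight S.τ wt v) (hξ : S.ξ • v = 0) {d : ℕ}
    (hd : S.y ^ d • v = 0) (hc : ∀ j, 0 < j → j < d → S.coeff wt j ≠ 0) {x : M}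
    (hx : x ∈ Submodule.span A {v}) (hx0 : x ≠ 0) : v ∈ Submodule.span A {x} := by
  classical
  obtain ⟨α, hα⟩ := exists_eq_sum_of_mem_span h hξ hx
  set I := (Finset.range S.n).filter fun j => α j • S.y ^ j • v ≠ 0 with hI
  have hIne : I.Nonempty := by
    by_contra hne
    rw [Finset.not_nonempty_iff_eq_empty] at hne
    apply hx0
    rw [hα]
    refine Finset.sum_eq_zero fun j hj => ?_
    by_contra h0
    have : j ∈ I := Finset.mem_filter.mpr ⟨hj, h0⟩
    simp [hne] at this
  -- The largest exponent that occurs in `x`. The power `ξʲ` kills all lower terms and turns the top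
  -- one into a nonzero multiple of `v`.
  set j := I.max' hIne with hjdef
  have hj : j ∈ I := I.max'_mem hIne
  obtain ⟨hjn, hj0⟩ := Finset.mem_filter.mp hj
  have hjd : j < d := by
    by_contra hle
    apply hj0
    obtain ⟨i, hi⟩ := Nat.exists_eq_add_of_le (not_lt.mp hle)
    rw [hi, add_comm, pow_add, mul_smul, hd, smul_zero, smul_zero]
  have hαj : α j ≠ 0 := fun h0 => hj0 (by rw [h0, zero_smul])
  have hprod : (∏ i ∈ Finset.range j, S.coeff wt (i + 1)) ≠ 0 :=
    Finset.prod_ne_zero_iff.mpr fun i hi =>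
      hc _ (by omega) (by have := Finset.mem_range.mp hi; omega)
  have key : S.ξ ^ j • x = (α j * ∏ i ∈ Finset.range j, S.coeff wt (i + 1)) • v := by
    rw [hα, Finset.smul_sum, Finset.sum_eq_single j]
    · rw [smul_comm, ξ_pow_smul_y_pow_smul_self h hξ, smul_smul]
    · intro i hi hij
      rcases lt_or_gt_of_ne hij with hlt | hgt
      · rw [smul_comm, ξ_pow_smul_y_pow_smul_of_lt h hξ hlt, smul_zero]
      · have : α i • S.y ^ i • v = 0 := by
          by_contra h0
          have := I.le_max' i (Finset.mem_filter.mpr ⟨hi, h0⟩)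
          omega
        rw [this, smul_zero]
    · exact fun h0 => absurd hjn h0
  have hv : v = (α j * ∏ i ∈ Finset.range j, S.coeff wt (i + 1))⁻¹ • S.ξ ^ j • x := by
    rw [key, smul_smul, inv_mul_cancel₀ (mul_ne_zero hαj hprod), one_smul]
  rw [hv, ← smul_assoc]
  exact Submodule.smul_mem _ _ (Submodule.mem_span_singleton_self x)

theorem HasWeight_mkQ (B : Submodule A M) (h : HasWeight S.τ wt v) :
    HasWeight S.τ wt (B.mkQ v) := fun t => by
  rw [← map_smul, h t]
  rfl

theorem exists_sub_sum_mem (B : Submodule A M) (h : HasWeight S.τ wt v) (hξ : S.ξ • v ∈ B)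
    {x : M} (hx : x ∈ Submodule.span A {v} ⊔ B) :
    ∃ α : ℕ → k, x - ∑ j ∈ Finset.range S.n, α j • S.y ^ j • v ∈ B := by
  have hx' : B.mkQ x ∈ Submodule.span A {B.mkQ v} := by
    have := Submodule.mem_map_of_mem (f := B.mkQ) hx
    rwa [Submodule.map_sup, Submodule.mkQ_map_self, sup_bot_eq, Submodule.map_span,
      Set.image_singleton] at this
  have hξ' : S.ξ • B.mkQ v = 0 := by
    rw [← map_smul]
    exact (Submodule.Quotient.mk_eq_zero B).mpr hξ
  obtain ⟨α, hα⟩ := exists_eq_sum_of_mem_span (HasWeight_mkQ B h) hξ' hx'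
  refine ⟨α, ?_⟩
  rw [← Submodule.ker_mkQ B, LinearMap.mem_ker, map_sub, hα, map_sum, sub_eq_zero]
  rfl

theorem mem_span_sup_of_notMem (B : Submodule A M) (h : HasWeight S.τ wt v) (hξ : S.ξ • v ∈ B)
    {d : ℕ} (hd : S.y ^ d • v ∈ B) (hc : ∀ j, 0 < j → j < d → S.coeff wt j ≠ 0) {x : M}
    (hx : x ∈ Submodule.span A {v} ⊔ B) (hx0 : x ∉ B) : v ∈ Submodule.span A {x} ⊔ B := by
  have hx' : B.mkQ x ∈ Submodule.span A {B.mkQ v} := by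
    have := Submodule.mem_map_of_mem (f := B.mkQ) hx
    rwa [Submodule.map_sup, Submodule.mkQ_map_self, sup_bot_eq, Submodule.map_span,
      Set.image_singleton] at this
  have hz : ∀ a : A, a • v ∈ B → a • B.mkQ v = 0 := fun a ha => by
    rw [← map_smul]
    exact (Submodule.Quotient.mk_eq_zero B).mpr ha
  have := mem_span_of_mem_span (HasWeight_mkQ B h) (hz _ hξ) (hz _ hd) hc hx'
    (by simpa using hx0)
  rw [← Set.image_singleton, ← Submodule.map_span] at this
  obtain ⟨w, hw, hwv⟩ := this
  rw [show v = w + (v - w) by abel]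
  refine Submodule.add_mem_sup hw ?_
  rw [← Submodule.ker_mkQ B, LinearMap.mem_ker, map_sub, hwv, sub_self]

/-- Modulo `B` the vector `v` is a highest weight vector with no vanishing coefficient below `d`, so
it generates a simple module. -/
theorem covBy_span_sup (B : Submodule A M) (h : HasWeight S.τ wt v) (hξ : S.ξ • v ∈ B)
    {d : ℕ} (hd : S.y ^ d • v ∈ B) (hc : ∀ j, 0 < j → j < d → S.coeff wt j ≠ 0) (hv : v ∉ B) :
    B ⋖ Submodule.span A {v} ⊔ B := by
  refine ⟨lt_of_le_of_ne le_sup_right fun h0 => hv ?_, fun Q hBQ hQ => ?_⟩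
  · rw [h0]
    exact (le_sup_left : _ ≤ Submodule.span A {v} ⊔ B) (Submodule.mem_span_singleton_self v)
  · obtain ⟨x, hxQ, hxB⟩ := Set.exists_of_ssubset hBQ
    have hvQ := mem_span_sup_of_notMem B h hξ hd hc (hQ.le hxQ) hxB
    have hvQ' : v ∈ Q := (sup_le ((Submodule.span_singleton_le_iff_mem x Q).mpr hxQ) hBQ.le) hvQ
    exact hQ.not_ge (sup_le ((Submodule.span_singleton_le_iff_mem v Q).mpr hvQ') hBQ.le)

theorem exists_ξ_smul_eq_zero {Q : Submodule A M} {x : M} (hx : x ∈ Q) (hx0 : x ≠ 0) :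
    ∃ i, S.ξ ^ i • x ∈ Q ∧ S.ξ ^ i • x ≠ 0 ∧ S.ξ • S.ξ ^ i • x = 0 := by
  classical
  have hex : ∃ i, S.ξ ^ i • x = 0 := ⟨S.n, ξ_pow_smul_eq_zero le_rfl x⟩
  obtain ⟨i, hi⟩ : ∃ i, Nat.find hex = i + 1 := by
    refine ⟨Nat.find hex - 1, ?_⟩
    have : Nat.find hex ≠ 0 := fun h0 => hx0 (by simpa [h0] using Nat.find_spec hex)
    omega
  refine ⟨i, Q.smul_mem _ hx, Nat.find_min hex (by omega), ?_⟩
  rw [smul_smul, ← pow_succ', ← hi]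
  exact Nat.find_spec hex

variable [Fintype T] [CharZero k]

/-- For `j < n` the weights of the `yʲ v` are distinct, and for `j ≥ n` the vector `yʲ v` is zero.
This holds even when a larger shift of the weight returns to it. -/
theorem charIdem_smul_y_pow_smul (h : HasWeight S.τ wt v) {i j : ℕ} (hi : i < S.n)
    (hij : j ≠ i) : charIdem S.τ (S.shift wt i) • S.y ^ j • v = 0 := by
  by_cases hj : j < S.n
  · refine (h.y_pow_smul j).charIdem_smul_of_ne fun h0 => hij ?_
    have := S.dvd_of_shift_eq h0
    have := Int.eq_zero_of_abs_lt_dvd this (by rw [abs_lt]; omega)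
    omega
  · rw [y_pow_smul_eq_zero (not_lt.mp hj), smul_zero]

theorem charIdem_shift_smul_sum (h : HasWeight S.τ wt v) (α : ℕ → k) {i : ℕ} (hi : i < S.n) :
    charIdem S.τ (S.shift wt i) • ∑ j ∈ Finset.range S.n, α j • S.y ^ j • v =
      α i • S.y ^ i • v := by
  rw [Finset.smul_sum, Finset.sum_eq_single i]
  · rw [smul_comm, (h.y_pow_smul i).charIdem_smul]
  · intro j _ hij
    rw [smul_comm, charIdem_smul_y_pow_smul h hi hij, smul_zero]
  · intro h0
    exact absurd (Finset.mem_range.mpr hi) h0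

theorem charIdem_smul_sum (h : HasWeight S.τ wt v) (α : ℕ → k) :
    charIdem S.τ wt • ∑ j ∈ Finset.range S.n, α j • S.y ^ j • v = α 0 • v := by
  have h2 := S.two_le
  have := charIdem_shift_smul_sum h α (i := 0) (by omega)
  rwa [Nat.cast_zero, shift_zero, pow_zero, one_smul] at this

/-- A simple quotient of a module generated by a highest weight vector is its head. -/
theorem ker_eq_jacobson (h : HasWeight S.τ wt v) (hξ : S.ξ • v = 0)
    (hv : Submodule.span A {v} = ⊤) {N : Type*} [AddCommGroup N] [Module A N] [IsSimpleModule A N]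
    (f : M →ₗ[A] N) (hf : f v ≠ 0) : LinearMap.ker f = Module.jacobson A M := by
  have hfs : Function.Surjective f := LinearMap.surjective_of_ne_zero fun h0 => hf (by simp [h0])
  have hcoatom : IsCoatom (LinearMap.ker f) := LinearMap.isCoatom_ker_of_surjective hfs
  -- The part of `M` of weight `wt` is the line through `v`, so a proper submodule has no such part.
  -- Hence two proper submodules never sum to `M`, and there is only one maximal submodule.
  have hzero : ∀ Q : Submodule A M, Q ≠ ⊤ → ∀ x ∈ Q, charIdem S.τ wt • x = 0 := by
    intro Q hQ x hx
    obtain ⟨α, hα⟩ := exists_eq_sum_of_mem_span h hξ (x := x) (by rw [hv]; trivial)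
    have h1 : charIdem S.τ wt • x = α 0 • v := by rw [hα, charIdem_smul_sum h]
    by_cases h0 : α 0 = 0
    · rw [h1, h0, zero_smul]
    · refine absurd ?_ hQ
      rw [eq_top_iff, ← hv, Submodule.span_singleton_le_iff_mem]
      have h2 : v = (α 0)⁻¹ • charIdem S.τ wt • x := by
        rw [h1, smul_smul, inv_mul_cancel₀ h0, one_smul]
      rw [h2, ← smul_assoc]
      exact Q.smul_mem _ hx
  have hv0 : v ≠ 0 := fun h0 => hf (by rw [h0, map_zero])
  apply le_antisymm
  · refine le_sInf fun Q hQ => ?_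
    have hQ : IsCoatom Q := hQ
    by_contra hle
    have htop : LinearMap.ker f ⊔ Q = ⊤ := by
      rw [sup_comm]
      exact hQ.2 _ (left_lt_sup.mpr hle)
    obtain ⟨x, hx, z, hz, hxz⟩ := Submodule.mem_sup.mp (show v ∈ LinearMap.ker f ⊔ Q by
      rw [htop]; trivial)
    apply hv0
    rw [← h.charIdem_smul, ← hxz, smul_add, hzero _ hcoatom.1 x hx, hzero _ hQ.1 z hz, add_zero]
  · exact sInf_le hcoatom

variable [IsAlgClosed k] [Fintype (T →* kˣ)]

variable (S) in
/-- Every nonzero submodule contains a highest weight vector. -/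
theorem exists_highestWeight {Q : Submodule A M} (hQ : Q ≠ ⊥) :
    ∃ (wt : T →* kˣ) (x : M), x ∈ Q ∧ x ≠ 0 ∧ HasWeight S.τ wt x ∧ S.ξ • x = 0 := by
  obtain ⟨x, hx, hx0⟩ := (Submodule.ne_bot_iff Q).mp hQ
  obtain ⟨wt, hwt⟩ := exists_charIdem_smul_notMem (k := k) S.τ (⊥ : Submodule A M)
    (v := x) (by simpa using hx0)
  obtain ⟨i, h1, h2, h3⟩ := exists_ξ_smul_eq_zero (S := S) (Q.smul_mem (charIdem S.τ wt) hx)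
    (by simpa using hwt)
  exact ⟨_, _, h1, h2, (hasWeight_charIdem_smul S.τ wt x).ξ_pow_smul i, h3⟩

end SkewSl2

/-! ### Recognizing a diamond by its submodules. -/

section DiamondOfLattice

variable {R : Type u} [Ring R] {P : Type u} [AddCommGroup P] [Module R P]

theorem length_eq_of_covBy {B C : Submodule R P} (h : B ⋖ C) :
    Module.length R C = Module.length R B + 1 := by
  have hs := (covBy_iff_quot_is_simple h.le).mp h
  rw [length_eq_add (B.submoduleOf C), (Submodule.submoduleOfEquivOfLe h.le).length_eq]
  congr 1
  exact Module.length_eq_one_iff.mpr hs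

theorem jacobson_smul_le_of_covBy {B C : Submodule R P} (h : B ⋖ C) :
    Ring.jacobson R • C ≤ B := by
  have hs := (covBy_iff_quot_is_simple h.le).mp h
  have : IsSemisimpleModule R (C ⧸ B.submoduleOf C) := by
    have : IsSimpleModule R (C ⧸ B.submoduleOf C) := hs
    infer_instance
  rw [Submodule.smul_le]
  intro a ha x hx
  have h1 := Module.mem_annihilator.mp
    (IsSemisimpleModule.jacobson_le_annihilator R (C ⧸ B.submoduleOf C) ha)
    (Submodule.Quotient.mk ⟨x, hx⟩)
  rw [← Submodule.Quotient.mk_smul, Submodule.Quotient.mk_eq_zero] at h1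
  exact h1

variable [IsArtinianRing R] {Z F W : Submodule R P}

/-- A module with diamond-shaped submodule lattice. -/
theorem isDiamond_of_lattice [Module.Finite R P] (hproj : Module.Projective R P)
    (hinj : Module.Injective R P) (hZ0 : Z ≠ ⊥) (hZ : ∀ Q : Submodule R P, Q ≠ ⊥ → Z ≤ Q)
    (hZF : Z ⋖ F) (hZW : Z ⋖ W) (hne : W ≠ F) (hJ0 : F ⊔ W ≠ ⊤)
    (hJ : ∀ Q : Submodule R P, ¬ Q ≤ F ⊔ W → Q = ⊤) {S : Type u} [AddCommGroup S] [Module R S]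
    (e₁ : (P ⧸ (F ⊔ W)) ≃ₗ[R] S) (e₂ : S ≃ₗ[R] Z) :
    IsDiamond (e₁.toLinearMap ∘ₗ (F ⊔ W).mkQ) (Z.subtype ∘ₗ e₂.toLinearMap) := by
  have hcoatom : IsCoatom (F ⊔ W) := ⟨hJ0, fun Q hQ => hJ Q hQ.not_ge⟩
  have hatom : IsAtom Z := ⟨hZ0, fun Q hQ => by
    by_contra h
    exact hQ.not_ge (hZ Q h)⟩
  have hrad : jacobsonSMulTop R P = F ⊔ W := by
    rw [← moduleJacobson_eq]
    refine le_antisymm (sInf_le (show IsCoatom _ from hcoatom)) ?_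
    refine le_sInf fun Q hQ => ?_
    have hQ : IsCoatom Q := hQ
    have h1 : Q ≤ F ⊔ W := by
      by_contra h
      exact hQ.1 (hJ Q h)
    rcases hQ.le_iff.mp h1 with h2 | h2
    · exact absurd h2 hJ0
    · exact h2.le
  have hinf : F ⊓ W = Z := by
    apply le_antisymm _ (le_inf hZF.le hZW.le)
    rcases hZF.eq_or_eq (le_inf hZF.le hZW.le) inf_le_left with h | h
    · exact h.le
    · rcases hZW.eq_or_eq hZF.le (h ▸ inf_le_right) with h2 | h2
      · exact absurd h2.symm hZF.lt.ne
      · exact absurd h2.symm hne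
  have hFJ : F ⋖ F ⊔ W := covBy_sup_of_inf_covBy_of_inf_covBy_left (hinf ▸ hZF) (hinf ▸ hZW)
  have hsqle : jacobsonSqSMulTop R P ≤ Z := by
    rw [jacobsonSqSMulTop, hrad, Submodule.smul_sup]
    exact sup_le (jacobson_smul_le_of_covBy hZF) (jacobson_smul_le_of_covBy hZW)
  have htors : jacobsonTorsion R P ≤ Z := by
    have := isSemisimpleModule_of_le_jacobsonTorsion (le_refl (jacobsonTorsion R P))
    refine le_of_forall_isSimpleModule_le fun Q _ hQ => ?_
    have hQ' := isSimpleModule_iff_isAtom.mp hQ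
    rcases hQ'.le_iff.mp (hZ Q hQ'.1) with h | h
    · exact absurd h hZ0
    · exact h.ge
  -- If `J² P` were zero, the radical and with it `F` would lie in the socle, which is contained in
  -- `Z`.
  have hsq0 : jacobsonSqSMulTop R P ≠ ⊥ := by
    intro h0
    have := le_jacobsonTorsion_iff.mpr h0
    rw [hrad] at this
    exact hZF.lt.not_ge (le_sup_left.trans (this.trans htors))
  have hsq : jacobsonSqSMulTop R P = Z := le_antisymm hsqle (hZ _ hsq0)
  exact
  { projective := hproj
    injective := hinj
    finite := inferInstance
    surjective := e₁.surjective.comp (F ⊔ W).mkQ_surjective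
    ker_eq := by
      rw [LinearEquiv.ker_comp, Submodule.ker_mkQ, hrad]
    injective_ι := Z.subtype_injective.comp e₂.injective
    range_eq := by
      rw [LinearMap.range_comp, LinearEquiv.range, Submodule.map_subtype_top, hsq]
    torsion_le := htors.trans hsq.ge
    mem_of_smul_smul := fun x hx => by
      rw [hrad]
      by_contra hxJ
      have h1 : Submodule.span R {x} = ⊤ := hJ _ fun h =>
        hxJ (h (Submodule.mem_span_singleton_self x))
      apply hsq0
      refine le_jacobsonTorsion_iff.mp (Submodule.smul_le.mpr fun b hb z _ a ha => ?_)
      obtain ⟨c, rfl⟩ := Submodule.mem_span_singleton.mp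
        (show z ∈ Submodule.span R {x} by rw [h1]; trivial)
      rw [smul_smul b c x]
      exact hx a ha _ (Ideal.mul_mem_right c _ hb)
    length_eq := by
      have hS : Module.length R S = 1 := by
        rw [← e₁.length_eq]
        exact Module.length_eq_one_iff.mpr (isSimpleModule_iff_isCoatom.mpr hcoatom)
      -- The chain `⊥ ⋖ Z ⋖ F ⋖ F ⊔ W ⋖ ⊤` gives length four.
      have hT := length_eq_of_covBy hcoatom.covBy_top
      rw [length_eq_of_covBy hFJ, length_eq_of_covBy hZF,
        length_eq_of_covBy hatom.bot_covBy] at hT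
      rw [hS, ← Module.length_top, hT, Module.length_bot]
      norm_num }

end DiamondOfLattice

/-! ### Extensions of two linked highest weight modules. -/

namespace SkewSl2

section

variable {k : Type*} [Field k] {T : Type*} [CommGroup T] {A : Type*} [Ring A]
  [Algebra k A] {S : SkewSl2 k T A}
  {M : Type*} [AddCommGroup M] [Module k M] [Module A M] [IsScalarTower k A M]
  {wt : T →* kˣ} {v : M}

/-- A power of `y` raises the lowest term of `x` to a nonzero multiple of `yⁿ⁻¹ v`, and all higher
terms vanish because `yⁿ = 0`. -/
theorem y_pow_smul_mem_span (h : HasWeight S.τ wt v) (hξ : S.ξ • v = 0) {x : M}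
    (hx : x ∈ Submodule.span A {v}) (hx0 : x ≠ 0) :
    S.y ^ (S.n - 1) • v ∈ Submodule.span A {x} := by
  classical
  obtain ⟨α, hα⟩ := exists_eq_sum_of_mem_span h hξ hx
  have hex : ∃ j, j < S.n ∧ α j ≠ 0 := by
    by_contra! hne
    apply hx0
    rw [hα]
    exact Finset.sum_eq_zero fun j hj => by rw [hne j (Finset.mem_range.mp hj), zero_smul]
  obtain ⟨hjn, hj0⟩ := Nat.find_spec hex
  set j := Nat.find hex with hj
  have key : S.y ^ (S.n - 1 - j) • x = α j • S.y ^ (S.n - 1) • v := by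
    rw [hα, Finset.smul_sum, Finset.sum_eq_single j]
    · rw [smul_comm, smul_smul (S.y ^ _), ← pow_add]
      congr 3
      omega
    · intro i hi hij
      rcases lt_or_gt_of_ne hij with hlt | hgt
      · have := Nat.find_min hex hlt
        have hi0 : α i = 0 := by
          by_contra h0
          exact this ⟨Finset.mem_range.mp hi, h0⟩
        rw [hi0, zero_smul, smul_zero]
      · rw [smul_comm, smul_smul (S.y ^ _), ← pow_add, y_pow_smul_eq_zero (by omega), smul_zero]
    · exact fun h0 => absurd (Finset.mem_range.mpr hjn) h0
  have hv : S.y ^ (S.n - 1) • v = ((α j)⁻¹ • S.y ^ (S.n - 1 - j)) • x := by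
    rw [smul_assoc, key, smul_smul, inv_mul_cancel₀ hj0, one_smul]
  rw [hv]
  exact Submodule.smul_mem _ _ (Submodule.mem_span_singleton_self x)

theorem y_pow_smul_mem_span_sup (B : Submodule A M) (h : HasWeight S.τ wt v) (hξ : S.ξ • v ∈ B)
    {x : M} (hx : x ∈ Submodule.span A {v} ⊔ B) (hx0 : x ∉ B) :
    S.y ^ (S.n - 1) • v ∈ Submodule.span A {x} ⊔ B := by
  have hx' : B.mkQ x ∈ Submodule.span A {B.mkQ v} := by
    have := Submodule.mem_map_of_mem (f := B.mkQ) hx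
    rwa [Submodule.map_sup, Submodule.mkQ_map_self, sup_bot_eq, Submodule.map_span,
      Set.image_singleton] at this
  have hξ' : S.ξ • B.mkQ v = 0 := by
    rw [← map_smul]
    exact (Submodule.Quotient.mk_eq_zero B).mpr hξ
  have := y_pow_smul_mem_span (HasWeight_mkQ B h) hξ' hx' (by simpa using hx0)
  rw [← Set.image_singleton, ← Submodule.map_span] at this
  obtain ⟨w, hw, hwv⟩ := this
  rw [show S.y ^ (S.n - 1) • v = w + (S.y ^ (S.n - 1) • v - w) by abel]
  refine Submodule.add_mem_sup hw ?_
  rw [← Submodule.ker_mkQ B, LinearMap.mem_ker, map_sub, hwv, map_smul, sub_self]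

variable (S) in
/-- The left ideal defining the universal module generated by a highest weight vector. -/
def vermaIdeal (wt : T →* kˣ) : Ideal A :=
  Ideal.span ({S.ξ} ∪ Set.range fun t => S.τ t - algebraMap k A (wt t))

theorem hasWeight_mk_vermaIdeal (wt : T →* kˣ) :
    HasWeight S.τ wt (Submodule.Quotient.mk 1 : A ⧸ S.vermaIdeal wt) := fun t => by
  rw [← Submodule.Quotient.mk_smul, ← Submodule.Quotient.mk_smul, Submodule.Quotient.eq]
  apply Ideal.subset_span
  refine Or.inr ⟨t, ?_⟩
  simp [Algebra.algebraMap_eq_smul_one]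

theorem ξ_smul_mk_vermaIdeal (wt : T →* kˣ) :
    S.ξ • (Submodule.Quotient.mk 1 : A ⧸ S.vermaIdeal wt) = 0 := by
  rw [← Submodule.Quotient.mk_smul, Submodule.Quotient.mk_eq_zero, smul_eq_mul, mul_one]
  exact Ideal.subset_span (Or.inl rfl)

theorem span_mk_vermaIdeal (wt : T →* kˣ) :
    Submodule.span A {(Submodule.Quotient.mk 1 : A ⧸ S.vermaIdeal wt)} = ⊤ := by
  rw [eq_top_iff]
  rintro x -
  obtain ⟨x, rfl⟩ := Submodule.Quotient.mk_surjective _ x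
  exact Submodule.mem_span_singleton.mpr ⟨x, by
    rw [← Submodule.Quotient.mk_smul, smul_eq_mul, mul_one]⟩

/-- The homomorphism from the universal highest weight module. -/
def vermaLift (h : HasWeight S.τ wt v) (hξ : S.ξ • v = 0) : (A ⧸ S.vermaIdeal wt) →ₗ[A] M :=
  (S.vermaIdeal wt).liftQ (LinearMap.toSpanSingleton A M v) (by
    rw [vermaIdeal, Ideal.span, Submodule.span_le]
    rintro _ (rfl | ⟨t, rfl⟩)
    · exact hξ
    · simp only [SetLike.mem_coe, LinearMap.mem_ker, LinearMap.toSpanSingleton_apply]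
      rw [sub_smul, h t, algebraMap_smul, sub_self])

theorem vermaLift_mk_one (h : HasWeight S.τ wt v) (hξ : S.ξ • v = 0) :
    vermaLift h hξ (Submodule.Quotient.mk 1) = v := by
  rw [vermaLift, Submodule.liftQ_apply, LinearMap.toSpanSingleton_apply, one_smul]

variable [Fintype T] [CharZero k]

/-- A simple module is determined by the weight of a highest weight vector. -/
theorem nonempty_quotient_equiv (h : HasWeight S.τ wt v) (hξ : S.ξ • v = 0)
    (hv : Submodule.span A {v} = ⊤) {N : Type*} [AddCommGroup N] [Module k N] [Module A N]
    [IsScalarTower k A N] [IsSimpleModule A N] {w : N} (hw : HasWeight S.τ wt w)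
    (hwξ : S.ξ • w = 0) (hw0 : w ≠ 0) [IsSimpleModule A M] :
    Nonempty (M ≃ₗ[A] N) := by
  have hv0 : v ≠ 0 := fun h0 => by
    have := IsSimpleModule.nontrivial A M
    rw [h0, Submodule.span_zero_singleton] at hv
    exact bot_ne_top hv
  have h1 := ker_eq_jacobson (hasWeight_mk_vermaIdeal wt) (ξ_smul_mk_vermaIdeal wt)
    (span_mk_vermaIdeal wt) (vermaLift h hξ) (by rwa [vermaLift_mk_one])
  have h2 := ker_eq_jacobson (hasWeight_mk_vermaIdeal wt) (ξ_smul_mk_vermaIdeal wt)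
    (span_mk_vermaIdeal wt) (vermaLift hw hwξ) (by rwa [vermaLift_mk_one])
  have s1 : Function.Surjective (vermaLift h hξ) := LinearMap.surjective_of_ne_zero fun h0 =>
    hv0 (by rw [← vermaLift_mk_one h hξ, h0, LinearMap.zero_apply])
  have s2 : Function.Surjective (vermaLift hw hwξ) := LinearMap.surjective_of_ne_zero fun h0 =>
    hw0 (by rw [← vermaLift_mk_one hw hwξ, h0, LinearMap.zero_apply])
  exact ⟨((vermaLift h hξ).quotKerEquivOfSurjective s1).symm.trans
    ((Submodule.quotEquivOfEq _ _ (h1.trans h2.symm)).trans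
      ((vermaLift hw hwξ).quotKerEquivOfSurjective s2))⟩

theorem nonempty_equiv {N : Type*} [AddCommGroup N] [Module k N] [Module A N]
    [IsScalarTower k A N] [IsSimpleModule A M] [IsSimpleModule A N]
    (h : HasWeight S.τ wt v) (hξ : S.ξ • v = 0) (hv0 : v ≠ 0) {w : N} (hw : HasWeight S.τ wt w)
    (hwξ : S.ξ • w = 0) (hw0 : w ≠ 0) : Nonempty (M ≃ₗ[A] N) :=
  nonempty_quotient_equiv h hξ (IsSimpleModule.span_singleton_eq_top A hv0) hw hwξ hw0

end

section

variable {k : Type*} [Field k] {T : Type*} [CommGroup T] {A : Type*} [Ring A]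
  [Algebra k A] (S : SkewSl2 k T A) {P : Type*} [AddCommGroup P] [Module k P]
  [Module A P] [IsScalarTower k A P]

/-- A generator of a module that is an extension of two highest weight modules of dimension `n`
which have the composition factors of dimensions `l` and `m`, where `l + m = n`. -/
structure IsLinkedGenerator (wt : T →* kˣ) (l m : ℕ) (u : P) : Prop where
  l_pos : 1 ≤ l
  m_pos : 1 ≤ m
  add_eq : l + m = S.n
  wt_a : (wt S.a : k) = S.ρ ^ (l - 1) * (wt S.b : k)
  hasWeight : HasWeight S.τ wt u
  span_eq : Submodule.span A {u} = ⊤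
  ξ_smul : S.ξ • S.ξ ^ m • u = 0
  ξ_smul_mem : S.ξ • u ∈ Submodule.span A {S.ξ ^ m • u}
  y_pow_smul_ne_zero : S.y ^ (S.n - 1) • S.ξ ^ m • u ≠ 0
  y_pow_smul_notMem : S.y ^ (S.n - 1) • u ∉ Submodule.span A {S.ξ ^ m • u}

end

section

variable {k : Type*} [Field k] {T : Type*} [CommGroup T] {A : Type u} [Ring A]
  [Algebra k A] {S : SkewSl2 k T A} {wt : T →* kˣ} {l m : ℕ}

theorem coeff_ne_zero (hl : 1 ≤ l) (hln : l < S.n)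
    (h : (wt S.a : k) = S.ρ ^ (l - 1) * (wt S.b : k)) {j : ℕ} (hj : 0 < j) (hjn : j < S.n)
    (hjl : j ≠ l) : S.coeff wt j ≠ 0 := by
  rw [Ne, S.coeff_eq_zero_iff wt hj hjn, h]
  intro h0
  have := S.ρ_pow_injOn (by omega) (by omega) (mul_right_cancel₀ (Units.ne_zero _) h0)
  omega

/-- Linkage is symmetric: since `ρⁿ = 1` and `l + m = n`, a weight linked with `l` has the shift by
`l` linked with `m`. -/
theorem shift_a_eq (hl : 1 ≤ l) (hm : 1 ≤ m) (hlm : l + m = S.n)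
    (h : (wt S.a : k) = S.ρ ^ (l - 1) * (wt S.b : k)) :
    (S.shift wt l S.a : k) = S.ρ ^ (m - 1) * (S.shift wt l S.b : k) := by
  rw [shift_a, shift_b, h, zpow_natCast]
  have h1 : S.ρ ^ (l - 1) = S.ρ ^ l * S.ρ ^ l * S.ρ ^ (m - 1) := by
    rw [← pow_add, ← pow_add, show l + l + (m - 1) = S.n + (l - 1) by omega, pow_add, S.ρ_pow_n,
      one_mul]
  rw [h1]
  have := pow_ne_zero l S.ρ_ne_zero
  field_simp

theorem shift_neg_a_eq (hl : 1 ≤ l) (hm : 1 ≤ m) (hlm : l + m = S.n)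
    (h : (wt S.a : k) = S.ρ ^ (l - 1) * (wt S.b : k)) :
    (S.shift wt (-m) S.a : k) = S.ρ ^ (m - 1) * (S.shift wt (-m) S.b : k) := by
  rw [shift_a, shift_b, h, zpow_neg, zpow_natCast]
  have h1 : S.ρ ^ (m - 1) = S.ρ ^ m * S.ρ ^ m * S.ρ ^ (l - 1) := by
    rw [← pow_add, ← pow_add, show m + m + (l - 1) = S.n + (m - 1) by omega, pow_add, S.ρ_pow_n,
      one_mul]
  rw [h1]
  have := pow_ne_zero m S.ρ_ne_zero
  field_simp

namespace IsLinkedGenerator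

variable {P : Type u} [AddCommGroup P] [Module k P] [Module A P] [IsScalarTower k A P]
  {u : P}

/-- The vertices of the diamond are represented by `u` at the top, `ξᵐ u` and `yˡ u` in the middle,
of weights `wt σ⁻ᵐ` and `wt σˡ`, and `yᵐ ξᵐ u` at the bottom, again of weight `wt`. The submodule
generated by `ξᵐ u` and the quotient by it are the two highest weight modules. -/
theorem hasWeight_ξ_pow (h : IsLinkedGenerator S wt l m u) :
    HasWeight S.τ (S.shift wt (-m)) (S.ξ ^ m • u) :=
  h.hasWeight.ξ_pow_smul m

theorem hasWeight_y_pow_ξ_pow (h : IsLinkedGenerator S wt l m u) :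
    HasWeight S.τ wt (S.y ^ m • S.ξ ^ m • u) := by
  have := h.hasWeight_ξ_pow.y_pow_smul m
  rwa [shift_shift, neg_add_cancel, shift_zero] at this

/-- The weight of `ξᵐ u` is linked with `m`, so the coefficient produced by commuting `ξ` past `yᵐ`
vanishes. -/
theorem ξ_smul_y_pow_ξ_pow (h : IsLinkedGenerator S wt l m u) :
    S.ξ • S.y ^ m • S.ξ ^ m • u = 0 := by
  have h1 := h.m_pos
  have h2 := h.l_pos
  have h3 := h.add_eq
  obtain ⟨i, hi⟩ : ∃ i, m = i + 1 := ⟨m - 1, by omega⟩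
  have hc : S.coeff (S.shift wt (-m)) m = 0 :=
    (S.coeff_eq_zero_iff _ (by omega) (by omega)).mpr (shift_neg_a_eq h2 h1 h3 h.wt_a)
  have := h.hasWeight_ξ_pow.ξ_smul_y_pow_smul i
  rw [← hi, hc, h.ξ_smul, smul_zero, zero_smul, zero_add] at this
  exact this

theorem coeff_neg_ne_zero (h : IsLinkedGenerator S wt l m u) {j : ℕ} (hj : 0 < j) (hjm : j < m) :
    S.coeff (S.shift wt (-m)) j ≠ 0 := by
  have h1 := h.m_pos
  have h2 := h.l_pos
  have h3 := h.add_eq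
  exact coeff_ne_zero h1 (by omega) (shift_neg_a_eq h2 h1 h3 h.wt_a) hj (by omega) (by omega)

theorem coeff_pos_ne_zero (h : IsLinkedGenerator S wt l m u) {j : ℕ} (hj : 0 < j) (hjm : j < m) :
    S.coeff (S.shift wt l) j ≠ 0 := by
  have h1 := h.m_pos
  have h2 := h.l_pos
  have h3 := h.add_eq
  exact coeff_ne_zero h1 (by omega) (shift_a_eq h2 h1 h3 h.wt_a) hj (by omega) (by omega)

theorem coeff_wt_ne_zero (h : IsLinkedGenerator S wt l m u) {j : ℕ} (hj : 0 < j) (hjl : j < l) :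
    S.coeff wt j ≠ 0 := by
  have h1 := h.m_pos
  have h2 := h.l_pos
  have h3 := h.add_eq
  exact coeff_ne_zero h2 (by omega) h.wt_a hj (by omega) (by omega)

theorem y_pow_l_notMem (h : IsLinkedGenerator S wt l m u) :
    S.y ^ l • u ∉ Submodule.span A {S.ξ ^ m • u} := by
  intro h0
  have h1 := h.m_pos
  have h3 := h.add_eq
  apply h.y_pow_smul_notMem
  rw [show S.n - 1 = (m - 1) + l by omega, pow_add, mul_smul]
  exact Submodule.smul_mem _ _ h0

/-- The vector `yᵐ ξᵐ u` is killed by `ξ` and by `yˡ`, and its coefficients below `l` do not vanish.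
So it generates a simple module, which any of its nonzero elements generates. -/
theorem span_y_pow_ξ_pow_le (h : IsLinkedGenerator S wt l m u) {Q : Submodule A P}
    (hQ : S.y ^ (S.n - 1) • S.ξ ^ m • u ∈ Q) : Submodule.span A {S.y ^ m • S.ξ ^ m • u} ≤ Q := by
  have h1 := h.l_pos
  have h3 := h.add_eq
  have e : S.y ^ (S.n - 1) • S.ξ ^ m • u = S.y ^ (l - 1) • S.y ^ m • S.ξ ^ m • u := by
    rw [smul_smul (S.y ^ (l - 1)), ← pow_add]
    congr 2
    omega
  rw [Submodule.span_singleton_le_iff_mem]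
  have := mem_span_of_mem_span h.hasWeight_y_pow_ξ_pow h.ξ_smul_y_pow_ξ_pow (d := l)
    (by rw [smul_smul (S.y ^ l), ← pow_add, y_pow_smul_eq_zero (j := l + m) (by omega)])
    (fun j => h.coeff_wt_ne_zero) (x := S.y ^ (S.n - 1) • S.ξ ^ m • u)
    (by rw [e]; exact Submodule.smul_mem _ _ (Submodule.mem_span_singleton_self _))
    h.y_pow_smul_ne_zero
  exact (Submodule.span_singleton_le_iff_mem _ _).mpr hQ this

variable [Fintype T] [CharZero k]

/-- In the module generated by `ξᵐ u` the weight of `ξ u` occurs only on the line of `yᵐ⁻¹ ξᵐ u`.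
The factor is nonzero because `ξ u = 0` would imply `ξᵐ u = 0`. -/
theorem exists_ξ_smul_eq (h : IsLinkedGenerator S wt l m u) :
    ∃ κ : k, κ ≠ 0 ∧ S.ξ • u = κ • S.y ^ (m - 1) • S.ξ ^ m • u := by
  have h1 := h.m_pos
  have h3 := h.add_eq
  obtain ⟨α, hα⟩ := exists_eq_sum_of_mem_span h.hasWeight_ξ_pow h.ξ_smul h.ξ_smul_mem
  have e : S.ξ • u = α (m - 1) • S.y ^ (m - 1) • S.ξ ^ m • u := by
    have h4 := charIdem_shift_smul_sum h.hasWeight_ξ_pow α (i := m - 1) (by omega)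
    rw [shift_shift, show (-(m : ℤ) + ((m - 1 : ℕ) : ℤ)) = -1 by omega, ← hα,
      h.hasWeight.ξ_smul.charIdem_smul] at h4
    exact h4
  refine ⟨α (m - 1), fun h0 => h.y_pow_smul_ne_zero ?_, e⟩
  rw [h0, zero_smul] at e
  obtain ⟨i, hi⟩ : ∃ i, m = i + 1 := ⟨m - 1, by omega⟩
  rw [hi, pow_succ, mul_smul, e, smul_zero, smul_zero]

/-- As `coeff wt l` vanishes, `ξ` passes `yˡ` without an extra term and the previous formula
applies. Since the result is nonzero, `yˡ u` is attached to the bottom of the diamond. -/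
theorem ξ_smul_y_pow_l (h : IsLinkedGenerator S wt l m u) :
    ∃ κ : k, κ ≠ 0 ∧ S.ξ • S.y ^ l • u = κ • S.y ^ (S.n - 1) • S.ξ ^ m • u := by
  have h1 := h.m_pos
  have h2 := h.l_pos
  have h3 := h.add_eq
  obtain ⟨κ, hκ, e⟩ := h.exists_ξ_smul_eq
  refine ⟨κ, hκ, ?_⟩
  obtain ⟨i, hi⟩ : ∃ i, l = i + 1 := ⟨l - 1, by omega⟩
  have hc : S.coeff wt l = 0 := (S.coeff_eq_zero_iff _ (by omega) (by omega)).mpr h.wt_a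
  have h4 := h.hasWeight.ξ_smul_y_pow_smul i
  rw [← hi, hc, zero_smul, add_zero, e, smul_comm _ κ, smul_smul (S.y ^ l), ← pow_add,
    show l + (m - 1) = S.n - 1 by omega] at h4
  exact h4

theorem ξ_smul_y_pow_l_mem (h : IsLinkedGenerator S wt l m u) :
    S.ξ • S.y ^ l • u ∈ Submodule.span A {S.ξ ^ m • u} := by
  obtain ⟨κ, -, e⟩ := h.ξ_smul_y_pow_l
  rw [e, ← smul_assoc]
  exact Submodule.smul_mem _ _ (Submodule.mem_span_singleton_self _)

/-- Let `F` be the module generated by `ξᵐ u`. If `Q` meets `F`, the claim is known for `F`.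
Otherwise, working modulo `F`, the vector `yˡ u` lies in `Q + F`. Its image under `ξ` is a nonzero
multiple of `yⁿ⁻¹ ξᵐ u`, and after projecting to the weight of `yˡ u` the part from `F` contributes
nothing to that image. -/
theorem y_pow_mem_of_ne_bot (h : IsLinkedGenerator S wt l m u) {Q : Submodule A P} (hQ : Q ≠ ⊥) :
    S.y ^ (S.n - 1) • S.ξ ^ m • u ∈ Q := by
  have h1 := h.m_pos
  have h2 := h.l_pos
  have h3 := h.add_eq
  set F := Submodule.span A {S.ξ ^ m • u} with hF
  have hQF : ∀ x ∈ Q, x ∈ F → x ≠ 0 → S.y ^ (S.n - 1) • S.ξ ^ m • u ∈ Q := fun x hx hxF hx0 =>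
    (Submodule.span_singleton_le_iff_mem x Q).mpr hx
      (y_pow_smul_mem_span h.hasWeight_ξ_pow h.ξ_smul hxF hx0)
  obtain ⟨x, hx, hx0⟩ := (Submodule.ne_bot_iff Q).mp hQ
  by_cases hxF : x ∈ F
  · exact hQF x hx hxF hx0
  have h4 := y_pow_smul_mem_span_sup F h.hasWeight h.ξ_smul_mem (x := x)
    (by rw [h.span_eq, top_sup_eq]; trivial) hxF
  have h5 : S.y ^ l • u ∈ Submodule.span A {S.y ^ (S.n - 1) • u} ⊔ F := by
    refine mem_span_sup_of_notMem F (h.hasWeight.y_pow_smul l) h.ξ_smul_y_pow_l_mem (d := m)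
      ?_ (fun j => h.coeff_pos_ne_zero) ?_ h.y_pow_smul_notMem
    · rw [smul_smul (S.y ^ m), ← pow_add, y_pow_smul_eq_zero (by omega)]
      exact F.zero_mem
    · refine Submodule.mem_sup_left ?_
      rw [show S.n - 1 = (m - 1) + l by omega, pow_add, mul_smul]
      exact Submodule.smul_mem _ _ (Submodule.mem_span_singleton_self _)
  have h6 : S.y ^ l • u ∈ Q ⊔ F := by
    have h7 : Submodule.span A {S.y ^ (S.n - 1) • u} ⊔ F ≤ Q ⊔ F := by
      refine sup_le ((Submodule.span_singleton_le_iff_mem _ _).mpr ?_) le_sup_right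
      exact sup_le_sup_right ((Submodule.span_singleton_le_iff_mem x Q).mpr hx) F h4
    exact h7 h5
  obtain ⟨q, hq, z, hz, hqz⟩ := Submodule.mem_sup.mp h6
  obtain ⟨α, hα⟩ := exists_eq_sum_of_mem_span h.hasWeight_ξ_pow h.ξ_smul hz
  set e := charIdem S.τ (S.shift wt l) with he
  -- In `F` the weight `wt σˡ` can occur only at `j = 0`, on the line of `ξᵐ u`, which `ξ` kills;
  -- this happens exactly when `σⁿ = 1` on the group.
  have hez : S.ξ • e • z = 0 := by
    rw [hα, Finset.smul_sum, Finset.smul_sum]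
    refine Finset.sum_eq_zero fun j hj => ?_
    have hj' := Finset.mem_range.mp hj
    rw [smul_comm e, smul_comm S.ξ (α j)]
    by_cases hw : S.shift wt l = S.shift wt (-m + j)
    · have h7 := S.dvd_of_shift_eq hw
      have hj0 : j = 0 := by
        have h8 : (S.n : ℤ) ∣ j := by
          have := dvd_sub (dvd_refl (S.n : ℤ)) h7
          rwa [show (S.n : ℤ) - (l - (-m + j)) = j by omega] at this
        exact Nat.eq_zero_of_dvd_of_lt (Int.natCast_dvd_natCast.mp h8) hj'
      rw [he, hw, ← shift_shift, (h.hasWeight_ξ_pow.y_pow_smul j).charIdem_smul, hj0, pow_zero,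
        one_smul, h.ξ_smul, smul_zero]
    · rw [he, (h.hasWeight_ξ_pow.y_pow_smul j).charIdem_smul_of_ne (by rwa [shift_shift]),
        smul_zero, smul_zero]
  obtain ⟨κ, hκ, hξ⟩ := h.ξ_smul_y_pow_l
  have h8 : S.ξ • e • q = κ • S.y ^ (S.n - 1) • S.ξ ^ m • u := by
    rw [← hξ, ← (h.hasWeight.y_pow_smul l).charIdem_smul, ← hqz, smul_add, smul_add, hez, add_zero]
  have h9 : S.y ^ (S.n - 1) • S.ξ ^ m • u = κ⁻¹ • S.ξ • e • q := by
    rw [h8, smul_smul κ⁻¹, inv_mul_cancel₀ hκ, one_smul]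
  rw [h9, ← smul_assoc]
  exact Q.smul_mem _ (Q.smul_mem _ hq)

/-- The vectors `yʲ yˡ u` have no component of weight `wt`: the weight returns to `wt` only when `n`
divides `j + l`, and then the power of `y` is zero. In the other summand this weight occurs only on
the line of `yᵐ ξᵐ u`. -/
theorem charIdem_smul_mem (h : IsLinkedGenerator S wt l m u) {x : P}
    (hx : x ∈ Submodule.span A {S.ξ ^ m • u} ⊔ Submodule.span A {S.y ^ l • u}) :
    ∃ β : k, charIdem S.τ wt • x = β • S.y ^ m • S.ξ ^ m • u := by
  have h1 := h.m_pos
  have h2 := h.l_pos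
  have h3 := h.add_eq
  rw [sup_comm] at hx
  obtain ⟨α, hα⟩ := exists_sub_sum_mem _ (h.hasWeight.y_pow_smul l) h.ξ_smul_y_pow_l_mem hx
  obtain ⟨β, hβ⟩ := exists_eq_sum_of_mem_span h.hasWeight_ξ_pow h.ξ_smul hα
  refine ⟨β m, ?_⟩
  have h4 := charIdem_shift_smul_sum h.hasWeight_ξ_pow β (i := m) (by omega)
  rw [shift_shift, neg_add_cancel, shift_zero, ← hβ, smul_sub] at h4
  rw [← h4, eq_comm, sub_eq_self, Finset.smul_sum]
  refine Finset.sum_eq_zero fun j _ => ?_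
  have h5 := charIdem_smul_y_pow_smul h.hasWeight (i := 0) (j := j + l) (by omega) (by omega)
  rw [Nat.cast_zero, shift_zero] at h5
  rw [smul_comm, smul_smul (S.y ^ j), ← pow_add, h5, smul_zero]

/-- The quotient by the sum is simple, so `Q` contains `u` up to an element of the sum. Projecting
to weight `wt` leaves `u - β yᵐ ξᵐ u` in `Q`. Applying `ξᵐ` removes the second term, so `ξᵐ u`, and
then `u`, lies in `Q`. -/
theorem eq_top_of_not_le (h : IsLinkedGenerator S wt l m u) {Q : Submodule A P}
    (hQ : ¬ Q ≤ Submodule.span A {S.ξ ^ m • u} ⊔ Submodule.span A {S.y ^ l • u}) : Q = ⊤ := by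
  have h1 := h.m_pos
  have h2 := h.l_pos
  have h3 := h.add_eq
  set J := Submodule.span A {S.ξ ^ m • u} ⊔ Submodule.span A {S.y ^ l • u} with hJ
  obtain ⟨x, hx, hxJ⟩ := SetLike.not_le_iff_exists.mp hQ
  have h4 := mem_span_sup_of_notMem J h.hasWeight (Submodule.mem_sup_left h.ξ_smul_mem) (d := l)
    (Submodule.mem_sup_right (Submodule.mem_span_singleton_self _))
    (fun j => h.coeff_wt_ne_zero) (x := x) (by rw [h.span_eq, top_sup_eq]; trivial) hxJ
  obtain ⟨q, hq, z, hz, hqz⟩ := Submodule.mem_sup.mp h4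
  replace hq : q ∈ Q := (Submodule.span_singleton_le_iff_mem x Q).mpr hx hq
  obtain ⟨β, hβ⟩ := h.charIdem_smul_mem hz
  have h5 : charIdem S.τ wt • q = u - β • S.y ^ m • S.ξ ^ m • u := by
    rw [← hβ, eq_sub_iff_add_eq, ← smul_add, hqz, h.hasWeight.charIdem_smul]
  have h6 : S.ξ ^ m • charIdem S.τ wt • q = S.ξ ^ m • u := by
    rw [h5, smul_sub, sub_eq_self, smul_comm]
    obtain ⟨i, hi⟩ : ∃ i, m = i + 1 := ⟨m - 1, by omega⟩
    have : S.ξ ^ m • S.y ^ m • S.ξ ^ m • u = S.ξ ^ i • S.ξ • S.y ^ m • S.ξ ^ m • u := by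
      rw [smul_smul (S.ξ ^ i), ← pow_succ, ← hi]
    rw [this, h.ξ_smul_y_pow_ξ_pow, smul_zero, smul_zero]
  have h7 : S.ξ ^ m • u ∈ Q := h6 ▸ Q.smul_mem _ (Q.smul_mem _ hq)
  rw [eq_top_iff, ← h.span_eq, Submodule.span_singleton_le_iff_mem,
    show u = charIdem S.τ wt • q + β • S.y ^ m • S.ξ ^ m • u by rw [h5, sub_add_cancel],
    ← smul_assoc β]
  exact Q.add_mem (Q.smul_mem _ hq) (Q.smul_mem _ h7)

theorem notMem_sup (h : IsLinkedGenerator S wt l m u) :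
    u ∉ Submodule.span A {S.ξ ^ m • u} ⊔ Submodule.span A {S.y ^ l • u} := by
  intro h0
  obtain ⟨β, hβ⟩ := h.charIdem_smul_mem h0
  rw [h.hasWeight.charIdem_smul] at hβ
  apply h.y_pow_smul_notMem
  have h1 : u ∈ Submodule.span A {S.ξ ^ m • u} := Submodule.mem_span_singleton.mpr
    ⟨β • S.y ^ m, by rw [smul_assoc, ← hβ]⟩
  exact Submodule.smul_mem _ _ h1

theorem covBy_ξ_pow (h : IsLinkedGenerator S wt l m u) :
    Submodule.span A {S.y ^ m • S.ξ ^ m • u} ⋖ Submodule.span A {S.ξ ^ m • u} := by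
  have h1 := h.m_pos
  have h3 := h.add_eq
  have hle : Submodule.span A {S.y ^ m • S.ξ ^ m • u} ≤ Submodule.span A {S.ξ ^ m • u} :=
    (Submodule.span_singleton_le_iff_mem _ _).mpr
      (Submodule.smul_mem _ _ (Submodule.mem_span_singleton_self _))
  rw [← sup_eq_left.mpr hle]
  refine covBy_span_sup _ h.hasWeight_ξ_pow (by rw [h.ξ_smul]; exact Submodule.zero_mem _) (d := m)
    (Submodule.mem_span_singleton_self _) (fun j => h.coeff_neg_ne_zero) fun h0 => ?_
  obtain ⟨α, hα⟩ := exists_eq_sum_of_mem_span h.hasWeight_y_pow_ξ_pow h.ξ_smul_y_pow_ξ_pow h0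
  -- `yⁿ⁻¹` kills every `yʲ yᵐ ξᵐ u`, because `m ≥ 1`, but it does not kill `ξᵐ u`.
  apply h.y_pow_smul_ne_zero
  rw [hα, Finset.smul_sum]
  refine Finset.sum_eq_zero fun j _ => ?_
  rw [smul_comm, smul_smul (S.y ^ j), ← pow_add, smul_smul (S.y ^ _), ← pow_add,
    y_pow_smul_eq_zero (by omega), smul_zero]

theorem covBy_y_pow (h : IsLinkedGenerator S wt l m u) :
    Submodule.span A {S.y ^ m • S.ξ ^ m • u} ⋖ Submodule.span A {S.y ^ l • u} := by
  have h1 := h.m_pos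
  have h2 := h.l_pos
  have h3 := h.add_eq
  have hne : Submodule.span A {S.y ^ l • u} ≠ ⊥ := fun h0 => h.y_pow_l_notMem (by
    rw [Submodule.span_singleton_eq_bot.mp h0]
    exact Submodule.zero_mem _)
  have hle := h.span_y_pow_ξ_pow_le (h.y_pow_mem_of_ne_bot hne)
  rw [← sup_eq_left.mpr hle]
  refine covBy_span_sup _ (h.hasWeight.y_pow_smul l) ?_ (d := m) ?_
    (fun j => h.coeff_pos_ne_zero) fun h0 => h.y_pow_l_notMem (h.covBy_ξ_pow.le h0)
  · obtain ⟨κ, -, e⟩ := h.ξ_smul_y_pow_l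
    rw [e, show S.n - 1 = (l - 1) + m by omega, pow_add, mul_smul, ← smul_assoc κ]
    exact Submodule.smul_mem _ _ (Submodule.mem_span_singleton_self _)
  · rw [smul_smul (S.y ^ m) (S.y ^ l), ← pow_add, y_pow_smul_eq_zero (j := m + l) (by omega)]
    exact Submodule.zero_mem _

theorem exists_isDiamond [IsArtinianRing A] [Module.Finite A P]
    (h : IsLinkedGenerator S wt l m u) (hproj : Module.Projective A P)
    (hinj : Module.Injective A P) {N : Type u} [AddCommGroup N] [Module k N] [Module A N]
    [IsScalarTower k A N] [IsSimpleModule A N] {w : N} (hw : HasWeight S.τ wt w)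
    (hwξ : S.ξ • w = 0) (hw0 : w ≠ 0) :
    ∃ (π : P →ₗ[A] N) (ι : N →ₗ[A] P), IsDiamond π ι := by
  set F := Submodule.span A {S.ξ ^ m • u} with hF
  set W := Submodule.span A {S.y ^ l • u} with hW
  set Z := Submodule.span A {S.y ^ m • S.ξ ^ m • u} with hZ
  have hJ0 : F ⊔ W ≠ ⊤ := fun h0 => h.notMem_sup (by rw [← hF, ← hW, h0]; trivial)
  have hZ0 : Z ≠ ⊥ := fun h0 => h.y_pow_smul_ne_zero (by
    have h1 := h.l_pos
    have h3 := h.add_eq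
    rw [show S.n - 1 = (l - 1) + m by omega, pow_add, mul_smul,
      Submodule.span_singleton_eq_bot.mp h0, smul_zero])
  have hZmin : ∀ Q : Submodule A P, Q ≠ ⊥ → Z ≤ Q := fun Q hQ =>
    h.span_y_pow_ξ_pow_le (h.y_pow_mem_of_ne_bot hQ)
  have hne : W ≠ F := fun h0 => h.y_pow_l_notMem (by
    rw [← hF, ← h0]
    exact Submodule.mem_span_singleton_self _)
  have hcoatom : IsCoatom (F ⊔ W) := ⟨hJ0, fun Q hQ => h.eq_top_of_not_le hQ.not_ge⟩
  have hs1 : IsSimpleModule A (P ⧸ (F ⊔ W)) := isSimpleModule_iff_isCoatom.mpr hcoatom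
  have hs2 : IsSimpleModule A Z := isSimpleModule_iff_isAtom.mpr ⟨hZ0, fun Q hQ => by
    by_contra h
    exact hQ.not_ge (hZmin Q h)⟩
  obtain ⟨e₁⟩ := nonempty_equiv (HasWeight_mkQ (F ⊔ W) h.hasWeight)
    (by rw [← map_smul]
        exact (Submodule.Quotient.mk_eq_zero _).mpr (Submodule.mem_sup_left h.ξ_smul_mem))
    (fun h0 => h.notMem_sup ((Submodule.Quotient.mk_eq_zero _).mp h0)) hw hwξ hw0
  obtain ⟨e₂⟩ := nonempty_equiv (M := Z) (v := ⟨_, Submodule.mem_span_singleton_self _⟩)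
    (fun t => Subtype.ext (h.hasWeight_y_pow_ξ_pow t)) (Subtype.ext h.ξ_smul_y_pow_ξ_pow)
    (fun h0 => hZ0 (Submodule.span_singleton_eq_bot.mpr (congrArg Subtype.val h0))) hw hwξ hw0
  exact ⟨_, _, isDiamond_of_lattice hproj hinj hZ0 hZmin h.covBy_ξ_pow h.covBy_y_pow hne hJ0
    (fun Q => h.eq_top_of_not_le) e₁ e₂.symm⟩

end IsLinkedGenerator

end

end SkewSl2

/-! ### The monomial basis and the Frobenius form. -/

namespace SkewSl2

section

variable {k : Type*} [Field k] {T : Type*} [CommGroup T] {A : Type*} [Ring A]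
  [Algebra k A] (S : SkewSl2 k T A)
  {M : Type*} [AddCommGroup M] [Module k M] [Module A M]

/-- The subspace spanned by the `yʲ ξⁱ v` with `j < r`. -/
def lowerSpan (v : M) (r : ℕ) : Submodule k M :=
  Submodule.span k {x | ∃ j i, j < r ∧ x = S.y ^ j • S.ξ ^ i • v}

variable {S} {v : M}

theorem mem_lowerSpan {j r : ℕ} (h : j < r) (i : ℕ) :
    S.y ^ j • S.ξ ^ i • v ∈ S.lowerSpan v r :=
  Submodule.subset_span ⟨j, i, h, rfl⟩

variable [IsScalarTower k A M] {wt : T →* kˣ}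

theorem smul_mem_lowerSpan_of_forall {a : A} {r : ℕ} {W : Submodule k M}
    (ha : ∀ j i, j < r → a • S.y ^ j • S.ξ ^ i • v ∈ W) {x : M} (hx : x ∈ S.lowerSpan v r) :
    a • x ∈ W := by
  induction hx using Submodule.span_induction with
  | mem x hx =>
    obtain ⟨j, i, hj, rfl⟩ := hx
    exact ha j i hj
  | zero => rw [smul_zero]; exact W.zero_mem
  | add _ _ _ _ h1 h2 => rw [smul_add]; exact W.add_mem h1 h2
  | smul c _ _ h1 => rw [smul_comm]; exact W.smul_mem c h1

theorem τ_smul_mem_lowerSpan (h : HasWeight S.τ wt v) (t : T) {r : ℕ} {x : M}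
    (hx : x ∈ S.lowerSpan v r) : S.τ t • x ∈ S.lowerSpan v r :=
  smul_mem_lowerSpan_of_forall (fun j i hj => by
    rw [(h.ξ_pow_smul i).y_pow_smul j t]
    exact Submodule.smul_mem _ _ (mem_lowerSpan hj i)) hx

/-- Commuting `ξ` past powers of `y` only creates terms with fewer factors `y`. This triangularity
underlies both the spanning set and the Frobenius form. -/
theorem ξ_smul_y_pow_smul_sub_mem (h : HasWeight S.τ wt v) (r i : ℕ) :
    S.ξ • S.y ^ r • S.ξ ^ i • v - S.y ^ r • S.ξ ^ (i + 1) • v ∈ S.lowerSpan v r := by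
  rw [pow_succ' S.ξ, mul_smul S.ξ]
  cases r with
  | zero =>
    simp only [pow_zero, one_smul, sub_self]
    exact Submodule.zero_mem _
  | succ r =>
    rw [(h.ξ_pow_smul i).ξ_smul_y_pow_smul, add_sub_cancel_left]
    exact Submodule.smul_mem _ _ (mem_lowerSpan (by omega) i)

theorem lowerSpan_mono {r r' : ℕ} (hr : r ≤ r') : S.lowerSpan v r ≤ S.lowerSpan v r' :=
  Submodule.span_mono fun _ ⟨j, i, hj, h⟩ => ⟨j, i, by omega, h⟩

theorem ξ_smul_mem_lowerSpan (h : HasWeight S.τ wt v) {r : ℕ} {x : M}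
    (hx : x ∈ S.lowerSpan v r) : S.ξ • x ∈ S.lowerSpan v r :=
  smul_mem_lowerSpan_of_forall (fun j i hj => by
    rw [← sub_add_cancel (S.ξ • S.y ^ j • S.ξ ^ i • v) (S.y ^ j • S.ξ ^ (i + 1) • v)]
    exact Submodule.add_mem _ (lowerSpan_mono hj.le (ξ_smul_y_pow_smul_sub_mem h j i))
      (mem_lowerSpan hj _)) hx

theorem ξ_pow_smul_y_pow_smul_sub_mem (h : HasWeight S.τ wt v) (r s : ℕ) :
    S.ξ ^ s • S.y ^ r • v - S.y ^ r • S.ξ ^ s • v ∈ S.lowerSpan v r := by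
  induction s with
  | zero =>
    simp only [pow_zero, one_smul, sub_self]
    exact Submodule.zero_mem _
  | succ s ih =>
    have h1 := ξ_smul_mem_lowerSpan h ih
    have h2 := Submodule.add_mem _ h1 (ξ_smul_y_pow_smul_sub_mem h r s)
    rwa [smul_sub, sub_add_sub_cancel, smul_smul S.ξ, ← pow_succ'] at h2

theorem smul_mem_lowerSpan (h : HasWeight S.τ wt v) (a : A) : a • v ∈ S.lowerSpan v S.n := by
  have h2 := S.two_le
  refine S.smul_mem_of_stable _ (fun t x => τ_smul_mem_lowerSpan h t) (fun x hx => ?_)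
    (fun x => ξ_smul_mem_lowerSpan h) a v ?_
  · refine smul_mem_lowerSpan_of_forall (fun j i hj => ?_) hx
    rw [smul_smul S.y, ← pow_succ']
    by_cases hj' : j + 1 < S.n
    · exact mem_lowerSpan hj' i
    · rw [y_pow_smul_eq_zero (by omega)]
      exact Submodule.zero_mem _
  · have := mem_lowerSpan (S := S) (v := v) (show 0 < S.n by omega) 0
    rwa [pow_zero, one_smul, pow_zero, one_smul] at this

theorem charIdem_smul_mem_of_stable [Fintype T] {W : Submodule k M}
    (hW : ∀ t, ∀ w ∈ W, S.τ t • w ∈ W) (μ : T →* kˣ) {x : M} (hx : x ∈ W) :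
    charIdem S.τ μ • x ∈ W := by
  rw [charIdem, smul_assoc, Finset.sum_smul]
  exact W.smul_mem _ (Submodule.sum_mem _ fun t _ => by
    rw [smul_assoc]
    exact W.smul_mem _ (hW t x hx))

end

section

variable {k : Type*} [Field k] [CharZero k] [IsAlgClosed k] {T : Type*} [CommGroup T] [Fintype T]
  [Fintype (T →* kˣ)] {A : Type u} [Ring A] [Algebra k A] (S : SkewSl2 k T A)

/-- The monomials `yʲ ξⁱ e_λ`. -/
noncomputable def monomial (p : Fin S.n × Fin S.n × (T →* kˣ)) : A :=
  S.y ^ (p.1 : ℕ) * (S.ξ ^ (p.2.1 : ℕ) * charIdem S.τ p.2.2)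

theorem span_monomial : ⊤ ≤ Submodule.span k (Set.range S.monomial) := by
  intro a _
  rw [← mul_one a, ← sum_charIdem (k := k) S.τ, Finset.mul_sum]
  refine Submodule.sum_mem _ fun μ _ => ?_
  have h1 := smul_mem_lowerSpan (hasWeight_charIdem S.τ μ) a
  refine (Submodule.span_le.mpr ?_ : S.lowerSpan (charIdem S.τ μ) S.n ≤ _) h1
  rintro _ ⟨j, i, hj, rfl⟩
  by_cases hi : i < S.n
  · exact Submodule.subset_span ⟨(⟨j, hj⟩, ⟨i, hi⟩, μ), rfl⟩
  · rw [ξ_pow_smul_eq_zero (not_lt.mp hi), smul_zero]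
    exact Submodule.zero_mem _

include S in
theorem finite_of_skewSl2 : Module.Finite k A :=
  ⟨Submodule.fg_def.mpr ⟨_, Set.finite_range S.monomial, top_le_iff.mp S.span_monomial⟩⟩

variable {S} (hS : S.n ^ 2 * Nat.card T ≤ Module.finrank k A)

include hS in
theorem linearIndependent_monomial : LinearIndependent k S.monomial := by
  refine linearIndependent_of_top_le_span_of_card_le_finrank S.span_monomial ?_
  have := card_characters k T
  rw [Nat.card_eq_fintype_card] at this
  rw [Fintype.card_prod, Fintype.card_prod, Fintype.card_fin, this, ← mul_assoc, ← sq]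
  exact hS

/-- The basis of monomials. -/
noncomputable def monomialBasis : Module.Basis (Fin S.n × Fin S.n × (T →* kˣ)) k A :=
  Module.Basis.mk (linearIndependent_monomial hS) S.span_monomial

theorem monomialBasis_apply (p : Fin S.n × Fin S.n × (T →* kˣ)) :
    monomialBasis hS p = S.monomial p := by
  rw [monomialBasis, Module.Basis.mk_apply]

theorem coord_monomial [DecidableEq (T →* kˣ)] {j i : ℕ} (hj : j < S.n) (hi : i < S.n)
    (μ : T →* kˣ) (p : Fin S.n × Fin S.n × (T →* kˣ)) :
    (monomialBasis hS).coord p (S.y ^ j • S.ξ ^ i • charIdem S.τ μ) =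
      if (⟨j, hj⟩, ⟨i, hi⟩, μ) = p then 1 else 0 := by
  have : S.y ^ j • S.ξ ^ i • charIdem S.τ μ = monomialBasis hS (⟨j, hj⟩, ⟨i, hi⟩, μ) := by
    rw [monomialBasis_apply]
    rfl
  rw [this, Module.Basis.coord_apply, Module.Basis.repr_self, Finsupp.single_apply]

theorem pred_n_lt : S.n - 1 < S.n := by
  have := S.two_le
  omega

/-- The sum of the coefficients of the `yⁿ⁻¹ ξⁿ⁻¹ e_λ`. -/
noncomputable def frobeniusForm : A →ₗ[k] k :=
  ∑ μ : T →* kˣ, (monomialBasis hS).coord (⟨S.n - 1, pred_n_lt⟩, ⟨S.n - 1, pred_n_lt⟩, μ)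

theorem frobeniusForm_of_lt {j : ℕ} (hj : j < S.n - 1) (i : ℕ) (μ : T →* kˣ) :
    frobeniusForm hS (S.y ^ j • S.ξ ^ i • charIdem S.τ μ) = 0 := by
  classical
  by_cases hi : i < S.n
  · rw [frobeniusForm, LinearMap.sum_apply]
    refine Finset.sum_eq_zero fun ν _ => ?_
    rw [coord_monomial hS (by omega) hi, if_neg]
    simp only [Prod.mk.injEq, Fin.mk.injEq]
    omega
  · rw [ξ_pow_smul_eq_zero (not_lt.mp hi), smul_zero, map_zero]

theorem frobeniusForm_top (μ : T →* kˣ) :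
    frobeniusForm hS (S.y ^ (S.n - 1) • S.ξ ^ (S.n - 1) • charIdem S.τ μ) = 1 := by
  classical
  rw [frobeniusForm, LinearMap.sum_apply,
    Finset.sum_congr rfl fun ν _ => coord_monomial hS pred_n_lt pred_n_lt μ _]
  simp

theorem frobeniusForm_lowerSpan {μ : T →* kˣ} {x : A}
    (hx : x ∈ S.lowerSpan (charIdem S.τ μ) (S.n - 1)) : frobeniusForm hS x = 0 := by
  have : S.lowerSpan (charIdem S.τ μ) (S.n - 1) ≤ LinearMap.ker (frobeniusForm hS) := by
    refine Submodule.span_le.mpr ?_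
    rintro _ ⟨j, i, hj, rfl⟩
    exact frobeniusForm_of_lt hS hj i μ
  exact this hx

/-- Order the monomials lexicographically by the exponents of `y` and `ξ`, and pair each with the
complementary product. A larger exponent of `y` gives a power at least `n`; with equal exponents of
`y`, the product is `yⁿ⁻¹` times a power of `ξ` up to lower terms, and a larger exponent of `ξ`
kills it. The idempotent in front separates the weights. -/
theorem frobeniusForm_pairing [DecidableEq (T →* kˣ)] {p q : Fin S.n × Fin S.n × (T →* kˣ)}
    (hpq : (p.1 : ℕ) * S.n + p.2.1 ≤ (q.1 : ℕ) * S.n + q.2.1) :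
    frobeniusForm hS (charIdem S.τ p.2.2 • S.ξ ^ (S.n - 1 - p.2.1) • S.y ^ (S.n - 1 - p.1) •
      S.monomial q) = if q = p then 1 else 0 := by
  obtain ⟨⟨j₀, hj₀⟩, ⟨i₀, hi₀⟩, μ₀⟩ := p
  obtain ⟨⟨j, hj⟩, ⟨i, hi⟩, μ⟩ := q
  simp only at hpq
  change frobeniusForm hS (charIdem S.τ μ₀ • S.ξ ^ (S.n - 1 - i₀) • S.y ^ (S.n - 1 - j₀) •
    S.y ^ j • S.ξ ^ i • charIdem S.τ μ) = _
  have hle : j₀ ≤ j := by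
    by_contra hlt
    have := Nat.mul_le_mul_right S.n (show j + 1 ≤ j₀ by omega)
    rw [add_mul, one_mul] at this
    omega
  rw [smul_smul (S.y ^ _) (S.y ^ _), ← pow_add]
  rcases hle.lt_or_eq with hlt | rfl
  · rw [y_pow_smul_eq_zero (by omega), smul_zero, smul_zero, map_zero, if_neg]
    simp only [Prod.mk.injEq, Fin.mk.injEq]
    omega
  · rw [Nat.sub_add_cancel (by omega)]
    have hw := (hasWeight_charIdem S.τ μ).ξ_pow_smul (S := S) i
    have h1 := ξ_pow_smul_y_pow_smul_sub_mem hw (S.n - 1) (S.n - 1 - i₀)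
    have h2 : S.lowerSpan (S.ξ ^ i • charIdem S.τ μ) (S.n - 1) ≤
        S.lowerSpan (charIdem S.τ μ) (S.n - 1) := by
      refine Submodule.span_le.mpr ?_
      rintro _ ⟨j', i', hj', rfl⟩
      rw [smul_smul (S.ξ ^ _) (S.ξ ^ _), ← pow_add]
      exact mem_lowerSpan hj' _
    have h3 := frobeniusForm_lowerSpan hS (charIdem_smul_mem_of_stable
      (fun t x => τ_smul_mem_lowerSpan (hasWeight_charIdem S.τ μ) t) μ₀ (h2 h1))
    rw [smul_sub, map_sub, sub_eq_zero] at h3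
    rw [h3, smul_smul (S.ξ ^ _) (S.ξ ^ _), ← pow_add]
    by_cases hii : i = i₀
    · subst hii
      rw [Nat.sub_add_cancel (by omega)]
      have h4 : HasWeight S.τ μ (S.y ^ (S.n - 1) • S.ξ ^ (S.n - 1) • charIdem S.τ μ) := by
        have := ((hasWeight_charIdem S.τ μ).ξ_pow_smul (S := S) (S.n - 1)).y_pow_smul (S.n - 1)
        rwa [shift_shift, neg_add_cancel, shift_zero] at this
      by_cases hμ : μ = μ₀
      · subst hμ
        rw [h4.charIdem_smul, frobeniusForm_top, if_pos rfl]
      · rw [h4.charIdem_smul_of_ne (Ne.symm hμ), map_zero, if_neg]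
        simp [hμ]
    · rw [ξ_pow_smul_eq_zero (by omega), smul_zero, smul_zero, map_zero, if_neg]
      simp [hii]

/-- By triangularity, pairing with the complement of the least monomial occurring in `a` returns its
coefficient. -/
theorem exists_frobeniusForm_ne_zero {a : A} (ha : a ≠ 0) : ∃ z : A, frobeniusForm hS (z * a) ≠ 0 := by
  classical
  set b := monomialBasis hS with hb
  have hne : (b.repr a).support.Nonempty := by
    rw [Finsupp.support_nonempty_iff]
    simpa using ha
  obtain ⟨p, hp, hmin⟩ := Finset.exists_min_image _
    (fun p : Fin S.n × Fin S.n × (T →* kˣ) => (p.1 : ℕ) * S.n + p.2.1) hne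
  refine ⟨charIdem S.τ p.2.2 * (S.ξ ^ (S.n - 1 - p.2.1) * S.y ^ (S.n - 1 - p.1)), ?_⟩
  have h1 : a = ∑ q ∈ (b.repr a).support, b.repr a q • S.monomial q := by
    conv_lhs => rw [← b.linearCombination_repr a]
    rw [Finsupp.linearCombination_apply, Finsupp.sum]
    simp only [hb, monomialBasis_apply]
  rw [← smul_eq_mul, mul_smul, mul_smul]
  conv_lhs => rw [h1]
  rw [Finset.smul_sum, Finset.smul_sum, Finset.smul_sum, map_sum, Finset.sum_eq_single p]
  · rw [smul_comm (S.y ^ _) (b.repr a p), smul_comm (S.ξ ^ _) (b.repr a p),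
      smul_comm (charIdem S.τ p.2.2) (b.repr a p), map_smul,
      frobeniusForm_pairing hS le_rfl, if_pos rfl, smul_eq_mul, mul_one]
    exact Finsupp.mem_support_iff.mp hp
  · intro q hq hqp
    rw [smul_comm (S.y ^ _) (b.repr a q), smul_comm (S.ξ ^ _) (b.repr a q),
      smul_comm (charIdem S.τ p.2.2) (b.repr a q), map_smul,
      frobeniusForm_pairing hS (hmin q hq), if_neg hqp, smul_zero]
  · exact fun h => absurd hp h

include hS in
/-- The algebra is a Frobenius algebra, so it is injective as a module over itself. -/
theorem injective_self : Module.Injective A A := by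
  have := S.finite_of_skewSl2
  have hnd : ∀ c c' : A, (∀ z, frobeniusForm hS (z * c) = frobeniusForm hS (z * c')) → c = c' := by
    intro c c' h
    by_contra hne
    obtain ⟨z, hz⟩ := exists_frobeniusForm_ne_zero hS (sub_ne_zero.mpr hne)
    exact hz (by rw [mul_sub, map_sub, h, sub_self])
  let Φ : A →ₗ[k] Module.Dual k A := ((LinearMap.mul k A).compr₂ (frobeniusForm hS)).flip
  have hΦ : Function.Surjective Φ := by
    refine (LinearMap.injective_iff_surjective_of_finrank_eq_finrank
      Subspace.dual_finrank_eq.symm).mp fun c c' h => hnd c c' fun z => ?_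
    exact LinearMap.congr_fun h z
  refine Module.Baer.injective fun I g => ?_
  -- Baer's criterion: the form composed with `g` extends linearly to `A`, nondegeneracy represents
  -- the extension by an element `c`, and right multiplication by `c` extends `g`.
  obtain ⟨F, hF⟩ := LinearMap.exists_extend (p := I.restrictScalars k)
    (frobeniusForm hS ∘ₗ g.restrictScalars k)
  obtain ⟨c, hc⟩ := hΦ F
  refine ⟨LinearMap.toSpanSingleton A A c, fun x hx => hnd _ _ fun z => ?_⟩
  have h1 : frobeniusForm hS (z * (x * c)) = F (z * x) := by
    rw [← hc, ← mul_assoc]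
    rfl
  have h2 := LinearMap.congr_fun hF ⟨z * x, I.mul_mem_left z hx⟩
  have h3 : g ⟨z * x, I.mul_mem_left z hx⟩ = z * g ⟨x, hx⟩ := g.map_smul z ⟨x, hx⟩
  rw [LinearMap.toSpanSingleton_apply, smul_eq_mul, h1, ← h3]
  exact h2

-- The left ideal of `ξⁱ⁺¹ e_μ` is spanned by monomials whose exponent of `ξ` is at least `i + 1`.
include hS in
theorem y_pow_notMem (i : ℕ) (hi : i < S.n) (μ : T →* kˣ) :
    S.y ^ (S.n - 1) • S.ξ ^ i • charIdem S.τ μ ∉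
      Submodule.span A {S.ξ ^ (i + 1) • charIdem S.τ μ} := by
  classical
  intro h0
  obtain ⟨a, ha⟩ := Submodule.mem_span_singleton.mp h0
  set p : Fin S.n × Fin S.n × (T →* kˣ) := (⟨S.n - 1, pred_n_lt⟩, ⟨i, hi⟩, μ) with hp
  have h1 := smul_mem_lowerSpan ((hasWeight_charIdem S.τ μ).ξ_pow_smul (S := S) (i + 1)) a
  have h2 : S.lowerSpan (S.ξ ^ (i + 1) • charIdem S.τ μ) S.n ≤
      LinearMap.ker ((monomialBasis hS).coord p) := by
    refine Submodule.span_le.mpr ?_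
    rintro _ ⟨j', i', hj', rfl⟩
    rw [smul_smul (S.ξ ^ _) (S.ξ ^ _), ← pow_add]
    by_cases hi' : i' + (i + 1) < S.n
    · rw [SetLike.mem_coe, LinearMap.mem_ker, coord_monomial hS hj' hi', if_neg]
      simp only [hp, Prod.mk.injEq, Fin.mk.injEq]
      omega
    · rw [ξ_pow_smul_eq_zero (not_lt.mp hi'), smul_zero]
      exact Submodule.zero_mem _
  have h3 := h2 h1
  rw [ha, LinearMap.mem_ker, coord_monomial hS pred_n_lt hi, if_pos rfl] at h3
  exact one_ne_zero h3

end

end SkewSl2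

/-! ### The Casimir element and its block idempotents. -/

open Polynomial in
-- Chinese remainder theorem: the factors with root different from `c` are coprime to `(X - c)ⁿ`.
-- The polynomial `p` is divisible by the former and is `1` modulo the latter, so it is idempotent
-- modulo the product, and each `X - f i` with `f i ≠ c` has an inverse `q` on it.
theorem exists_block_polynomial {k : Type*} [Field k] (f : ℕ → k) {n : ℕ} (hn : n ≠ 0) (c : k) :
    ∃ p : k[X], ((∏ i ∈ Finset.range n, (X - C (f i))) ∣ p * p - p) ∧ p.eval c = 1 ∧
      ∀ i, f i ≠ c → ∃ q : k[X], (∏ i ∈ Finset.range n, (X - C (f i))) ∣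
        (q * (X - C (f i)) - 1) * p := by
  classical
  set h : k[X] := ∏ i ∈ (Finset.range n).filter (fun i => f i ≠ c), (X - C (f i)) with hh
  have hdvd : (∏ i ∈ Finset.range n, (X - C (f i))) ∣ h * (X - C c) ^ n := by
    rw [← Finset.prod_filter_mul_prod_filter_not (Finset.range n) (fun i => f i ≠ c)]
    refine mul_dvd_mul_left _ ?_
    rw [Finset.prod_congr rfl (g := fun _ => X - C c), Finset.prod_const]
    · refine pow_dvd_pow _ ((Finset.card_filter_le _ _).trans ?_)
      rw [Finset.card_range]
    · intro i hi
      have := (Finset.mem_filter.mp hi).2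
      rw [not_not.mp this]
  have hcop : ∀ d, d ≠ c → IsCoprime (X - C d) ((X - C c) ^ n) := fun d hd =>
    (isCoprime_X_sub_C_of_isUnit_sub (sub_ne_zero.mpr hd).isUnit).pow_right
  have hcoph : IsCoprime h ((X - C c) ^ n) :=
    IsCoprime.prod_left fun i hi => hcop _ (Finset.mem_filter.mp hi).2
  obtain ⟨a, b, hab⟩ := hcoph
  refine ⟨a * h, ?_, ?_, fun i hi => ?_⟩
  · refine hdvd.trans ⟨-(a * b), ?_⟩
    linear_combination a * h * hab
  · have := congrArg (eval c) hab
    simpa [hn] using this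
  · obtain ⟨q, b', hq⟩ := hcop _ hi
    refine ⟨q, hdvd.trans ⟨-(b' * a), ?_⟩⟩
    linear_combination a * h * hq

namespace SkewSl2

section

variable {k : Type*} [Field k] {T : Type*} [CommGroup T] {A : Type*} [Ring A]
  [Algebra k A] (S : SkewSl2 k T A)

/-- The Casimir element. -/
def casimir : A := S.ξ * S.y + (1 - S.ρ)⁻¹ • (S.τ S.a + S.ρ • S.τ S.b)

theorem one_sub_ρ_ne_zero : 1 - S.ρ ≠ 0 := sub_ne_zero.mpr S.ρ_ne_one.symm

theorem casimir_mul_y : S.casimir * S.y = S.y * S.casimir := by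
  have ha := S.τ_mul_y S.a
  have hb := S.τ_mul_y S.b
  rw [S.σ_a_val] at ha
  change _ = S.ρ • _ at hb
  have h1 := S.one_sub_ρ_ne_zero
  have h2 := S.ρ_ne_zero
  rw [casimir, add_mul, mul_add, smul_mul_assoc, add_mul, smul_mul_assoc, ha, hb, mul_smul_comm,
    mul_add, mul_smul_comm, ← mul_assoc S.y S.ξ, S.y_mul_ξ, sub_mul, add_mul, ha, hb]
  match_scalars <;> field_simp <;> ring

theorem casimir_mul_ξ : S.casimir * S.ξ = S.ξ * S.casimir := by
  have ha := S.τ_mul_ξ S.a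
  have hb := S.τ_mul_ξ S.b
  rw [S.σ_a_val, inv_inv] at ha
  change _ = S.ρ⁻¹ • _ at hb
  have h1 := S.one_sub_ρ_ne_zero
  have h2 := S.ρ_ne_zero
  rw [casimir, add_mul, mul_add, smul_mul_assoc, add_mul, smul_mul_assoc, ha, hb, mul_smul_comm,
    mul_add, mul_smul_comm, mul_assoc S.ξ S.y S.ξ, S.y_mul_ξ, mul_sub, mul_add]
  match_scalars <;> field_simp <;> ring

theorem casimir_mul_τ (t : T) : S.casimir * S.τ t = S.τ t * S.casimir := by
  have h1 : S.τ t * (S.ξ * S.y) = S.ξ * S.y * S.τ t := by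
    rw [← mul_assoc, S.τ_mul_ξ, smul_mul_assoc, mul_assoc, S.τ_mul_y, mul_smul_comm, smul_smul,
      inv_mul_cancel₀ (Units.ne_zero _), one_smul, mul_assoc]
  have h2 : ∀ s, S.τ t * S.τ s = S.τ s * S.τ t := fun s => by rw [← map_mul, mul_comm, map_mul]
  rw [casimir, add_mul, mul_add, h1, mul_smul_comm, smul_mul_assoc, mul_add, add_mul, h2,
    mul_smul_comm, smul_mul_assoc, h2]

theorem casimir_mem_center : S.casimir ∈ Subalgebra.center k A := by
  have h : (⊤ : Subalgebra k A) ≤ Subalgebra.centralizer k {S.casimir} := by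
    rw [← S.adjoin_eq_top, Algebra.adjoin_le_iff]
    rintro _ (⟨t, rfl⟩ | rfl | rfl) <;> rw [SetLike.mem_coe, Subalgebra.mem_centralizer_iff] <;>
      rintro _ rfl
    · exact S.casimir_mul_τ t
    · exact S.casimir_mul_y
    · exact S.casimir_mul_ξ
  rw [Subalgebra.mem_center_iff]
  intro b
  have := (Subalgebra.mem_centralizer_iff k).mp (h (trivial : b ∈ ⊤)) _ rfl
  exact this.symm

theorem mul_aeval_casimir (p : Polynomial k) (b : A) :
    b * Polynomial.aeval S.casimir p = Polynomial.aeval S.casimir p * b := by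
  have h : Algebra.adjoin k {S.casimir} ≤ Subalgebra.center k A :=
    Algebra.adjoin_le (Set.singleton_subset_iff.mpr S.casimir_mem_center)
  exact Subalgebra.mem_center_iff.mp (h (Polynomial.aeval_mem_adjoin_singleton k S.casimir)) b

/-- The scalar by which the Casimir element acts on a highest weight vector. -/
def casimirValue (wt : T →* kˣ) : k := (1 - S.ρ)⁻¹ * (S.ρ * wt S.a + wt S.b)

/-- Up to nonzero factors the difference of the two values is `(ρⁱ - 1) (ρⁱ⁺¹ wt(a) - wt(b))`. -/
theorem casimirValue_shift_eq_iff (wt : T →* kˣ) (i : ℕ) :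
    S.casimirValue (S.shift wt (-i)) = S.casimirValue wt ↔
      S.ρ ^ i = 1 ∨ S.ρ ^ (i + 1) * (wt S.a : k) = wt S.b := by
  have h1 := S.one_sub_ρ_ne_zero
  have h2 := pow_ne_zero i S.ρ_ne_zero
  rw [casimirValue, casimirValue, shift_a, shift_b, zpow_neg, zpow_natCast, inv_inv,
    mul_right_inj' (inv_ne_zero h1), ← sub_eq_zero, ← sub_eq_zero (a := S.ρ ^ i),
    ← sub_eq_zero (a := S.ρ ^ (i + 1) * _), ← mul_eq_zero, ← mul_right_inj' h2, mul_zero]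
  have : S.ρ ^ i * (S.ρ * (↑(wt S.a) * S.ρ ^ i) + ↑(wt S.b) * (S.ρ ^ i)⁻¹ -
      (S.ρ * ↑(wt S.a) + ↑(wt S.b))) = (S.ρ ^ i - 1) * (S.ρ ^ (i + 1) * ↑(wt S.a) - ↑(wt S.b)) := by
    field_simp
    ring
  rw [this]

variable {S} {M : Type*} [AddCommGroup M] [Module k M] [Module A M] [IsScalarTower k A M]
  {wt : T →* kˣ} {v : M}

theorem aeval_casimir_smul_comm (p : Polynomial k) (b : A) (v : M) :
    Polynomial.aeval S.casimir p • b • v = b • Polynomial.aeval S.casimir p • v := by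
  rw [smul_smul, smul_smul, S.mul_aeval_casimir]

theorem casimir_smul (h : HasWeight S.τ wt v) :
    S.casimir • v = S.y • S.ξ • v + S.casimirValue wt • v := by
  have h1 := S.one_sub_ρ_ne_zero
  rw [casimir, add_smul, mul_smul, h.ξ_smul_y_smul, smul_assoc, add_smul, smul_assoc, h, h,
    casimirValue]
  generalize S.y • S.ξ • v = z
  match_scalars <;> field_simp
  ring

open Polynomial in
theorem aeval_X_sub_C_smul (h : HasWeight S.τ wt v) (i : ℕ) :
    aeval S.casimir (X - C (S.casimirValue (S.shift wt (-i)))) • S.ξ ^ i • v =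
      S.y • S.ξ ^ (i + 1) • v := by
  rw [map_sub, aeval_X, aeval_C, sub_smul, casimir_smul (h.ξ_pow_smul i), algebraMap_smul,
    add_sub_cancel_right, smul_smul S.ξ, ← pow_succ']

-- The Casimir element minus its value at `ξⁱ v` acts on `ξⁱ v` as `y ξ`. As it is central, each new
-- factor inserts one `y ξ` between the powers already present. With `n` factors the result is zero,
-- so this product annihilates every vector of weight `wt`.
open Polynomial in
theorem aeval_prod_smul (h : HasWeight S.τ wt v) (r : ℕ) :
    aeval S.casimir (∏ i ∈ Finset.range r, (X - C (S.casimirValue (S.shift wt (-i))))) • v =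
      S.y ^ r • S.ξ ^ r • v := by
  induction r with
  | zero => simp
  | succ r ih =>
    rw [Finset.prod_range_succ, mul_comm, map_mul, mul_smul, ih, aeval_casimir_smul_comm,
      aeval_X_sub_C_smul h, smul_smul (S.y ^ r), ← pow_succ]

open Polynomial in
theorem aeval_smul_eq_zero (h : HasWeight S.τ wt v) {p : k[X]}
    (hp : (∏ i ∈ Finset.range S.n, (X - C (S.casimirValue (S.shift wt (-i))))) ∣ p) :
    aeval S.casimir p • v = 0 := by
  obtain ⟨q, rfl⟩ := hp
  rw [mul_comm, map_mul, mul_smul, aeval_prod_smul h, y_pow_smul_eq_zero le_rfl, smul_zero]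

theorem ξ_pow_smul_mem_span {w : M} {s r : ℕ} (hsr : s ≤ r)
    (h : ∀ i, s ≤ i → i < r → S.ξ ^ i • w ∈ Submodule.span A {S.ξ ^ (i + 1) • w}) :
    S.ξ ^ s • w ∈ Submodule.span A {S.ξ ^ r • w} := by
  induction r, hsr using Nat.le_induction with
  | base => exact Submodule.mem_span_singleton_self _
  | succ r hr ih =>
    have h1 := ih fun i h1 h2 => h i h1 (by omega)
    exact (Submodule.span_singleton_le_iff_mem _ _).mpr (h r hr (by omega)) h1

end

section

variable {R : Type u} [Ring R]

theorem injective_of_split {P Q : Type u} [AddCommGroup P] [Module R P] [AddCommGroup Q]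
    [Module R Q] (hQ : Module.Injective R Q) (i : P →ₗ[R] Q) (s : Q →ₗ[R] P)
    (h : s ∘ₗ i = LinearMap.id) : Module.Injective R P where
  out X Y _ _ _ _ f hf g := by
    obtain ⟨g', hg'⟩ := hQ.out f hf (i ∘ₗ g)
    refine ⟨s ∘ₗ g', fun x => ?_⟩
    rw [LinearMap.comp_apply, hg']
    exact LinearMap.congr_fun h (g x)

theorem projective_and_injective_span {e : R} (he : e * e = e) (hR : Module.Injective R R) :
    Module.Projective R (Submodule.span R {e}) ∧ Module.Injective R (Submodule.span R {e}) := by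
  let s : R →ₗ[R] Submodule.span R {e} :=
    (LinearMap.toSpanSingleton R R e).codRestrict _ fun a =>
      Submodule.smul_mem _ a (Submodule.mem_span_singleton_self e)
  have h : s ∘ₗ (Submodule.span R {e}).subtype = LinearMap.id := by
    ext ⟨x, hx⟩
    obtain ⟨a, rfl⟩ := Submodule.mem_span_singleton.mp hx
    change (a • e) • e = a • e
    rw [smul_eq_mul, smul_eq_mul, mul_assoc, he]
  exact ⟨Module.Projective.of_split _ s h, injective_of_split hR _ s h⟩

end

section

variable {k : Type*} [Field k] [CharZero k] [IsAlgClosed k] {T : Type*} [CommGroup T] [Fintype T]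
  [Fintype (T →* kˣ)] {A : Type u} [Ring A] [Algebra k A] {S : SkewSl2 k T A}

/-- The weight `wt` has a finite-dimensional simple highest weight module that is not projective. -/
def IsLinked (S : SkewSl2 k T A) (wt : T →* kˣ) (l : ℕ) : Prop :=
  1 ≤ l ∧ l < S.n ∧ (wt S.a : k) = S.ρ ^ (l - 1) * (wt S.b : k)

/-- By `ρⁿ = 1`, a recurrence of the Casimir value at `0 < i < n` is the linkage condition for `n -
i`. -/
theorem casimirValue_shift_ne (wt : T →* kˣ) {i : ℕ} (hi0 : 0 < i) (hi : i < S.n)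
    (h : ¬ S.IsLinked wt (S.n - i)) :
    S.casimirValue (S.shift wt (-i)) ≠ S.casimirValue wt := by
  rw [Ne, casimirValue_shift_eq_iff, not_or]
  refine ⟨S.ρ_pow_ne_one hi0 hi, fun h1 => h ⟨by omega, by omega, ?_⟩⟩
  rw [← h1, ← mul_assoc, ← pow_add, show S.n - i - 1 + (i + 1) = S.n by omega, S.ρ_pow_n, one_mul]

theorem casimirValue_shift_eq {wt : T →* kˣ} {l : ℕ} (h : S.IsLinked wt l) :
    S.casimirValue (S.shift wt (-(S.n - l : ℕ))) = S.casimirValue wt := by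
  obtain ⟨h1, h2, h3⟩ := h
  rw [casimirValue_shift_eq_iff]
  right
  rw [h3, ← mul_assoc, ← pow_add, show S.n - l + 1 + (l - 1) = S.n by omega, S.ρ_pow_n, one_mul]

theorem IsLinked.eq {wt : T →* kˣ} {l l' : ℕ} (h : S.IsLinked wt l) (h' : S.IsLinked wt l') :
    l = l' := by
  obtain ⟨h1, h2, h3⟩ := h
  obtain ⟨h1', h2', h3'⟩ := h'
  rw [h3] at h3'
  have := S.ρ_pow_injOn (by omega) (by omega) (mul_right_cancel₀ (Units.ne_zero _) h3')
  omega

/-- The block idempotent of the projective cover of the simple module of highest weight `wt`. -/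
theorem exists_idempotent (hS : S.n ^ 2 * Nat.card T ≤ Module.finrank k A) (wt : T →* kˣ) :
    ∃ E : A, E * E = E ∧ HasWeight S.τ wt E ∧
      (∀ i, 0 < i → i < S.n → ¬ S.IsLinked wt (S.n - i) →
        S.ξ ^ i • E ∈ Submodule.span A {S.ξ ^ (i + 1) • E}) ∧
      (∀ i, i < S.n → (i = 0 ∨ S.IsLinked wt (S.n - i)) → S.y ^ (S.n - 1) • S.ξ ^ i • E ≠ 0) ∧
      (∀ m, 0 < m → S.y ^ (S.n - 1) • E ∉ Submodule.span A {S.ξ ^ m • E}) := by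
  have h2 := S.two_le
  obtain ⟨p, hp1, hp2, hp3⟩ := exists_block_polynomial
    (fun i => S.casimirValue (S.shift wt (-i))) (n := S.n) (by omega) (S.casimirValue wt)
  set e := charIdem S.τ wt with he
  have hew : HasWeight S.τ wt e := hasWeight_charIdem S.τ wt
  have hee : e * e = e := hew.charIdem_smul
  set c := Polynomial.aeval S.casimir p with hc
  have hcomm : ∀ b : A, b * c = c * b := S.mul_aeval_casimir p
  have hi : ∀ i : ℕ, S.ξ ^ i • (c * e) = c • S.ξ ^ i • e := fun i => by
    rw [smul_eq_mul, smul_eq_mul, smul_eq_mul, ← mul_assoc, hcomm, mul_assoc]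
  -- When the value at `i` equals the value at `0`, the polynomial `p - 1` vanishes there, so `c -
  -- 1` contains the factor that acts on `ξⁱ e` as `y ξ`.
  have key : ∀ i : ℕ, S.casimirValue (S.shift wt (-i)) = S.casimirValue wt →
      S.ξ ^ i • (c * e) - S.ξ ^ i • e ∈ Submodule.span A {S.ξ ^ (i + 1) • e} := by
    intro i hci
    obtain ⟨r, hr⟩ := Polynomial.dvd_iff_isRoot.mpr
      (show (p - 1).IsRoot (S.casimirValue wt) by simp [hp2])
    have h3 : c - 1 = Polynomial.aeval S.casimir (p - 1) := by simp [hc]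
    rw [hi, ← one_smul A (S.ξ ^ i • e), smul_smul c, mul_one, ← sub_smul, h3, hr, mul_comm,
      map_mul, mul_smul, ← hci, aeval_X_sub_C_smul hew]
    exact Submodule.smul_mem _ _ (Submodule.smul_mem _ _ (Submodule.mem_span_singleton_self _))
  have hmem : ∀ m : ℕ, 0 < m → Submodule.span A {S.ξ ^ m • (c * e)} ≤
      Submodule.span A {S.ξ ^ (0 + 1) • e} := by
    intro m hm
    rw [Submodule.span_singleton_le_iff_mem, hi]
    refine Submodule.smul_mem _ _ ?_
    have h3 : S.ξ ^ m • e = S.ξ ^ (m - 1) • S.ξ ^ (0 + 1) • e := by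
      rw [smul_smul, ← pow_add, show m - 1 + (0 + 1) = m by omega]
    rw [h3]
    exact Submodule.smul_mem _ _ (Submodule.mem_span_singleton_self _)
  refine ⟨c * e, ?_, fun t => ?_, fun i hi0 hin hl => ?_, fun i hin hl h0 => ?_, fun m hm h0 => ?_⟩
  · have h3 := aeval_smul_eq_zero hew hp1
    rw [map_sub, map_mul, sub_smul, sub_eq_zero, smul_eq_mul, smul_eq_mul] at h3
    rw [mul_assoc, ← mul_assoc e, hcomm e, mul_assoc c e e, hee, ← mul_assoc, h3]
  · rw [smul_eq_mul, ← mul_assoc, hcomm, mul_assoc, ← smul_eq_mul (S.τ t), hew t, mul_smul_comm]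
  -- Here the factor belonging to `i` is invertible on `c * e`, which makes `ξⁱ E` a multiple of `y
  -- ξⁱ⁺¹ E`.
  · obtain ⟨q, hq⟩ := hp3 i (casimirValue_shift_ne wt hi0 hin hl)
    have h3 := aeval_smul_eq_zero (hew.ξ_pow_smul 0) (p := (q * (Polynomial.X - Polynomial.C
      (S.casimirValue (S.shift wt (-i)))) - 1) * p) (by simpa [shift_zero] using hq)
    rw [pow_zero, one_smul, map_mul, map_sub, map_one, mul_smul, sub_smul, one_smul, sub_eq_zero,
      map_mul, mul_smul, smul_eq_mul c] at h3
    have h4 : HasWeight S.τ wt (c * e) := fun t => by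
      rw [smul_eq_mul, ← mul_assoc, hcomm, mul_assoc, ← smul_eq_mul (S.τ t), hew t, mul_smul_comm]
    have h5 : S.ξ ^ i • (c * e) = Polynomial.aeval S.casimir q • S.y • S.ξ ^ (i + 1) • (c * e) := by
      conv_lhs => rw [← h3]
      rw [← aeval_casimir_smul_comm, ← aeval_casimir_smul_comm, aeval_X_sub_C_smul h4]
    rw [h5]
    exact Submodule.smul_mem _ _ (Submodule.smul_mem _ _ (Submodule.mem_span_singleton_self _))
  -- By `key` the element `ξⁱ E` agrees with `ξⁱ e` modulo the left ideal of `ξⁱ⁺¹ e`, so its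
  -- vanishing after `yⁿ⁻¹` would contradict the monomial basis.
  · have hci : S.casimirValue (S.shift wt (-i)) = S.casimirValue wt := by
      rcases hl with rfl | hl
      · rw [Nat.cast_zero, neg_zero, shift_zero]
      · have := casimirValue_shift_eq hl
        rwa [show S.n - (S.n - i) = i by omega] at this
    have h3 := Submodule.smul_mem _ (S.y ^ (S.n - 1)) (key i hci)
    rw [smul_sub, h0, zero_sub, Submodule.neg_mem_iff] at h3
    exact y_pow_notMem hS i hin wt h3
  · have h3 := Submodule.smul_mem _ (S.y ^ (S.n - 1)) (key 0 (by
      rw [Nat.cast_zero, neg_zero, shift_zero]))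
    rw [pow_zero, one_smul, one_smul, smul_sub] at h3
    have h4 := Submodule.sub_mem _ (hmem m hm h0) h3
    rw [sub_sub_cancel] at h4
    have := y_pow_notMem hS 0 (by omega) wt
    rw [pow_zero, one_smul] at this
    exact this h4

end

end SkewSl2

/-! ### Diamonds over the nonprojective simple modules. -/

namespace SkewSl2

variable {k : Type*} [Field k] [CharZero k] [IsAlgClosed k] {T : Type*} [CommGroup T] [Fintype T]
  [Fintype (T →* kˣ)] {A : Type u} [Ring A] [Algebra k A] {S : SkewSl2 k T A}

include S in
theorem isArtinianRing : IsArtinianRing A := by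
  have := S.finite_of_skewSl2
  exact IsArtinianRing.of_finite k A

/-- The left ideals of the `ξⁱ E` agree for `1 ≤ i ≤ n - l` and again for `n - l < i ≤ n`, where
they are zero. This gives the two conditions on `ξ` with `m = n - l`. -/
theorem exists_isLinkedGenerator (hS : S.n ^ 2 * Nat.card T ≤ Module.finrank k A) {wt : T →* kˣ}
    {l : ℕ} (hl : S.IsLinked wt l) :
    ∃ E : A, Module.Projective A (Submodule.span A {E}) ∧
      Module.Injective A (Submodule.span A {E}) ∧
      IsLinkedGenerator S wt l (S.n - l)
        (⟨E, Submodule.mem_span_singleton_self E⟩ : Submodule.span A {E}) := by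
  obtain ⟨E, hE, hw, h1, h2, h3⟩ := exists_idempotent hS wt
  obtain ⟨hl1, hl2, hl3⟩ := id hl
  obtain ⟨hp, hi⟩ := projective_and_injective_span hE (injective_self hS)
  have hne : ∀ i, 0 < i → i < S.n → i ≠ S.n - l → ¬ S.IsLinked wt (S.n - i) := by
    intro i h4 h5 h6 h7
    have := h7.eq hl
    omega
  have hmem : S.ξ ^ 1 • E ∈ Submodule.span A {S.ξ ^ (S.n - l) • E} :=
    ξ_pow_smul_mem_span (by omega) fun i h4 h5 =>
      h1 i (by omega) (by omega) (hne i (by omega) (by omega) (by omega))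
  have hzero : S.ξ ^ (S.n - l + 1) • E ∈ Submodule.span A {S.ξ ^ S.n • E} :=
    ξ_pow_smul_mem_span (by omega) fun i h4 h5 =>
      h1 i (by omega) (by omega) (hne i (by omega) (by omega) (by omega))
  rw [ξ_pow_smul_eq_zero le_rfl, Submodule.span_zero_singleton, Submodule.mem_bot] at hzero
  refine ⟨E, hp, hi, ⟨hl1, by omega, by omega, hl3, fun t => Subtype.ext (hw t), ?_,
    Subtype.ext ?_, ?_, fun h0 => ?_, fun h0 => ?_⟩⟩
  · rw [eq_top_iff]
    rintro ⟨x, hx⟩ -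
    obtain ⟨a, rfl⟩ := Submodule.mem_span_singleton.mp hx
    exact Submodule.mem_span_singleton.mpr ⟨a, rfl⟩
  · rw [pow_succ', mul_smul] at hzero
    exact hzero
  · obtain ⟨a, ha⟩ := Submodule.mem_span_singleton.mp hmem
    rw [pow_one] at ha
    exact Submodule.mem_span_singleton.mpr ⟨a, Subtype.ext ha⟩
  · refine h2 (S.n - l) (by omega) (Or.inr ?_) (congrArg Subtype.val h0)
    rwa [show S.n - (S.n - l) = l by omega]
  · obtain ⟨a, ha⟩ := Submodule.mem_span_singleton.mp h0
    exact h3 (S.n - l) (by omega) (Submodule.mem_span_singleton.mpr ⟨a, congrArg Subtype.val ha⟩)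

variable {N : Type u} [AddCommGroup N] [Module k N] [Module A N] [IsScalarTower k A N]
  [IsSimpleModule A N] {wt : T →* kˣ} {w : N}

theorem exists_isDiamond_of_isLinked (hS : S.n ^ 2 * Nat.card T ≤ Module.finrank k A) {l : ℕ}
    (hl : S.IsLinked wt l) (hw : HasWeight S.τ wt w) (hwξ : S.ξ • w = 0) (hw0 : w ≠ 0) :
    ∃ (P : Type u) (_ : AddCommGroup P) (_ : Module A P) (π : P →ₗ[A] N) (ι : N →ₗ[A] P),
      IsDiamond π ι := by
  have := isArtinianRing (S := S)
  obtain ⟨E, hp, hi, h⟩ := exists_isLinkedGenerator hS hl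
  obtain ⟨π, ι, h⟩ := h.exists_isDiamond hp hi hw hwξ hw0
  exact ⟨_, _, _, π, ι, h⟩

/-- Without linkage the chain of left ideals of the `ξⁱ E` is constant from `i = 1` to `n`, so `ξ E
= 0`. As no coefficient vanishes, `E` generates a simple projective module with the same highest
weight as `N`. -/
theorem projective_of_not_isLinked (hS : S.n ^ 2 * Nat.card T ≤ Module.finrank k A)
    (hl : ∀ l, ¬ S.IsLinked wt l) (hw : HasWeight S.τ wt w) (hwξ : S.ξ • w = 0) (hw0 : w ≠ 0) :
    Module.Projective A N := by
  obtain ⟨E, hE, hwE, h1, h2, -⟩ := exists_idempotent hS wt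
  have h2n := S.two_le
  obtain ⟨hp, -⟩ := projective_and_injective_span hE (injective_self hS)
  have hξ : S.ξ • E = 0 := by
    have := ξ_pow_smul_mem_span (S := S) (w := E) (show 1 ≤ S.n by omega) fun i h4 h5 =>
      h1 i (by omega) (by omega) (hl _)
    rwa [ξ_pow_smul_eq_zero le_rfl, Submodule.span_zero_singleton, Submodule.mem_bot,
      pow_one] at this
  have hE0 : E ≠ 0 := fun h0 => h2 0 (by omega) (Or.inl rfl) (by rw [h0, smul_zero, smul_zero])
  set u : Submodule.span A {E} := ⟨E, Submodule.mem_span_singleton_self E⟩ with hu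
  have huw : HasWeight S.τ wt u := fun t => Subtype.ext (hwE t)
  have huξ : S.ξ • u = 0 := Subtype.ext hξ
  have hu0 : u ≠ 0 := fun h0 => hE0 (congrArg Subtype.val h0)
  have hspan : Submodule.span A {u} = ⊤ := by
    rw [eq_top_iff]
    rintro ⟨x, hx⟩ -
    obtain ⟨a, rfl⟩ := Submodule.mem_span_singleton.mp hx
    exact Submodule.mem_span_singleton.mpr ⟨a, rfl⟩
  have hsimple : IsSimpleModule A (Submodule.span A {E}) := by
    have : Nontrivial (Submodule.span A {E}) := ⟨u, 0, hu0⟩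
    refine { eq_bot_or_eq_top := fun Q => or_iff_not_imp_left.mpr fun hQ => ?_ }
    obtain ⟨x, hx, hx0⟩ := (Submodule.ne_bot_iff Q).mp hQ
    rw [eq_top_iff, ← hspan, Submodule.span_singleton_le_iff_mem]
    refine (Submodule.span_singleton_le_iff_mem x Q).mpr hx (mem_span_of_mem_span huw huξ (d := S.n)
      (y_pow_smul_eq_zero le_rfl u) (fun j hj0 hj => ?_) (by rw [hspan]; trivial) hx0)
    rw [Ne, S.coeff_eq_zero_iff wt hj0 hj]
    exact fun h => hl j ⟨hj0, hj, h⟩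
  obtain ⟨e⟩ := nonempty_equiv huw huξ hu0 hw hwξ hw0
  exact Module.Projective.of_equiv e

-- A projective simple module is a direct summand of the self-injective algebra.
omit [Module k N] [IsScalarTower k A N] in
theorem injective_of_projective (hS : S.n ^ 2 * Nat.card T ≤ Module.finrank k A)
    (hN : Module.Projective A N) : Module.Injective A N := by
  have := IsSimpleModule.nontrivial A N
  obtain ⟨x, hx⟩ := exists_ne (0 : N)
  have hs : Function.Surjective (LinearMap.toSpanSingleton A N x) :=
    IsSimpleModule.toSpanSingleton_surjective A hx
  obtain ⟨i, hi⟩ := Module.projective_lifting_property _ LinearMap.id hs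
  exact injective_of_split (injective_self hS) i _ hi

theorem hasDiamonds (hS : S.n ^ 2 * Nat.card T ≤ Module.finrank k A) : HasDiamonds A where
  injective_of_projective := fun N _ _ _ hN => injective_of_projective hS hN
  exists_diamond := fun N _ _ hs hN => by
    let _ : Module k N := Module.compHom N (algebraMap k A)
    have : IsScalarTower k A N := ⟨fun c a v => by
      rw [Algebra.smul_def, mul_smul]
      rfl⟩
    have hnt := IsSimpleModule.nontrivial A N
    obtain ⟨wt, w, -, hw0, hw, hwξ⟩ := S.exists_highestWeight (M := N) (Q := ⊤) top_ne_bot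
    by_cases hl : ∃ l, S.IsLinked wt l
    · obtain ⟨l, hl⟩ := hl
      exact exists_isDiamond_of_isLinked hS hl hw hwξ hw0
    · exact absurd (projective_of_not_isLinked hS (not_exists.mp hl) hw hwξ hw0) hN

/-- A simple module that is not projective has a highest weight vector of linked weight. -/
theorem exists_isLinked_of_not_projective (hS : S.n ^ 2 * Nat.card T ≤ Module.finrank k A)
    (hN : ¬ Module.Projective A N) :
    ∃ (wt : T →* kˣ) (l : ℕ) (w : N), S.IsLinked wt l ∧ w ≠ 0 ∧ HasWeight S.τ wt w ∧
      S.ξ • w = 0 := by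
  have hnt := IsSimpleModule.nontrivial A N
  obtain ⟨wt, w, -, hw0, hw, hwξ⟩ := S.exists_highestWeight (M := N) (Q := ⊤) top_ne_bot
  by_cases hl : ∃ l, S.IsLinked wt l
  · obtain ⟨l, hl⟩ := hl
    exact ⟨wt, l, w, hl, hw0, hw, hwξ⟩
  · exact absurd (projective_of_not_isLinked hS (not_exists.mp hl) hw hwξ hw0) hN

end SkewSl2

/-! ### Relations and generators of a Drinfeld double. -/

namespace DrinfeldDouble

variable {k : Type u} [Field k] {H : Type w} [Ring H] [HopfAlgebra k H]

theorem ofFun_counit : ofFun k H Coalgebra.counit = 1 := by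
  have := RingQuot.mkAlgHom_rel k (DoubleRel.fun_one (k := k) (H := H))
  rw [map_one] at this
  exact this

theorem ofFun_mul (p q : Module.Dual k H) :
    ofFun k H p * ofFun k H q = ofFun k H (dualConv k H p q) := by
  have := RingQuot.mkAlgHom_rel k (DoubleRel.fun_mul (k := k) (H := H) p q)
  rw [map_mul] at this
  exact this

theorem ofElt_one : ofElt k H 1 = 1 := by
  exact (RingQuot.mkAlgHom_rel k (DoubleRel.elt_one (k := k) (H := H))).trans (map_one _)

theorem ofElt_mul (h h' : H) : ofElt k H h * ofElt k H h' = ofElt k H (h * h') := by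
  have := RingQuot.mkAlgHom_rel k (DoubleRel.elt_mul (k := k) (H := H) h h')
  rw [map_mul] at this
  exact this

theorem ofElt_pow (h : H) (i : ℕ) : ofElt k H h ^ i = ofElt k H (h ^ i) := by
  induction i with
  | zero => rw [pow_zero, pow_zero, ofElt_one]
  | succ i ih => rw [pow_succ, ih, ofElt_mul, pow_succ]

theorem mk_cross (h : H) (p : Module.Dual k H) :
    DrinfeldDouble.mk k H (doubleCrossLeft k H p (Coalgebra.comul h)) =
      DrinfeldDouble.mk k H (doubleCrossRight k H p (Coalgebra.comul h)) :=
  RingQuot.mkAlgHom_rel k (DoubleRel.cross (k := k) (H := H) h p)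

theorem mk_crossLeft_tmul (p : Module.Dual k H) (y z : H) :
    DrinfeldDouble.mk k H (doubleCrossLeft k H p (y ⊗ₜ z)) =
      ofElt k H y * ofFun k H (p ∘ₗ LinearMap.mulLeft k z) := by
  simp only [doubleCrossLeft, TensorProduct.lift.tmul, LinearMap.compl₁₂_apply, LinearMap.mul_apply',
    map_mul]
  rfl

theorem mk_crossRight_tmul (p : Module.Dual k H) (y z : H) :
    DrinfeldDouble.mk k H (doubleCrossRight k H p (y ⊗ₜ z)) =
      ofFun k H (p ∘ₗ LinearMap.mulRight k y) * ofElt k H z := by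
  simp only [doubleCrossRight, TensorProduct.lift.tmul, LinearMap.compl₁₂_apply,
    LinearMap.mul_apply', map_mul]
  rfl

/-- The double is generated by the images of `H^*` and `H`. -/
theorem adjoin_range_eq_top :
    Algebra.adjoin k (Set.range (ofFun k H) ∪ Set.range (ofElt k H)) = ⊤ := by
  rw [eq_top_iff]
  rintro d -
  obtain ⟨t, rfl⟩ := RingQuot.mkAlgHom_surjective k (DoubleRel k H) d
  change DrinfeldDouble.mk k H t ∈ _
  induction t using TensorAlgebra.induction with
  | algebraMap r =>
    rw [AlgHom.commutes]
    exact Subalgebra.algebraMap_mem _ r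
  | ι m =>
    have : DrinfeldDouble.mk k H (TensorAlgebra.ι k m) = ofFun k H m.1 + ofElt k H m.2 := by
      change _ = DrinfeldDouble.mk k H (TensorAlgebra.ι k (m.1, 0)) +
        DrinfeldDouble.mk k H (TensorAlgebra.ι k (0, m.2))
      rw [← map_add, ← map_add]
      simp
    rw [this]
    exact Subalgebra.add_mem _ (Algebra.subset_adjoin (Or.inl ⟨_, rfl⟩))
      (Algebra.subset_adjoin (Or.inr ⟨_, rfl⟩))
  | mul a b ha hb =>
    rw [map_mul]
    exact Subalgebra.mul_mem _ ha hb
  | add a b ha hb =>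
    rw [map_add]
    exact Subalgebra.add_mem _ ha hb

end DrinfeldDouble

/-! ### Homogeneous functionals on `H_D`. -/

namespace GroupDatum

variable {k : Type u} {G : Type v} [Field k] [CommGroup G] [Finite G] (D : GroupDatum k G)

/-- The functional `g xʲ ↦ φ(g) δ_{j,i}`. -/
noncomputable def degFun (φ : G → k) (i : ℕ) : Module.Dual k D.RankOne :=
  D.basis.constr k fun p => if (p.2 : ℕ) = i then φ p.1 else 0

theorem degFun_apply (φ : G → k) (i : ℕ) (g : G) {j : ℕ} (hj : j < D.n) :
    D.degFun φ i (D.gp g * D.x ^ j) = if j = i then φ g else 0 := by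
  have := D.basis.constr_basis k (fun p => if (p.2 : ℕ) = i then φ p.1 else 0) (g, ⟨j, hj⟩)
  rwa [basis_apply] at this

theorem dual_ext {p q : Module.Dual k D.RankOne}
    (h : ∀ (g : G) (j : ℕ), j < D.n → p (D.gp g * D.x ^ j) = q (D.gp g * D.x ^ j)) : p = q := by
  refine D.basis.ext fun i => ?_
  obtain ⟨g, j, hj⟩ := i
  rw [basis_apply]
  exact h g j hj

theorem degFun_of_le (φ : G → k) {i : ℕ} (hi : D.n ≤ i) : D.degFun φ i = 0 :=
  D.dual_ext fun g j hj => by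
    rw [degFun_apply _ _ _ _ hj, if_neg (by omega), LinearMap.zero_apply]

theorem gaussBinom_zero_right (q : k) (m : ℕ) : gaussBinom q m 0 = 1 := by
  cases m <;> rfl

theorem comul_gp_mul_x_pow (g : G) (m : ℕ) :
    Coalgebra.comul (R := k) (D.gp g * D.x ^ m) =
      ∑ j ∈ Finset.range (m + 1), gaussBinom D.ρ m j •
        ((D.gp g * D.x ^ j) ⊗ₜ[k] (D.gp (g * D.a ^ j) * D.x ^ (m - j))) := by
  have h1 : (1 ⊗ₜ[k] D.x : D.RankOne ⊗[k] D.RankOne) * (D.x ⊗ₜ[k] D.gp D.a) =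
      D.ρ • ((D.x ⊗ₜ[k] D.gp D.a) * (1 ⊗ₜ[k] D.x)) := by
    rw [Algebra.TensorProduct.tmul_mul_tmul, Algebra.TensorProduct.tmul_mul_tmul, one_mul, mul_one,
      x_mul_gp, TensorProduct.tmul_smul]
    rfl
  rw [Bialgebra.comul_mul, Bialgebra.comul_pow, comul_gp, comul_x, add_pow_of_skew _ _ _ h1,
    Finset.mul_sum]
  refine Finset.sum_congr rfl fun j _ => ?_
  rw [mul_smul_comm, Algebra.TensorProduct.tmul_pow, Algebra.TensorProduct.tmul_pow, one_pow,
    Algebra.TensorProduct.tmul_mul_tmul, Algebra.TensorProduct.tmul_mul_tmul, mul_one, ← mul_assoc,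
    map_mul, map_pow]

theorem dualConv_apply (p q : Module.Dual k D.RankOne) (g : G) (m : ℕ) :
    dualConv k D.RankOne p q (D.gp g * D.x ^ m) =
      ∑ j ∈ Finset.range (m + 1), gaussBinom D.ρ m j *
        (p (D.gp g * D.x ^ j) * q (D.gp (g * D.a ^ j) * D.x ^ (m - j))) := by
  rw [dualConv, LinearMap.comp_apply, LinearMap.comp_apply, comul_gp_mul_x_pow, map_sum, map_sum]
  refine Finset.sum_congr rfl fun j _ => ?_
  rw [map_smul, map_smul, TensorProduct.map_tmul, LinearMap.mul'_apply, smul_eq_mul]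

/-- In the `q`-binomial formula for the coproduct of `g xᵐ` only the term of degree `i` on the left
and `j` on the right survives; it requires `m = i + j`. -/
theorem dualConv_degFun (φ ψ : G → k) (i j : ℕ) :
    dualConv k D.RankOne (D.degFun φ i) (D.degFun ψ j) =
      gaussBinom D.ρ (i + j) i • D.degFun (fun g => φ g * ψ (g * D.a ^ i)) (i + j) := by
  refine D.dual_ext fun g m hm => ?_
  rw [dualConv_apply, LinearMap.smul_apply, degFun_apply _ _ _ _ hm, smul_eq_mul]
  have h1 : ∀ r ∈ Finset.range (m + 1), gaussBinom D.ρ m r *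
      (D.degFun φ i (D.gp g * D.x ^ r) * D.degFun ψ j (D.gp (g * D.a ^ r) * D.x ^ (m - r))) =
      if r = i then (if m = i + j then gaussBinom D.ρ m i * (φ g * ψ (g * D.a ^ i)) else 0)
      else 0 := by
    intro r hr
    have := Finset.mem_range.mp hr
    rw [degFun_apply _ _ _ _ (by omega), degFun_apply _ _ _ _ (by omega)]
    by_cases hri : r = i
    · subst hri
      by_cases hmj : m = r + j
      · simp [hmj]
      · rw [if_neg (show ¬ m - r = j by omega)]
        simp [hmj]
    · simp [hri]
  rw [Finset.sum_congr rfl h1, Finset.sum_ite_eq']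
  by_cases hm' : m = i + j
  · subst hm'
    simp
  · simp [hm']

theorem counit_eq : (Coalgebra.counit : D.RankOne →ₗ[k] k) = D.degFun (fun _ => 1) 0 :=
  D.dual_ext fun g j hj => by
    rw [degFun_apply _ _ _ _ hj, Bialgebra.counit_mul, Bialgebra.counit_pow, counit_gp, counit_x,
      one_mul]
    by_cases h : j = 0 <;> simp [h]

end GroupDatum

/-! ### Commutation relations in the double of `H_D`. -/

namespace GroupDatum

variable {k : Type u} {G : Type v} [Field k] [CommGroup G] [Finite G] (D : GroupDatum k G)

/-- The functional `g xʲ ↦ φ(g) δ_{j,i}` as an element of the double. -/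
noncomputable def dFun (φ : G → k) (i : ℕ) : D.Double :=
  DrinfeldDouble.ofFun k D.RankOne (D.degFun φ i)

theorem dFun_mul_dFun (φ ψ : G → k) (i j : ℕ) :
    D.dFun φ i * D.dFun ψ j =
      gaussBinom D.ρ (i + j) i • D.dFun (fun g => φ g * ψ (g * D.a ^ i)) (i + j) := by
  rw [dFun, dFun, DrinfeldDouble.ofFun_mul, dualConv_degFun, map_smul]
  rfl

theorem dFun_smul (c : k) (φ : G → k) (i : ℕ) : D.dFun (fun g => c * φ g) i = c • D.dFun φ i := by
  rw [dFun, dFun, ← map_smul]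
  congr 1
  refine D.dual_ext fun g j hj => ?_
  rw [LinearMap.smul_apply, degFun_apply _ _ _ _ hj, degFun_apply _ _ _ _ hj]
  simp

theorem dFun_of_le (φ : G → k) {i : ℕ} (hi : D.n ≤ i) : D.dFun φ i = 0 := by
  rw [dFun, degFun_of_le _ _ hi, map_zero]

theorem dΓ_eq (γ : G →* kˣ) : D.dΓ γ = D.dFun (fun g => (γ g : k)) 0 := rfl

theorem dΞ_eq : D.dΞ = D.dFun (fun _ => 1) 1 := rfl

theorem dFun_one_zero : D.dFun (fun _ => 1) 0 = 1 := by
  rw [dFun, ← counit_eq, DrinfeldDouble.ofFun_counit]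

theorem dΓ_mul_dFun (γ : G →* kˣ) (φ : G → k) (i : ℕ) :
    D.dΓ γ * D.dFun φ i = D.dFun (fun g => γ g * φ g) i := by
  rw [dΓ_eq, dFun_mul_dFun, zero_add, gaussBinom_zero_right, one_smul]
  simp only [pow_zero, mul_one]

theorem dFun_mul_dΓ (γ : G →* kˣ) (φ : G → k) (i : ℕ) :
    D.dFun φ i * D.dΓ γ = (γ D.a : k) ^ i • D.dFun (fun g => γ g * φ g) i := by
  rw [dΓ_eq, dFun_mul_dFun, add_zero, gaussBinom_self, one_smul, ← dFun_smul]
  congr 1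
  funext g
  rw [map_mul, map_pow, Units.val_mul, Units.val_pow_eq_pow_val]
  ring

theorem dΓ_mul (γ γ' : G →* kˣ) : D.dΓ (γ * γ') = D.dΓ γ * D.dΓ γ' := by
  rw [D.dΓ_eq γ', dΓ_mul_dFun, dΓ_eq]
  rfl

theorem dΓ_one : D.dΓ 1 = 1 := D.dFun_one_zero

theorem dG_mul (g h : G) : D.dG (g * h) = D.dG g * D.dG h := by
  rw [dG, map_mul, ← DrinfeldDouble.ofElt_mul]
  rfl

theorem dG_one : D.dG 1 = 1 := by
  rw [dG, map_one, DrinfeldDouble.ofElt_one]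

theorem dG_pow (g : G) (i : ℕ) : D.dG g ^ i = D.dG (g ^ i) := by
  rw [dG, DrinfeldDouble.ofElt_pow, ← map_pow]
  rfl

theorem dX_mul_dG (g : G) : D.dX * D.dG g = (D.χ g : k) • (D.dG g * D.dX) := by
  rw [dX, dG, DrinfeldDouble.ofElt_mul, x_mul_gp, map_smul, DrinfeldDouble.ofElt_mul]

theorem dX_pow_n : D.dX ^ D.n = D.α • (D.dG (D.a ^ D.n) - 1) := by
  rw [dX, DrinfeldDouble.ofElt_pow, x_pow_n, map_smul, map_sub, DrinfeldDouble.ofElt_one,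
    ← DrinfeldDouble.ofElt_pow, ← dG_pow]
  rfl

theorem dG_mul_ofFun (g : G) (p : Module.Dual k D.RankOne) :
    D.dG g * DrinfeldDouble.ofFun k D.RankOne (p ∘ₗ LinearMap.mulLeft k (D.gp g)) =
      DrinfeldDouble.ofFun k D.RankOne (p ∘ₗ LinearMap.mulRight k (D.gp g)) * D.dG g := by
  have := DrinfeldDouble.mk_cross (k := k) (D.gp g) p
  rwa [comul_gp, DrinfeldDouble.mk_crossLeft_tmul, DrinfeldDouble.mk_crossRight_tmul] at this

theorem dX_mul_ofFun (p : Module.Dual k D.RankOne) :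
    D.dX * DrinfeldDouble.ofFun k D.RankOne (p ∘ₗ LinearMap.mulLeft k (D.gp D.a)) +
        DrinfeldDouble.ofFun k D.RankOne (p ∘ₗ LinearMap.mulLeft k D.x) =
      DrinfeldDouble.ofFun k D.RankOne (p ∘ₗ LinearMap.mulRight k D.x) * D.dG D.a +
        DrinfeldDouble.ofFun k D.RankOne p * D.dX := by
  have := DrinfeldDouble.mk_cross (k := k) D.x p
  rwa [comul_x, map_add, map_add, map_add, map_add, DrinfeldDouble.mk_crossLeft_tmul,
    DrinfeldDouble.mk_crossRight_tmul, DrinfeldDouble.mk_crossLeft_tmul,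
    DrinfeldDouble.mk_crossRight_tmul, DrinfeldDouble.ofElt_one, one_mul, LinearMap.mulRight_one,
    LinearMap.comp_id] at this

theorem x_pow_mul_gp (j : ℕ) (g : G) :
    D.x ^ j * D.gp g = (D.χ g : k) ^ j • (D.gp g * D.x ^ j) := by
  induction j with
  | zero => simp
  | succ j ih =>
    rw [pow_succ, mul_assoc, x_mul_gp, mul_smul_comm, ← mul_assoc, ih, smul_mul_assoc, smul_smul,
      mul_assoc, ← pow_succ, ← pow_succ']

theorem degFun_comp_mulLeft_gp (φ : G → k) (i : ℕ) (g : G) :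
    D.degFun φ i ∘ₗ LinearMap.mulLeft k (D.gp g) = D.degFun (fun h => φ (g * h)) i :=
  D.dual_ext fun h j hj => by
    rw [LinearMap.comp_apply, LinearMap.mulLeft_apply, ← mul_assoc, ← map_mul,
      degFun_apply _ _ _ _ hj, degFun_apply _ _ _ _ hj]

theorem degFun_comp_mulRight_gp (φ : G → k) (i : ℕ) (g : G) :
    D.degFun φ i ∘ₗ LinearMap.mulRight k (D.gp g) =
      (D.χ g : k) ^ i • D.degFun (fun h => φ (g * h)) i :=
  D.dual_ext fun h j hj => by
    rw [LinearMap.comp_apply, LinearMap.mulRight_apply, mul_assoc, x_pow_mul_gp, mul_smul_comm,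
      ← mul_assoc, ← map_mul, map_smul, LinearMap.smul_apply, degFun_apply _ _ _ _ hj,
      degFun_apply _ _ _ _ hj, mul_comm h]
    by_cases h : j = i <;> simp [h]

theorem dG_mul_dFun (g : G) (φ : G → k) (i : ℕ) :
    D.dG g * D.dFun φ i = (D.χ g : k) ^ i • (D.dFun φ i * D.dG g) := by
  have := D.dG_mul_ofFun g (D.degFun (fun h => φ (g⁻¹ * h)) i)
  rw [degFun_comp_mulLeft_gp, degFun_comp_mulRight_gp, map_smul, smul_mul_assoc] at this
  simp only [inv_mul_cancel_left] at this
  exact this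

theorem degFun_gp_mul_x_pow_succ (φ : G → k) (i : ℕ) (g : G) {j : ℕ} (hj : j < D.n) :
    D.degFun φ i (D.gp g * D.x ^ (j + 1)) =
      if j + 1 = D.n then (if i = 0 then D.α * (φ (g * D.a ^ D.n) - φ g) else 0)
      else (if j + 1 = i then φ g else 0) := by
  by_cases h : j + 1 = D.n
  · have h1 := D.degFun_apply φ i (g * D.a ^ D.n) D.n_pos
    have h2 := D.degFun_apply φ i g D.n_pos
    rw [pow_zero, mul_one] at h1 h2
    rw [if_pos h, h, x_pow_n, mul_smul_comm, map_smul, mul_sub, mul_one, ← map_pow, ← map_mul,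
      map_sub, h1, h2]
    by_cases hi : i = 0
    · simp [hi]
    · simp [hi, Ne.symm hi]
  · rw [if_neg h, degFun_apply _ _ _ _ (by omega)]

/-- The cross relation for `x` and `ξ`, with `ξ(x ?) = χ`, `ξ(? x) = ε` and `ξ(a ?) = ξ`. -/
theorem dX_mul_dΞ (hn : 2 ≤ D.n) :
    D.dX * D.dΞ = D.dΞ * D.dX + D.dG D.a - D.dΓ D.χ := by
  have h1 : D.degFun (fun _ => 1) 1 ∘ₗ LinearMap.mulLeft k D.x =
      D.degFun (fun g => (D.χ g : k)) 0 := D.dual_ext fun g j hj => by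
    rw [LinearMap.comp_apply, LinearMap.mulLeft_apply, ← mul_assoc, x_mul_gp, smul_mul_assoc,
      mul_assoc, ← pow_succ', map_smul, degFun_gp_mul_x_pow_succ _ _ _ _ hj,
      degFun_apply _ _ _ _ hj]
    by_cases h : j + 1 = D.n
    · simp [h, show j ≠ 0 by omega]
    · by_cases hj0 : j = 0 <;> simp [h, hj0]
      omega
  have h2 : D.degFun (fun _ => 1) 1 ∘ₗ LinearMap.mulRight k D.x =
      D.degFun (fun _ => 1) 0 := D.dual_ext fun g j hj => by
    rw [LinearMap.comp_apply, LinearMap.mulRight_apply,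
      mul_assoc, ← pow_succ, degFun_gp_mul_x_pow_succ _ _ _ _ hj,
      degFun_apply _ _ _ _ hj]
    by_cases h : j + 1 = D.n
    · simp [h, show j ≠ 0 by omega]
    · by_cases hj0 : j = 0 <;> simp [h, hj0]
      omega
  have h3 := D.dX_mul_ofFun (D.degFun (fun _ => 1) 1)
  rw [h1, h2, degFun_comp_mulLeft_gp] at h3
  change D.dX * D.dΞ + D.dΓ D.χ = D.dFun (fun _ => 1) 0 * D.dG D.a + D.dΞ * D.dX at h3
  rw [dFun_one_zero, one_mul] at h3
  rw [eq_sub_iff_add_eq, h3, add_comm]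

/-- The element `χ θ - θ a`, where `θ(g xʲ) = δ_{j,n-1}`. -/
noncomputable def correction : D.Double :=
  D.dΓ D.χ * D.dFun (fun _ => 1) (D.n - 1) - D.dFun (fun _ => 1) (D.n - 1) * D.dG D.a

/-- The cross relation for `x` and `γ`. The functionals `γ(x ?)` and `γ(? x)` live only in degree `n
- 1`, where `xⁿ = α (aⁿ - 1)` is used; together they form the correction term. -/
theorem dΓ_mul_dX (γ : G →* kˣ) :
    D.dΓ γ * D.dX = (γ D.a : k) • (D.dX * D.dΓ γ) +
      (D.α * ((γ D.a : k) ^ D.n - 1)) • (D.dΓ γ * D.correction) := by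
  have hn := D.n_pos
  have h1 : D.degFun (fun g => (γ g : k)) 0 ∘ₗ LinearMap.mulLeft k D.x =
      (D.α * ((γ D.a : k) ^ D.n - 1)) •
        D.degFun (fun g => (γ g : k) * ((D.χ g : k) * 1)) (D.n - 1) :=
    D.dual_ext fun g j hj => by
      rw [LinearMap.comp_apply, LinearMap.mulLeft_apply, ← mul_assoc, x_mul_gp, smul_mul_assoc,
        mul_assoc, ← pow_succ', map_smul, degFun_gp_mul_x_pow_succ _ _ _ _ hj,
        LinearMap.smul_apply, degFun_apply _ _ _ _ hj]
      by_cases h : j + 1 = D.n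
      · rw [if_pos h, if_pos rfl, if_pos (by omega)]
        simp only [map_mul, map_pow, Units.val_mul, Units.val_pow_eq_pow_val, smul_eq_mul]
        ring
      · rw [if_neg h, if_neg (by omega), if_neg (by omega)]
        simp
  have h2 : D.degFun (fun g => (γ g : k)) 0 ∘ₗ LinearMap.mulRight k D.x =
      (D.α * ((γ D.a : k) ^ D.n - 1)) • D.degFun (fun g => (γ g : k) * 1) (D.n - 1) :=
    D.dual_ext fun g j hj => by
      rw [LinearMap.comp_apply, LinearMap.mulRight_apply, mul_assoc, ← pow_succ,
        degFun_gp_mul_x_pow_succ _ _ _ _ hj,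
        LinearMap.smul_apply, degFun_apply _ _ _ _ hj]
      by_cases h : j + 1 = D.n
      · rw [if_pos h, if_pos rfl, if_pos (by omega)]
        simp only [map_mul, map_pow, Units.val_mul, Units.val_pow_eq_pow_val, smul_eq_mul]
        ring
      · rw [if_neg h, if_neg (by omega), if_neg (by omega)]
        simp
  have h0 : D.degFun (fun g => (γ g : k)) 0 ∘ₗ LinearMap.mulLeft k (D.gp D.a) =
      (γ D.a : k) • D.degFun (fun g => (γ g : k)) 0 := by
    rw [degFun_comp_mulLeft_gp]
    refine D.dual_ext fun g j hj => ?_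
    rw [LinearMap.smul_apply, degFun_apply _ _ _ _ hj, degFun_apply _ _ _ _ hj]
    by_cases h : j = 0 <;> simp [h]
  have h3 := D.dX_mul_ofFun (D.degFun (fun g => (γ g : k)) 0)
  rw [h0, h1, h2, map_smul, map_smul, map_smul, mul_smul_comm, smul_mul_assoc] at h3
  change (γ D.a : k) • (D.dX * D.dΓ γ) + _ • D.dFun _ _ = _ • (D.dFun _ _ * _) + D.dΓ γ * D.dX at h3
  rw [← dΓ_mul_dFun, ← dΓ_mul_dFun, ← dΓ_mul_dFun] at h3
  rw [correction, mul_sub (D.dΓ γ), smul_sub, ← add_sub_assoc, h3, ← mul_assoc (D.dΓ γ) _ (D.dG D.a),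
    add_sub_cancel_left]

end GroupDatum

/-! ### Replacing `x` by a nilpotent weight vector. -/

namespace GroupDatum

variable {k : Type u} {G : Type v} [Field k] [CommGroup G] [Finite G] (D : GroupDatum k G)

theorem gaussBinom_one_ne_zero {r : ℕ} (hr : r + 1 < D.n) : gaussBinom D.ρ (1 + r) 1 ≠ 0 := by
  have h := gaussBinom_absorb D.ρ r 0
  rw [zero_add, Finset.sum_range_one, pow_zero, one_mul, gaussBinom_zero_right, mul_one] at h
  rw [add_comm, h]
  intro h0
  have h1 := geom_sum_mul D.ρ (r + 1)
  rw [h0, zero_mul, eq_comm, sub_eq_zero] at h1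
  have := orderOf_le_of_pow_eq_one (by omega) h1
  rw [D.orderOf_ρ] at this
  omega

theorem dΞ_pow (i : ℕ) :
    D.dΞ ^ i = (∏ r ∈ Finset.range i, gaussBinom D.ρ (1 + r) 1) • D.dFun (fun _ => 1) i := by
  induction i with
  | zero => rw [pow_zero, Finset.prod_range_zero, one_smul, dFun_one_zero]
  | succ i ih =>
    rw [pow_succ', ih, mul_smul_comm, dΞ_eq, dFun_mul_dFun, smul_smul, Finset.prod_range_succ,
      add_comm 1 i]
    simp only [mul_one]

theorem dΞ_pow_n : D.dΞ ^ D.n = 0 := by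
  rw [dΞ_pow, dFun_of_le _ _ le_rfl, smul_zero]

/-- `ξⁱ` is this functional times a product of `q`-integers, none of which vanishes below `n`. -/
theorem dFun_one_eq {i : ℕ} (hi : i < D.n) : ∃ c : k, D.dFun (fun _ => 1) i = c • D.dΞ ^ i := by
  refine ⟨(∏ r ∈ Finset.range i, gaussBinom D.ρ (1 + r) 1)⁻¹, ?_⟩
  rw [dΞ_pow, smul_smul, inv_mul_cancel₀, one_smul]
  refine Finset.prod_ne_zero_iff.mpr fun r hr => D.gaussBinom_one_ne_zero ?_
  have := Finset.mem_range.mp hr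
  omega

theorem dG_mul_dΓ (g : G) (γ : G →* kˣ) : D.dG g * D.dΓ γ = D.dΓ γ * D.dG g := by
  rw [dΓ_eq, dG_mul_dFun, pow_zero, one_smul]

theorem dG_mul_dΞ (g : G) : D.dG g * D.dΞ = (D.χ g : k) • (D.dΞ * D.dG g) := by
  rw [dΞ_eq, dG_mul_dFun, pow_one]

theorem dFun_one_mul_dΓ (γ : G →* kˣ) (i : ℕ) :
    D.dFun (fun _ => 1) i * D.dΓ γ = (γ D.a : k) ^ i • (D.dΓ γ * D.dFun (fun _ => 1) i) := by
  rw [dFun_mul_dΓ, dΓ_mul_dFun]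

theorem dΞ_mul_dΓ (γ : G →* kˣ) : D.dΞ * D.dΓ γ = (γ D.a : k) • (D.dΓ γ * D.dΞ) := by
  rw [dΞ_eq, dFun_one_mul_dΓ, pow_one]

theorem dG_mul_correction (g : G) :
    D.dG g * D.correction = (D.χ g : k) ^ (D.n - 1) • (D.correction * D.dG g) := by
  rw [correction, mul_sub, sub_mul, smul_sub, ← mul_assoc, dG_mul_dΓ, mul_assoc, dG_mul_dFun,
    ← mul_assoc (D.dG g), dG_mul_dFun, mul_smul_comm, smul_mul_assoc, mul_assoc, mul_assoc,
    mul_assoc, ← dG_mul, ← dG_mul, mul_comm g]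

theorem correction_mul_dΓ (γ : G →* kˣ) :
    D.correction * D.dΓ γ = (γ D.a : k) ^ (D.n - 1) • (D.dΓ γ * D.correction) := by
  rw [correction, sub_mul, mul_sub, smul_sub, mul_assoc, dFun_one_mul_dΓ, mul_assoc, dG_mul_dΓ,
    ← mul_assoc _ (D.dΓ γ), dFun_one_mul_dΓ, mul_smul_comm, smul_mul_assoc, ← mul_assoc,
    ← mul_assoc, ← mul_assoc, ← dΓ_mul, ← dΓ_mul, mul_comm γ]

theorem exists_correction_eq_mul : ∃ t, D.correction = t * D.dΞ ^ (D.n - 1) := by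
  have hn := D.n_pos
  obtain ⟨c, hc⟩ := D.dFun_one_eq (show D.n - 1 < D.n by omega)
  have h := D.dG_mul_dFun D.a (fun _ => 1) (D.n - 1)
  have h' : D.dFun (fun _ => 1) (D.n - 1) * D.dG D.a =
      ((D.χ D.a : k) ^ (D.n - 1))⁻¹ • (D.dG D.a * D.dFun (fun _ => 1) (D.n - 1)) := by
    rw [h, smul_smul, inv_mul_cancel₀ (pow_ne_zero _ (Units.ne_zero _)), one_smul]
  refine ⟨c • (D.dΓ D.χ - ((D.χ D.a : k) ^ (D.n - 1))⁻¹ • D.dG D.a), ?_⟩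
  rw [correction, h', smul_mul_assoc c, ← mul_smul_comm c, ← hc, sub_mul, smul_mul_assoc]

theorem exists_correction_eq_mul' : ∃ t, D.correction = D.dΞ ^ (D.n - 1) * t := by
  have hn := D.n_pos
  obtain ⟨c, hc⟩ := D.dFun_one_eq (show D.n - 1 < D.n by omega)
  have h := D.dFun_one_mul_dΓ D.χ (D.n - 1)
  have h' : D.dΓ D.χ * D.dFun (fun _ => 1) (D.n - 1) =
      ((D.χ D.a : k) ^ (D.n - 1))⁻¹ • (D.dFun (fun _ => 1) (D.n - 1) * D.dΓ D.χ) := by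
    rw [h, smul_smul, inv_mul_cancel₀ (pow_ne_zero _ (Units.ne_zero _)), one_smul]
  refine ⟨c • (((D.χ D.a : k) ^ (D.n - 1))⁻¹ • D.dΓ D.χ - D.dG D.a), ?_⟩
  rw [correction, h', mul_smul_comm c, ← smul_mul_assoc c, ← hc, mul_sub, mul_smul_comm]

theorem dΞ_mul_correction (hn : 2 ≤ D.n) : D.dΞ * D.correction = 0 := by
  obtain ⟨t, ht⟩ := D.exists_correction_eq_mul'
  rw [ht, ← mul_assoc, ← pow_succ', show D.n - 1 + 1 = D.n by omega, dΞ_pow_n, zero_mul]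

theorem correction_mul_dΞ (hn : 2 ≤ D.n) : D.correction * D.dΞ = 0 := by
  obtain ⟨t, ht⟩ := D.exists_correction_eq_mul
  rw [ht, mul_assoc, ← pow_succ, show D.n - 1 + 1 = D.n by omega, dΞ_pow_n, mul_zero]

open Classical in
/-- The multiple of the correction term that turns `x` into a weight vector. -/
noncomputable def correctionCoeff : k :=
  if D.α • (MonoidAlgebra.of k G (D.a ^ D.n) - 1) = 0 then 0 else D.α

/-- If the coefficient is not set to zero, then `α (aⁿ - 1) ≠ 0` and the compatibility condition
forces `χⁿ = 1`. This makes the correction compatible with the action of `G` on `x`. -/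
theorem correctionCoeff_mul_pow (g : G) :
    D.correctionCoeff * (D.χ g : k) ^ D.n = D.correctionCoeff := by
  rw [correctionCoeff]
  split_ifs with h
  · rw [zero_mul]
  · have h1 := D.compat.resolve_right h
    have h2 := DFunLike.congr_fun h1 g
    have h3 : (D.χ g : k) ^ D.n = 1 := by
      rw [← Units.val_pow_eq_pow_val]
      exact congrArg Units.val h2
    rw [h3, mul_one]

theorem eq_zero_or_pow_eq_one (h : D.α • (MonoidAlgebra.of k G (D.a ^ D.n) - 1) = 0) :
    D.α = 0 ∨ D.a ^ D.n = 1 := by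
  rcases smul_eq_zero.mp h with h | h
  · exact Or.inl h
  · refine Or.inr (MonoidAlgebra.of_injective (R := k) ?_)
    rw [map_one]
    exact sub_eq_zero.mp h

theorem correctionCoeff_mul_sub (γ : G →* kˣ) :
    D.α * ((γ D.a : k) ^ D.n - 1) = D.correctionCoeff * ((γ D.a : k) ^ D.n - 1) := by
  rw [correctionCoeff]
  split_ifs with h
  · rcases D.eq_zero_or_pow_eq_one h with h | h
    · rw [h]
    · rw [← Units.val_pow_eq_pow_val, ← map_pow, h]
      simp
  · rfl

/-- The modification of `x` that is a weight vector for `G × Γ`. -/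
noncomputable def dY : D.Double := D.dX + D.correctionCoeff • D.correction

theorem dG_mul_dY (g : G) : D.dG g * D.dY = ((D.χ g)⁻¹ : k) • (D.dY * D.dG g) := by
  have hn := D.n_pos
  have h0 : (D.χ g : k) ≠ 0 := Units.ne_zero _
  have h1 : D.dG g * D.dX = ((D.χ g)⁻¹ : k) • (D.dX * D.dG g) := by
    rw [dX_mul_dG, smul_smul, inv_mul_cancel₀ h0, one_smul]
  have h2 : D.correctionCoeff * (D.χ g : k) ^ (D.n - 1) = ((D.χ g)⁻¹ : k) * D.correctionCoeff := by
    rw [eq_inv_mul_iff_mul_eq₀ h0]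
    rw [mul_left_comm, ← pow_succ', show D.n - 1 + 1 = D.n by omega, D.correctionCoeff_mul_pow]
  rw [dY, mul_add, add_mul, smul_add, h1, mul_smul_comm, dG_mul_correction, smul_smul, h2,
    smul_mul_assoc, smul_smul]

/-- The correction term scales by `γ(a)ⁿ⁻¹` when moved past `γ`, and the resulting discrepancy
cancels the inhomogeneous term of `dΓ_mul_dX`. -/
theorem dΓ_mul_dY (γ : G →* kˣ) : D.dΓ γ * D.dY = (γ D.a : k) • (D.dY * D.dΓ γ) := by
  have hn := D.n_pos
  have h1 : (γ D.a : k) * (γ D.a : k) ^ (D.n - 1) = (γ D.a : k) ^ D.n := by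
    rw [← pow_succ', show D.n - 1 + 1 = D.n by omega]
  rw [dY, mul_add, add_mul, smul_add, dΓ_mul_dX, smul_mul_assoc, correction_mul_dΓ,
    correctionCoeff_mul_sub, mul_smul_comm, add_assoc, ← add_smul, smul_smul, smul_smul]
  congr 2
  linear_combination (-D.correctionCoeff) * h1

theorem dY_mul_dΞ (hn : 2 ≤ D.n) : D.dY * D.dΞ = D.dΞ * D.dY + D.dG D.a - D.dΓ D.χ := by
  rw [dY, add_mul, mul_add, smul_mul_assoc, mul_smul_comm, D.correction_mul_dΞ hn,
    D.dΞ_mul_correction hn, smul_zero, add_zero, add_zero, D.dX_mul_dΞ hn]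

theorem exists_dY_mul_dΞ_pow (hn : 2 ≤ D.n) (r : ℕ) :
    ∃ e, D.dY * D.dΞ ^ (r + 1) = D.dΞ ^ (r + 1) * D.dY + D.dΞ ^ r * e := by
  have hΓ : ∀ r : ℕ, D.dΓ D.χ * D.dΞ ^ r = (((D.χ D.a : k)⁻¹) ^ r) • (D.dΞ ^ r * D.dΓ D.χ) := by
    intro r
    have h1 : D.dΓ D.χ * D.dΞ = (D.χ D.a : k)⁻¹ • (D.dΞ * D.dΓ D.χ) := by
      rw [dΞ_mul_dΓ, smul_smul, inv_mul_cancel₀ (Units.ne_zero _), one_smul]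
    induction r with
    | zero => simp
    | succ r ih =>
      rw [pow_succ, ← mul_assoc, ih, smul_mul_assoc, mul_assoc, h1, mul_smul_comm, smul_smul,
        ← mul_assoc, ← pow_succ]
  have hG : ∀ r : ℕ, D.dG D.a * D.dΞ ^ r = ((D.χ D.a : k) ^ r) • (D.dΞ ^ r * D.dG D.a) := by
    intro r
    induction r with
    | zero => simp
    | succ r ih =>
      rw [pow_succ, ← mul_assoc, ih, smul_mul_assoc, mul_assoc, dG_mul_dΞ, mul_smul_comm,
        smul_smul, ← mul_assoc, ← pow_succ]
  induction r with
  | zero =>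
    refine ⟨D.dG D.a - D.dΓ D.χ, ?_⟩
    rw [zero_add, pow_one, D.dY_mul_dΞ hn, pow_zero, one_mul, add_sub_assoc]
  | succ r ih =>
    obtain ⟨e, he⟩ := ih
    refine ⟨e + (((D.χ D.a : k) ^ (r + 1)) • D.dG D.a -
      (((D.χ D.a : k)⁻¹) ^ (r + 1)) • D.dΓ D.χ), ?_⟩
    rw [pow_succ' _ (r + 1), ← mul_assoc, D.dY_mul_dΞ hn, sub_mul, add_mul, mul_assoc, he, hΓ, hG,
      mul_add, mul_add, mul_sub, mul_smul_comm, mul_smul_comm, ← mul_assoc D.dΞ, ← mul_assoc D.dΞ,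
      ← pow_succ' D.dΞ (r + 1), ← pow_succ' D.dΞ r]
    abel

/-- Moving a `y` to the right past the powers of `ξ` costs at most one factor `ξ`, so at least `n`
factors remain to the left of the first `y`. -/
theorem dΞ_pow_mul_dY_pow_mul_dΞ_pow (hn : 2 ≤ D.n) (i : ℕ) {s r : ℕ} (h : D.n + i ≤ s + r) :
    D.dΞ ^ s * D.dY ^ i * D.dΞ ^ r = 0 := by
  have hz : ∀ j, D.n ≤ j → D.dΞ ^ j = 0 := fun j hj => by
    obtain ⟨l, rfl⟩ := Nat.exists_eq_add_of_le hj
    rw [pow_add, dΞ_pow_n, zero_mul]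
  induction i generalizing s r with
  | zero => rw [pow_zero, mul_one, ← pow_add, hz _ (by omega)]
  | succ i ih =>
    cases r with
    | zero => rw [hz s (by omega), zero_mul, zero_mul]
    | succ r =>
      obtain ⟨e, he⟩ := D.exists_dY_mul_dΞ_pow hn r
      rw [pow_succ, ← mul_assoc, mul_assoc, he, mul_add, ← mul_assoc, ih (by omega), zero_mul,
        ← mul_assoc, ih (by omega), zero_mul, add_zero]

theorem correction_mul_dY_pow_mul_correction (hn : 2 ≤ D.n) {i : ℕ} (hi : i + 2 ≤ D.n) :
    D.correction * (D.dY ^ i * D.correction) = 0 := by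
  obtain ⟨t, ht⟩ := D.exists_correction_eq_mul
  obtain ⟨t', ht'⟩ := D.exists_correction_eq_mul'
  have h := D.dΞ_pow_mul_dY_pow_mul_dΞ_pow hn i (s := D.n - 1) (r := D.n - 1) (by omega)
  nth_rw 1 [ht]
  rw [ht', ← mul_assoc, ← mul_assoc, mul_assoc t, mul_assoc t, h, mul_zero, zero_mul]

theorem dΓ_mul_dY_pow (γ : G →* kˣ) (m : ℕ) :
    D.dΓ γ * D.dY ^ m = (γ D.a : k) ^ m • (D.dY ^ m * D.dΓ γ) := by
  induction m with
  | zero => simp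
  | succ m ih =>
    rw [pow_succ, ← mul_assoc, ih, smul_mul_assoc, mul_assoc, dΓ_mul_dY, mul_smul_comm, smul_smul,
      ← mul_assoc, ← pow_succ]

/-- Expand `x = y - c w`, with `w` the correction. Products with two factors `w` vanish in this
range, so `v` collects terms with a single `w`. In such a term `w` replaces one `y`, which changes
the scaling under `γ` by `γ(a)ⁿ`. The last clause keeps the vanishing available for the next step of
the induction. -/
theorem exists_dX_pow_eq (hn : 2 ≤ D.n) {m : ℕ} (hm : m ≤ D.n) :
    ∃ v, D.dX ^ m = D.dY ^ m + v ∧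
      (∀ γ : G →* kˣ, (γ D.a : k) ^ D.n • (D.dΓ γ * v) = (γ D.a : k) ^ m • (v * D.dΓ γ)) ∧
      ∀ i, m + i + 1 ≤ D.n → v * (D.dY ^ i * D.correction) = 0 := by
  induction m with
  | zero => exact ⟨0, by simp, by simp, by simp⟩
  | succ m ih =>
    obtain ⟨v, h1, h2, h3⟩ := ih (by omega)
    have hX : D.dX = D.dY - D.correctionCoeff • D.correction := by rw [dY, add_sub_cancel_right]
    have hv : v * D.correction = 0 := by
      have := h3 0 (by omega)
      rwa [pow_zero, one_mul] at this
    refine ⟨v * D.dY - D.correctionCoeff • (D.dY ^ m * D.correction), ?_, fun γ => ?_,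
      fun i hi => ?_⟩
    · rw [pow_succ, h1, hX, mul_sub, add_mul, mul_smul_comm, add_mul, hv, add_zero, ← pow_succ]
      abel
    · have h4 : (γ D.a : k) ^ D.n • (D.dΓ γ * D.correction) =
          (γ D.a : k) • (D.correction * D.dΓ γ) := by
        rw [correction_mul_dΓ, smul_smul, ← pow_succ', show D.n - 1 + 1 = D.n by omega]
      have h5 : (γ D.a : k) ^ D.n • (D.dΓ γ * (v * D.dY)) =
          (γ D.a : k) ^ (m + 1) • (v * D.dY * D.dΓ γ) := by
        rw [← mul_assoc, ← smul_mul_assoc, h2, smul_mul_assoc, mul_assoc, dΓ_mul_dY,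
          mul_smul_comm, smul_smul, ← pow_succ, mul_assoc]
      have h6 : (γ D.a : k) ^ D.n • (D.dΓ γ * (D.dY ^ m * D.correction)) =
          (γ D.a : k) ^ (m + 1) • (D.dY ^ m * D.correction * D.dΓ γ) := by
        rw [← mul_assoc, dΓ_mul_dY_pow, smul_mul_assoc, smul_comm, mul_assoc, ← mul_smul_comm, h4,
          mul_smul_comm, smul_smul, ← pow_succ, mul_assoc]
      rw [mul_sub, sub_mul, smul_sub, smul_sub, h5, mul_smul_comm, smul_mul_assoc, smul_comm, h6,
        smul_comm D.correctionCoeff]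
    · rw [sub_mul, mul_assoc, ← mul_assoc D.dY, ← pow_succ', h3 _ (by omega), smul_mul_assoc,
        mul_assoc, D.correction_mul_dY_pow_mul_correction hn (by omega), mul_zero, smul_zero,
        sub_zero]

variable [CharZero k] [IsAlgClosed k]

/-- If `α (aⁿ - 1) = 0`, then `y = x` and `xⁿ = 0`. Otherwise some character has `γ(a)ⁿ ≠ 1`. Both
`xⁿ = α (aⁿ - 1)` and the remainder `xⁿ - yⁿ` commute with `γ`, whereas `yⁿ` is scaled by `γ(a)ⁿ`;
so `yⁿ = 0`. -/
theorem dY_pow_n (hn : 2 ≤ D.n) : D.dY ^ D.n = 0 := by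
  by_cases h : D.α • (MonoidAlgebra.of k G (D.a ^ D.n) - 1) = 0
  · have h1 : D.dY = D.dX := by rw [dY, correctionCoeff, if_pos h, zero_smul, add_zero]
    rw [h1, dX_pow_n]
    rcases D.eq_zero_or_pow_eq_one h with h | h
    · rw [h, zero_smul]
    · rw [h, dG_one, sub_self, smul_zero]
  · have ha : D.a ^ D.n ≠ 1 := fun h0 => h (by rw [h0, map_one, sub_self, smul_zero])
    obtain ⟨γ, hγ⟩ := exists_character_ne_one k ha
    obtain ⟨v, h1, h2, -⟩ := D.exists_dX_pow_eq hn le_rfl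
    have h0 : (γ D.a : k) ^ D.n ≠ 0 := pow_ne_zero _ (Units.ne_zero _)
    have h3 : D.dΓ γ * v = v * D.dΓ γ := by
      have := congrArg (fun z => ((γ D.a : k) ^ D.n)⁻¹ • z) (h2 γ)
      simpa only [smul_smul, inv_mul_cancel₀ h0, one_smul] using this
    have h4 : D.dΓ γ * D.dX ^ D.n = D.dX ^ D.n * D.dΓ γ := by
      rw [dX_pow_n, mul_smul_comm, smul_mul_assoc, mul_sub, sub_mul, dG_mul_dΓ, mul_one, one_mul]
    rw [h1, mul_add, add_mul, h3, add_left_inj, dΓ_mul_dY_pow] at h4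
    have h5 : ((γ D.a : k) ^ D.n - 1) • (D.dY ^ D.n * D.dΓ γ) = 0 := by
      rw [sub_smul, h4, one_smul, sub_self]
    have h6 : (γ D.a : k) ^ D.n - 1 ≠ 0 := by
      rw [sub_ne_zero, ← Units.val_pow_eq_pow_val, ← map_pow]
      exact fun h => hγ (Units.val_eq_one.mp h)
    have h7 := (smul_eq_zero.mp h5).resolve_left h6
    have h8 : D.dΓ γ * D.dΓ γ⁻¹ = 1 := by 
      rw [← dΓ_mul, show γ * γ⁻¹ = 1 by ext; simp, dΓ_one]
    rw [← mul_one (D.dY ^ D.n), ← h8, ← mul_assoc, h7, zero_mul]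

end GroupDatum

/-! ### The double as an algebra of `sl₂` type. -/

namespace GroupDatum

variable {k : Type u} {G : Type v} [Field k] [CommGroup G] [Finite G] (D : GroupDatum k G)

/-- The elements `g γ` of the double. -/
noncomputable def dT : G × (G →* kˣ) →* D.Double where
  toFun t := D.dG t.1 * D.dΓ t.2
  map_one' := by
    change D.dG 1 * D.dΓ 1 = 1
    rw [dG_one, dΓ_one, one_mul]
  map_mul' s t := by
    change D.dG (s.1 * t.1) * D.dΓ (s.2 * t.2) = _
    rw [dG_mul, dΓ_mul, mul_assoc, mul_assoc, ← mul_assoc (D.dG t.1), dG_mul_dΓ, mul_assoc]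

theorem dT_apply (t : G × (G →* kˣ)) : D.dT t = D.dG t.1 * D.dΓ t.2 := rfl

theorem dT_inl (g : G) : D.dT (g, 1) = D.dG g := by
  rw [dT_apply]
  change D.dG g * D.dΓ 1 = _
  rw [dΓ_one, mul_one]

theorem dT_inr (γ : G →* kˣ) : D.dT (1, γ) = D.dΓ γ := by
  rw [dT_apply]
  change D.dG 1 * D.dΓ γ = _
  rw [dG_one, one_mul]

/-- The root `(g, γ) ↦ χ(g)⁻¹ γ(a)`. -/
noncomputable def root : G × (G →* kˣ) →* kˣ where
  toFun t := (D.χ t.1)⁻¹ * t.2 D.a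
  map_one' := by simp
  map_mul' s t := by
    simp only [Prod.fst_mul, Prod.snd_mul, map_mul, MonoidHom.mul_apply]
    rw [mul_inv, mul_mul_mul_comm]

theorem root_apply (t : G × (G →* kˣ)) : D.root t = (D.χ t.1)⁻¹ * t.2 D.a := rfl

theorem root_χ : D.root (1, D.χ) = D.χ D.a := by
  rw [root_apply]
  simp

theorem root_a : D.root (D.a, 1) = (D.χ D.a)⁻¹ := by
  rw [root_apply]
  simp

/-- `φ ↦ φ ξ_i` as a linear map, where `ξ_i(g xʲ) = δ_{j,i}`. -/
noncomputable def dFunLinear (i : ℕ) : (G → k) →ₗ[k] D.Double where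
  toFun φ := D.dFun φ i
  map_add' φ ψ := by
    rw [dFun, dFun, dFun, ← map_add]
    congr 1
    refine D.dual_ext fun g j hj => ?_
    rw [LinearMap.add_apply, degFun_apply _ _ _ _ hj, degFun_apply _ _ _ _ hj,
      degFun_apply _ _ _ _ hj]
    by_cases h : j = i <;> simp [h]
  map_smul' c φ := D.dFun_smul c φ i

theorem dual_eq_sum (p : Module.Dual k D.RankOne) :
    p = ∑ i ∈ Finset.range D.n, D.degFun (fun g => p (D.gp g * D.x ^ i)) i := by
  refine D.dual_ext fun g j hj => ?_
  rw [LinearMap.sum_apply, Finset.sum_congr rfl fun i _ => D.degFun_apply _ i g hj,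
    Finset.sum_ite_eq, if_pos (Finset.mem_range.mpr hj)]

variable [CharZero k] [IsAlgClosed k]

/-- Fourier inversion on `G`. -/
theorem span_characters : Submodule.span k (Set.range fun γ : G →* kˣ => fun g => (γ g : k)) = ⊤ := by
  classical
  have := Fintype.ofFinite G
  have : Finite (G →* kˣ) := by
    apply Nat.finite_of_card_ne_zero
    rw [card_characters k G]
    exact Nat.card_pos.ne'
  have := Fintype.ofFinite (G →* kˣ)
  rw [eq_top_iff]
  intro φ _
  have h : φ = ∑ h : G, ∑ γ : G →* kˣ, ((Fintype.card G : k)⁻¹ * φ h * (γ h⁻¹ : k)) •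
      (fun g => (γ g : k)) := by
    funext g
    simp only [Finset.sum_apply, Pi.smul_apply, smul_eq_mul]
    have h1 : ∀ h ∈ Finset.univ, ∑ γ : G →* kˣ,
        (Fintype.card G : k)⁻¹ * φ h * (γ h⁻¹ : k) * (γ g : k) = if g = h then φ h else 0 := by
      intro h _
      have h2 : ∀ γ ∈ Finset.univ, (Fintype.card G : k)⁻¹ * φ h * ((γ : G →* kˣ) h⁻¹ : k) *
          (γ g : k) = (Fintype.card G : k)⁻¹ * φ h * (γ (h⁻¹ * g) : k) := fun γ _ => by
        rw [map_mul γ, Units.val_mul, mul_assoc]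
      rw [Finset.sum_congr rfl h2, ← Finset.mul_sum, sum_character_apply]
      by_cases hgh : g = h
      · subst hgh
        have : (Fintype.card G : k) ≠ 0 := Nat.cast_ne_zero.mpr Fintype.card_ne_zero
        rw [if_pos (by simp), if_pos rfl]
        field_simp
      · rw [if_neg (by rw [inv_mul_eq_one]; exact Ne.symm hgh), if_neg hgh, mul_zero]
    rw [Finset.sum_congr rfl h1, Finset.sum_ite_eq, if_pos (Finset.mem_univ g)]
  rw [h]
  exact Submodule.sum_mem _ fun _ _ => Submodule.sum_mem _ fun γ _ =>
    Submodule.smul_mem _ _ (Submodule.subset_span ⟨γ, rfl⟩)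

/-- Each homogeneous part of a functional is a combination of products of a character with the
functional dual to `xⁱ`, and the latter is a multiple of `ξⁱ`. For `n = 1` only degree zero occurs,
so `ξ` is not needed. -/
theorem ofFun_mem (W : Subalgebra k D.Double) (hΓ : ∀ γ, D.dΓ γ ∈ W) (hΞ : 2 ≤ D.n → D.dΞ ∈ W)
    (p : Module.Dual k D.RankOne) : DrinfeldDouble.ofFun k D.RankOne p ∈ W := by
  rw [D.dual_eq_sum p, map_sum]
  refine Subalgebra.sum_mem _ fun i hi => ?_
  have hi' := Finset.mem_range.mp hi
  have h1 : Submodule.span k (Set.range fun γ : G →* kˣ => fun g => (γ g : k)) ≤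
      W.toSubmodule.comap (D.dFunLinear i) := by
    rw [Submodule.span_le]
    rintro _ ⟨γ, rfl⟩
    change D.dFun (fun g => (γ g : k)) i ∈ W
    have h2 := D.dΓ_mul_dFun γ (fun _ => 1) i
    simp only [mul_one] at h2
    rw [← h2]
    refine W.mul_mem (hΓ γ) ?_
    obtain ⟨c, hc⟩ := D.dFun_one_eq hi'
    rw [hc]
    refine W.smul_mem ?_ c
    cases i with
    | zero => rw [pow_zero]; exact W.one_mem
    | succ i => exact W.pow_mem (hΞ (by omega)) _
  refine h1 (show (fun g => p (D.gp g * D.x ^ i)) ∈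
    Submodule.span k (Set.range fun γ : G →* kˣ => fun g => (γ g : k)) from ?_)
  rw [span_characters]
  trivial

theorem eq_top_of_mem (W : Subalgebra k D.Double) (hG : ∀ g, D.dG g ∈ W) (hΓ : ∀ γ, D.dΓ γ ∈ W)
    (hΞ : 2 ≤ D.n → D.dΞ ∈ W) (hX : D.dX ∈ W) : W = ⊤ := by
  rw [eq_top_iff, ← DrinfeldDouble.adjoin_range_eq_top, Algebra.adjoin_le_iff]
  rintro _ (⟨p, rfl⟩ | ⟨h, rfl⟩)
  · exact D.ofFun_mem W hΓ hΞ p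
  · have hh : h ∈ Algebra.adjoin k (Set.range D.gp ∪ {D.x}) := by
      rw [D.adjoin_eq_top]
      trivial
    induction hh using Algebra.adjoin_induction with
    | mem y hy =>
      rcases hy with ⟨g, rfl⟩ | rfl
      · exact hG g
      · exact hX
    | algebraMap r =>
      rw [Algebra.algebraMap_eq_smul_one, map_smul, DrinfeldDouble.ofElt_one]
      exact W.smul_mem W.one_mem r
    | add y z _ _ hy hz =>
      rw [map_add]
      exact W.add_mem hy hz
    | mul y z _ _ hy hz =>
      rw [← DrinfeldDouble.ofElt_mul]
      exact W.mul_mem hy hz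

/-- The presentation of the double by `G × Γ`, `y` and `ξ`. -/
noncomputable def skewSl2 (hn : 2 ≤ D.n) : SkewSl2 k (G × (G →* kˣ)) D.Double where
  τ := D.dT
  y := D.dY
  ξ := D.dΞ
  σ := D.root
  a := (D.a, 1)
  b := (1, D.χ)
  n := D.n
  two_le := hn
  orderOf_σ_b := by rw [root_χ]; rfl
  σ_a := by rw [root_χ, root_a]
  τ_mul_y t := by
    rw [dT_apply, root_apply, mul_assoc, dΓ_mul_dY, mul_smul_comm, ← mul_assoc, dG_mul_dY,
      smul_mul_assoc, smul_smul, mul_assoc, Units.val_mul, Units.val_inv_eq_inv_val, mul_comm]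
  τ_mul_ξ t := by
    have h : D.dΓ t.2 * D.dΞ = (t.2 D.a : k)⁻¹ • (D.dΞ * D.dΓ t.2) := by
      rw [dΞ_mul_dΓ, smul_smul, inv_mul_cancel₀ (Units.ne_zero _), one_smul]
    rw [dT_apply, root_apply, mul_assoc, h, mul_smul_comm, ← mul_assoc, dG_mul_dΞ,
      smul_mul_assoc, smul_smul, mul_assoc, Units.val_mul, Units.val_inv_eq_inv_val, mul_inv,
      inv_inv, mul_comm (D.χ t.1 : k)]
  y_mul_ξ := by rw [dT_inl, dT_inr, D.dY_mul_dΞ hn]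
  y_pow := D.dY_pow_n hn
  ξ_pow := D.dΞ_pow_n
  adjoin_eq_top := by
    set W := Algebra.adjoin k (Set.range D.dT ∪ {D.dY, D.dΞ}) with hW
    have hT : ∀ t, D.dT t ∈ W := fun t => Algebra.subset_adjoin (Or.inl ⟨t, rfl⟩)
    have hY : D.dY ∈ W := Algebra.subset_adjoin (Or.inr (Or.inl rfl))
    have hΞ : D.dΞ ∈ W := Algebra.subset_adjoin (Or.inr (Or.inr rfl))
    have hΓ : ∀ γ, D.dΓ γ ∈ W := fun γ => by
      rw [← dT_inr]
      exact hT _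
    have hG : ∀ g, D.dG g ∈ W := fun g => by
      rw [← dT_inl]
      exact hT _
    refine D.eq_top_of_mem W hG hΓ (fun _ => hΞ) ?_
    have hw : D.correction ∈ W := by
      have := D.ofFun_mem W hΓ (fun _ => hΞ) (D.degFun (fun _ => 1) (D.n - 1))
      exact W.sub_mem (W.mul_mem (hΓ _) this) (W.mul_mem this (hG _))
    have h : D.dX = D.dY - D.correctionCoeff • D.correction := by rw [dY, add_sub_cancel_right]
    rw [h]
    exact W.sub_mem hY (W.smul_mem hw _)

end GroupDatum

/-! ### A representation on `End H` and the lower bound for the dimension of the double. -/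

namespace GroupDatum

section Representation

variable {k : Type u} {G : Type v} [Field k] [CommGroup G] [Finite G] (D : GroupDatum k G)

/-- Postcomposition with left multiplication. -/
noncomputable def leftHom : D.RankOne →ₐ[k] Module.End k (Module.End k D.RankOne) :=
  (Algebra.lmul k (Module.End k D.RankOne)).comp (Algebra.lmul k D.RankOne)

/-- Precomposition with right multiplication. -/
noncomputable def rightHom : D.RankOne →ₐ[k] Module.End k (Module.End k D.RankOne) :=
  AlgHom.ofLinearMap
    ((LinearMap.mul k (Module.End k D.RankOne)).flip ∘ₗ (LinearMap.mul k D.RankOne).flip)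
    (by ext f z; simp) (fun y z => by ext f w; simp [mul_assoc])

theorem rightHom_apply (h : D.RankOne) (f : Module.End k D.RankOne) (z : D.RankOne) :
    D.rightHom h f z = f (z * h) := rfl

/-- The inverse of the antipode. -/
noncomputable def skewAntipode : D.RankOne →ₗ[k] D.RankOne :=
  LinearMap.mulLeft k (D.gp D.a⁻¹) ∘ₗ LinearMap.mulRight k (D.gp D.a) ∘ₗ D.antipodeMap

/-- The square of the antipode is conjugation by `a`, so its inverse is the antipode followed by
conjugation by `a⁻¹`. -/
theorem skewAntipode_apply (h : D.RankOne) :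
    D.skewAntipode h = D.gp D.a⁻¹ * (D.antipodeMap h * D.gp D.a) := rfl

theorem skewAntipode_one : D.skewAntipode 1 = 1 := by
  rw [skewAntipode_apply, antipodeMap_one, one_mul, ← map_mul, inv_mul_cancel, map_one]

theorem skewAntipode_mul (y z : D.RankOne) :
    D.skewAntipode (y * z) = D.skewAntipode z * D.skewAntipode y := by
  have h : D.gp D.a * D.gp D.a⁻¹ = 1 := by rw [← map_mul, mul_inv_cancel, map_one]
  simp only [skewAntipode_apply, antipodeMap_mul, mul_assoc]
  rw [← mul_assoc (D.gp D.a) (D.gp D.a⁻¹), h, one_mul]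

theorem skewAntipode_gp (g : G) : D.skewAntipode (D.gp g) = D.gp g⁻¹ := by
  rw [skewAntipode_apply, antipodeMap_gp, ← map_mul, ← map_mul]
  simp [mul_comm g⁻¹]

theorem skewAntipode_x : D.skewAntipode D.x = -(D.gp D.a⁻¹ * D.x) := by
  rw [skewAntipode_apply, antipodeMap_x, neg_mul, mul_assoc, ← map_mul]
  simp

/-- Precomposition with left multiplication by the inverse antipode. -/
noncomputable def antipodeLeftHom : D.RankOne →ₐ[k] Module.End k (Module.End k D.RankOne) :=
  AlgHom.ofLinearMap
    ((LinearMap.mul k (Module.End k D.RankOne)).flip ∘ₗ LinearMap.mul k D.RankOne ∘ₗ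
      D.skewAntipode)
    (by ext f z; simp [skewAntipode_one])
    (fun y z => by ext f w; simp [mul_assoc, skewAntipode_mul])

/-- The action of `H ⊗ H` on `End H` by `(y ⊗ w) f = y f(S⁻¹(w) ?)`. -/
noncomputable def bimoduleHom :
    D.RankOne ⊗[k] D.RankOne →ₐ[k] Module.End k (Module.End k D.RankOne) :=
  Algebra.TensorProduct.lift D.leftHom D.antipodeLeftHom fun y z => by ext f w; rfl

theorem bimoduleHom_tmul (y w : D.RankOne) (f : Module.End k D.RankOne) (z : D.RankOne) :
    D.bimoduleHom (y ⊗ₜ w) f z = y * f (D.skewAntipode w * z) := rfl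

/-- The action of `H ⊗ (H ⊗ H)` on `End H` by `(v ⊗ y ⊗ w) f = y f(S⁻¹(w) ? v)`. -/
noncomputable def trimoduleHom :
    D.RankOne ⊗[k] (D.RankOne ⊗[k] D.RankOne) →ₐ[k] Module.End k (Module.End k D.RankOne) :=
  Algebra.TensorProduct.lift D.rightHom D.bimoduleHom fun y t => by
    induction t with
    | zero => rw [map_zero]; exact Commute.zero_right _
    | add p q hp hq => rw [map_add]; exact hp.add_right hq
    | tmul p q =>
      ext f w
      simp only [Module.End.mul_apply, rightHom_apply, bimoduleHom_tmul, mul_assoc]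

theorem trimoduleHom_tmul (v y w : D.RankOne) (f : Module.End k D.RankOne) (z : D.RankOne) :
    D.trimoduleHom (v ⊗ₜ (y ⊗ₜ w)) f z = y * f (D.skewAntipode w * (z * v)) := rfl

/-- The action of `H` on `End H` by `(h f)(z) = ∑ h₂ f(S⁻¹(h₃) z h₁)`. -/
noncomputable def eltAction : D.RankOne →ₐ[k] Module.End k (Module.End k D.RankOne) :=
  (D.trimoduleHom.comp
    (Algebra.TensorProduct.map (AlgHom.id k D.RankOne) (Bialgebra.comulAlgHom k D.RankOne))).comp
    (Bialgebra.comulAlgHom k D.RankOne)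

theorem eltAction_gp (g : G) (f : Module.End k D.RankOne) (z : D.RankOne) :
    D.eltAction (D.gp g) f z = D.gp g * f (D.gp g⁻¹ * (z * D.gp g)) := by
  simp [eltAction, comul_gp, trimoduleHom_tmul, skewAntipode_gp]

theorem eltAction_x (f : Module.End k D.RankOne) (z : D.RankOne) :
    D.eltAction D.x f z = D.gp D.a * f (D.gp D.a⁻¹ * (z * D.x)) + D.x * f (D.gp D.a⁻¹ * z) -
      f (D.gp D.a⁻¹ * (D.x * z)) := by
  simp [eltAction, comul_gp, comul_x, trimoduleHom_tmul, skewAntipode_gp, skewAntipode_x,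
    mul_assoc, TensorProduct.tmul_add]
  abel

/-- The map `y ⊗ z ↦ p(y) f(z)`. -/
noncomputable def pairing :
    Module.Dual k D.RankOne →ₗ[k] Module.End k D.RankOne →ₗ[k]
      D.RankOne ⊗[k] D.RankOne →ₗ[k] D.RankOne :=
  LinearMap.mk₂ k (fun p f => TensorProduct.lift ((LinearMap.lsmul k D.RankOne).compl₁₂ p f))
    (fun p q f => TensorProduct.ext' fun y z => by simp)
    (fun c p f => TensorProduct.ext' fun y z => by simp [mul_smul])
    (fun p f g => TensorProduct.ext' fun y z => by simp)
    (fun c p f => TensorProduct.ext' fun y z => by simp)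

theorem pairing_tmul (p : Module.Dual k D.RankOne) (f : Module.End k D.RankOne)
    (y z : D.RankOne) : D.pairing p f (y ⊗ₜ z) = p y • f z := rfl

/-- The action of `H^*` on `End H` by `(p f)(z) = ∑ p(z₁) f(z₂)`. -/
noncomputable def funAction :
    Module.Dual k D.RankOne →ₗ[k] Module.End k (Module.End k D.RankOne) :=
  LinearMap.mk₂ k (fun p f => D.pairing p f ∘ₗ Coalgebra.comul)
    (fun p q f => by ext; simp) (fun c p f => by ext; simp)
    (fun p f g => by ext; simp) (fun c p f => by ext; simp)

theorem funAction_apply (p : Module.Dual k D.RankOne) (f : Module.End k D.RankOne)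
    (z : D.RankOne) : D.funAction p f z = D.pairing p f (Coalgebra.comul z) := rfl

theorem funAction_counit : D.funAction Coalgebra.counit = 1 := by
  ext f z
  rw [funAction_apply, Module.End.one_apply]
  have h : ∀ t : D.RankOne ⊗[k] D.RankOne, D.pairing Coalgebra.counit f t =
      f (TensorProduct.lid k _ (Coalgebra.counit.rTensor D.RankOne t)) := by
    intro t
    induction t with
    | zero => simp
    | add p q hp hq => simp only [map_add, hp, hq]
    | tmul y z => simp [pairing_tmul]
  rw [h, Coalgebra.rTensor_counit_comul]
  simp

theorem funAction_mul (p q : Module.Dual k D.RankOne) :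
    D.funAction p * D.funAction q = D.funAction (dualConv k D.RankOne p q) := by
  ext f z
  rw [Module.End.mul_apply, funAction_apply, funAction_apply]
  have h1 : ∀ t : D.RankOne ⊗[k] D.RankOne, D.pairing p (D.funAction q f) t =
      TensorProduct.lift ((LinearMap.lsmul k D.RankOne).compl₁₂ p (D.pairing q f))
        (Coalgebra.comul.lTensor D.RankOne t) := by
    intro t
    induction t with
    | zero => simp
    | add p q hp hq => simp only [map_add, hp, hq]
    | tmul y z => simp [pairing_tmul, funAction_apply]
  have h2 : ∀ t : D.RankOne ⊗[k] D.RankOne ⊗[k] D.RankOne,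
      TensorProduct.lift ((LinearMap.lsmul k D.RankOne).compl₁₂ p (D.pairing q f))
        (TensorProduct.assoc k _ _ _ t) =
      TensorProduct.lift ((LinearMap.lsmul k D.RankOne).compl₁₂
        (LinearMap.mul' k k ∘ₗ TensorProduct.map p q) f) t := by
    intro t
    induction t with
    | zero => simp
    | add p q hp hq => simp only [map_add, hp, hq]
    | tmul t w =>
      induction t with
      | zero => simp
      | add p q hp hq => simp only [map_add, TensorProduct.add_tmul, hp, hq]
      | tmul y z => simp [pairing_tmul, mul_smul, smul_comm (q z)]
  have h3 : ∀ t : D.RankOne ⊗[k] D.RankOne,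
      TensorProduct.lift ((LinearMap.lsmul k D.RankOne).compl₁₂
        (LinearMap.mul' k k ∘ₗ TensorProduct.map p q) f) (Coalgebra.comul.rTensor D.RankOne t) =
      D.pairing (dualConv k D.RankOne p q) f t := by
    intro t
    induction t with
    | zero => simp
    | add p q hp hq => simp only [map_add, hp, hq]
    | tmul y z => simp [pairing_tmul, dualConv]
  rw [h1, ← Coalgebra.coassoc_apply, h2, h3]

/-- The map `y ⊗ z ↦ y · p(z ?)` on `End (End H)`. -/
noncomputable def crossLeft (p : Module.Dual k D.RankOne) :
    D.RankOne ⊗[k] D.RankOne →ₗ[k] Module.End k (Module.End k D.RankOne) :=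
  TensorProduct.lift ((LinearMap.mul k _).compl₁₂ D.eltAction.toLinearMap
    (D.funAction ∘ₗ (LinearMap.mul k D.RankOne).compr₂ p))

/-- The map `y ⊗ z ↦ p(? y) · z` on `End (End H)`. -/
noncomputable def crossRight (p : Module.Dual k D.RankOne) :
    D.RankOne ⊗[k] D.RankOne →ₗ[k] Module.End k (Module.End k D.RankOne) :=
  TensorProduct.lift ((LinearMap.mul k _).compl₁₂
    (D.funAction ∘ₗ (LinearMap.mul k D.RankOne).flip.compr₂ p) D.eltAction.toLinearMap)

theorem crossLeft_tmul (p : Module.Dual k D.RankOne) (y z : D.RankOne) :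
    D.crossLeft p (y ⊗ₜ z) = D.eltAction y * D.funAction (p ∘ₗ LinearMap.mulLeft k z) := rfl

theorem crossRight_tmul (p : Module.Dual k D.RankOne) (y z : D.RankOne) :
    D.crossRight p (y ⊗ₜ z) = D.funAction (p ∘ₗ LinearMap.mulRight k y) * D.eltAction z := rfl

/-- The cross relation is multiplicative, so it needs checking only on the generators `g` and `x`.
-/
theorem crossLeft_mul_eq {t t' : D.RankOne ⊗[k] D.RankOne}
    (h : ∀ p, D.crossLeft p t = D.crossRight p t)
    (h' : ∀ p, D.crossLeft p t' = D.crossRight p t') (p : Module.Dual k D.RankOne) :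
    D.crossLeft p (t * t') = D.crossRight p (t * t') := by
  obtain ⟨S, hS⟩ := TensorProduct.exists_finset t
  obtain ⟨S', hS'⟩ := TensorProduct.exists_finset t'
  have e : t * t' = ∑ i ∈ S, ∑ j ∈ S', (i.1 * j.1) ⊗ₜ (i.2 * j.2) := by
    rw [hS, hS', Finset.sum_mul_sum]
    simp
  have e1 : D.crossLeft p (t * t') = ∑ i ∈ S, D.eltAction i.1 *
      D.crossLeft (p ∘ₗ LinearMap.mulLeft k i.2) t' := by
    rw [e, hS', map_sum]
    refine Finset.sum_congr rfl fun i _ => ?_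
    rw [map_sum, map_sum, Finset.mul_sum]
    refine Finset.sum_congr rfl fun j _ => ?_
    rw [crossLeft_tmul, crossLeft_tmul, map_mul, mul_assoc, LinearMap.mulLeft_mul]
    rfl
  have e2 : D.crossRight p (t * t') = ∑ j ∈ S',
      D.crossRight (p ∘ₗ LinearMap.mulRight k j.1) t * D.eltAction j.2 := by
    rw [e, Finset.sum_comm, hS, map_sum]
    refine Finset.sum_congr rfl fun j _ => ?_
    rw [map_sum, map_sum, Finset.sum_mul]
    refine Finset.sum_congr rfl fun i _ => ?_
    rw [crossRight_tmul, crossRight_tmul, map_mul, mul_assoc, LinearMap.mulRight_mul]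
    rfl
  rw [e1, e2]
  simp only [h', ← h]
  rw [hS, hS']
  simp only [map_sum, Finset.mul_sum, Finset.sum_mul]
  rw [Finset.sum_comm]
  refine Finset.sum_congr rfl fun j _ => Finset.sum_congr rfl fun i _ => ?_
  rw [crossRight_tmul, crossLeft_tmul, mul_assoc]
  congr 3
  ext w
  simp [mul_assoc]

theorem cross_gp (g : G) (p : Module.Dual k D.RankOne) :
    D.crossLeft p (D.gp g ⊗ₜ D.gp g) = D.crossRight p (D.gp g ⊗ₜ D.gp g) := by
  rw [crossLeft_tmul, crossRight_tmul]
  ext f z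
  rw [Module.End.mul_apply, Module.End.mul_apply, eltAction_gp, funAction_apply, funAction_apply,
    Bialgebra.comul_mul, Bialgebra.comul_mul, comul_gp, comul_gp]
  generalize (Coalgebra.comul z : D.RankOne ⊗[k] D.RankOne) = t
  have hg : ∀ z, D.gp g * (D.gp g⁻¹ * z) = z := fun z => by
    rw [← mul_assoc, ← map_mul, mul_inv_cancel, map_one, one_mul]
  induction t with
  | zero => simp
  | add p q hp hq => simp only [map_add, add_mul, mul_add, hp, hq]
  | tmul y z => simp [pairing_tmul, eltAction_gp, hg]

theorem cross_x (p : Module.Dual k D.RankOne) :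
    D.crossLeft p (D.x ⊗ₜ D.gp D.a + 1 ⊗ₜ D.x) = D.crossRight p (D.x ⊗ₜ D.gp D.a + 1 ⊗ₜ D.x) := by
  rw [map_add, map_add, crossLeft_tmul, crossRight_tmul, crossLeft_tmul, crossRight_tmul]
  ext f z
  simp only [map_one, LinearMap.add_apply, Module.End.mul_apply, Module.End.one_apply, eltAction_x]
  simp only [ funAction_apply, Bialgebra.comul_mul, comul_gp, comul_x]
  generalize (Coalgebra.comul z : D.RankOne ⊗[k] D.RankOne) = t
  have hg : ∀ z, D.gp D.a * (D.gp D.a⁻¹ * z) = z := fun z => by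
    rw [← mul_assoc, ← map_mul, mul_inv_cancel, map_one, one_mul]
  have hg' : D.gp D.a⁻¹ * D.gp D.a = 1 := by
    rw [← map_mul, inv_mul_cancel, map_one]
  have hg'' : ∀ z, D.gp D.a⁻¹ * (D.gp D.a * z) = z := fun z => by
    rw [← mul_assoc, hg', one_mul]
  induction t with
  | zero => simp
  | add q r hq hr =>
    simp only [map_add, add_mul, mul_add] at hq hr ⊢
    rw [← sub_eq_zero] at hq hr ⊢
    rw [← add_zero (0 : D.RankOne)]
    nth_rewrite 1 [← hq]
    rw [← hr]
    abel
  | tmul y z =>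
    simp [pairing_tmul, eltAction_gp, eltAction_x, hg, hg'', mul_add, add_mul, smul_sub]
    abel

theorem cross (h : D.RankOne) : ∀ p : Module.Dual k D.RankOne,
    D.crossLeft p (Coalgebra.comul h) = D.crossRight p (Coalgebra.comul h) := by
  have hh : h ∈ Algebra.adjoin k (Set.range D.gp ∪ {D.x}) := by
    rw [D.adjoin_eq_top]
    trivial
  induction hh using Algebra.adjoin_induction with
  | mem y hy =>
    intro p
    rcases hy with ⟨g, rfl⟩ | rfl
    · rw [comul_gp, cross_gp]
    · rw [comul_x, cross_x]
  | algebraMap r =>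
    intro p
    have := D.cross_gp 1 p
    rw [map_one] at this
    rw [Algebra.algebraMap_eq_smul_one, map_smul, Bialgebra.comul_one,
      Algebra.TensorProduct.one_def, map_smul, map_smul, this]
  | add y z _ _ hy hz => intro p; rw [map_add, map_add, map_add, hy, hz]
  | mul y z _ _ hy hz => intro p; rw [Bialgebra.comul_mul, D.crossLeft_mul_eq hy hz]

/-- The representation of `D(H)` on `End H`. -/
noncomputable def endRep : D.Double →ₐ[k] Module.End k (Module.End k D.RankOne) :=
  RingQuot.liftAlgHom k ⟨TensorAlgebra.lift k (D.funAction.coprod D.eltAction.toLinearMap), by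
    have hl : ∀ (p : Module.Dual k D.RankOne) t,
        TensorAlgebra.lift k (D.funAction.coprod D.eltAction.toLinearMap)
          (doubleCrossLeft k D.RankOne p t) = D.crossLeft p t := by
      intro p t
      induction t with
      | zero => simp
      | add q r hq hr => simp only [map_add, hq, hr]
      | tmul y z => simp [doubleCrossLeft, crossLeft, doublePreElt, doublePreFun]
    have hr : ∀ (p : Module.Dual k D.RankOne) t,
        TensorAlgebra.lift k (D.funAction.coprod D.eltAction.toLinearMap)
          (doubleCrossRight k D.RankOne p t) = D.crossRight p t := by
      intro p t
      induction t with
      | zero => simp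
      | add q r hq hr => simp only [map_add, hq, hr]
      | tmul y z => simp [doubleCrossRight, crossRight, doublePreElt, doublePreFun]
    intro y z h
    induction h with
    | fun_one => simp [doublePreFun, funAction_counit]
    | fun_mul p q => simp [doublePreFun, funAction_mul]
    | elt_one => simp [doublePreElt]
    | elt_mul h h' => simp [doublePreElt]
    | cross h p => rw [hl, hr, cross]⟩

theorem endRep_ofFun (p : Module.Dual k D.RankOne) :
    D.endRep (DrinfeldDouble.ofFun k D.RankOne p) = D.funAction p := by
  change RingQuot.liftAlgHom k _ (RingQuot.mkAlgHom k (DoubleRel k D.RankOne) _) = _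
  rw [RingQuot.liftAlgHom_mkAlgHom_apply]
  simp [doublePreFun]

theorem endRep_ofElt (h : D.RankOne) :
    D.endRep (DrinfeldDouble.ofElt k D.RankOne h) = D.eltAction h := by
  change RingQuot.liftAlgHom k _ (RingQuot.mkAlgHom k (DoubleRel k D.RankOne) _) = _
  rw [RingQuot.liftAlgHom_mkAlgHom_apply]
  simp [doublePreElt]

theorem eltAction_counit_smulRight (h h' : D.RankOne) :
    D.eltAction h ((Coalgebra.counit : D.RankOne →ₗ[k] k).smulRight h') =
      (Coalgebra.counit : D.RankOne →ₗ[k] k).smulRight (h * h') := by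
  have hh : h ∈ Algebra.adjoin k (Set.range D.gp ∪ {D.x}) := by
    rw [D.adjoin_eq_top]
    trivial
  induction hh using Algebra.adjoin_induction generalizing h' with
  | mem y hy =>
    ext z
    rcases hy with ⟨g, rfl⟩ | rfl
    · rw [eltAction_gp]
      simp [counit_gp]
    · rw [eltAction_x]
      simp [counit_gp, counit_x]
  | algebraMap r => ext; simp [smul_comm _ r, Algebra.algebraMap_eq_smul_one]
  | add y z _ _ hy hz => rw [map_add, LinearMap.add_apply, hy, hz]; ext; simp [add_mul]
  | mul y z _ _ hy hz => rw [map_mul, Module.End.mul_apply, hz, hy, mul_assoc]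

/-- Together with the action of `H` on the same vectors this shows that `p h` sends `ε ⊗ 1` to `p ⊗
h`: the representation is cyclic, with `End H` playing the role of `H^* ⊗ H`. -/
theorem funAction_counit_smulRight (p : Module.Dual k D.RankOne) (h : D.RankOne) :
    D.funAction p ((Coalgebra.counit : D.RankOne →ₗ[k] k).smulRight h) = p.smulRight h := by
  ext z
  have h1 : ∀ t : D.RankOne ⊗[k] D.RankOne,
      D.pairing p ((Coalgebra.counit : D.RankOne →ₗ[k] k).smulRight h) t =
      p (TensorProduct.rid k _ (Coalgebra.counit.lTensor D.RankOne t)) • h := by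
    intro t
    induction t with
    | zero => simp
    | add p q hp hq => simp only [map_add, hp, hq, add_smul]
    | tmul y z => simp [pairing_tmul, mul_smul, smul_comm (p y)]
  rw [funAction_apply, h1, Coalgebra.lTensor_counit_comul]
  simp

theorem endRep_surjective :
    Function.Surjective fun d : D.Double =>
      D.endRep d ((Coalgebra.counit : D.RankOne →ₗ[k] k).smulRight 1) := by
  classical
  have := Fintype.ofFinite G
  intro f
  -- The expansion of `f` in a basis and its dual basis.
  refine ⟨∑ i, DrinfeldDouble.ofFun k D.RankOne (D.basis.coord i) *
    DrinfeldDouble.ofElt k D.RankOne (f (D.basis i)), ?_⟩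
  simp only [map_sum, LinearMap.sum_apply, map_mul, Module.End.mul_apply, endRep_ofFun,
    endRep_ofElt, eltAction_counit_smulRight, funAction_counit_smulRight, mul_one]
  refine D.basis.ext fun j => ?_
  simp [Finsupp.single_apply]

theorem finrank_double_ge [Module.Finite k D.Double] :
    (Nat.card G * D.n) ^ 2 ≤ Module.finrank k D.Double := by
  classical
  have := Fintype.ofFinite G
  have h : Module.finrank k D.RankOne = Nat.card G * D.n := by
    rw [Module.finrank_eq_card_basis D.basis]
    simp
  have : Module.Finite k D.RankOne := Module.Finite.of_basis D.basis
  have h2 := LinearMap.finrank_le_finrank_of_surjective (R := k)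
    (f := (LinearMap.applyₗ ((Coalgebra.counit : D.RankOne →ₗ[k] k).smulRight (1 : D.RankOne))) ∘ₗ
      D.endRep.toLinearMap) D.endRep_surjective
  rwa [Module.finrank_linearMap, h, ← sq] at h2

end Representation

end GroupDatum

/-! ### The semisimple case and the dimension estimate. -/

theorem isSemisimpleRing_of_adjoin_range_eq_top {k : Type*} [Field k] [CharZero k] {T : Type*}
    [Group T] [Finite T] {A : Type*} [Ring A] [Algebra k A] (τ : T →* A)
    (h : Algebra.adjoin k (Set.range τ) = ⊤) : IsSemisimpleRing A := by
  -- `A` is a quotient of the group algebra, which is semisimple by Maschke's theorem.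
  let F : MonoidAlgebra k T →ₐ[k] A := MonoidAlgebra.lift k _ _ τ
  have hF : F.range = ⊤ := by
    rw [eq_top_iff, ← h, Algebra.adjoin_le_iff]
    rintro _ ⟨t, rfl⟩
    exact ⟨MonoidAlgebra.of k T t, by simp [F]⟩
  have : NeZero (Nat.card T : k) := ⟨Nat.cast_ne_zero.mpr Nat.card_pos.ne'⟩
  exact RingHom.isSemisimpleRing_of_surjective F.toRingHom ((AlgHom.range_eq_top F).mp hF)

namespace GroupDatum

section

variable {k : Type u} [Field k] [IsAlgClosed k] [CharZero k] {G : Type v} [CommGroup G] [Finite G]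
  (D : GroupDatum k G)

theorem finite_characters (T : Type*) [CommGroup T] [Finite T] : Finite (T →* kˣ) :=
  Nat.finite_of_card_ne_zero (by rw [card_characters k T]; exact Nat.card_pos.ne')

/-- If `ρ = 1`, the double is a semisimple algebra. -/
theorem isSemisimpleRing_double (hn : D.n = 1) : IsSemisimpleRing D.Double := by
  have : Finite (G →* kˣ) := finite_characters G
  refine isSemisimpleRing_of_adjoin_range_eq_top (k := k) (T := G × (G →* kˣ)) D.dT ?_
  set W := Algebra.adjoin k (Set.range D.dT)
  have hT : ∀ t, D.dT t ∈ W := fun t => Algebra.subset_adjoin ⟨t, rfl⟩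
  have hG : ∀ g, D.dG g ∈ W := fun g => by rw [← dT_inl]; exact hT _
  refine D.eq_top_of_mem W hG (fun γ => by rw [← dT_inr]; exact hT _) (fun h => by omega) ?_
  have hx : D.dX = D.α • (D.dG D.a - 1) := by
    have := D.x_pow_n
    rw [hn, pow_one, pow_one] at this
    rw [dX, this, map_smul, map_sub, DrinfeldDouble.ofElt_one]
    rfl
  rw [hx]
  exact W.smul_mem (W.sub_mem (hG _) W.one_mem) _

/-- For `n = 1` the double is semisimple, so every module has zero radical and Loewy length at most
one. -/
theorem two_le_n_of_hasLoewyLength_two {M : Type w} [AddCommGroup M] [Module D.Double M]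
    (hM : HasLoewyLength D.Double M 2) : 2 ≤ D.n := by
  by_contra h
  have hn : D.n = 1 := by have := D.n_pos; omega
  have := D.isSemisimpleRing_double hn
  have h1 : radicalSeries D.Double M 1 = ⊥ := by
    rw [radicalSeries, IsSemisimpleModule.jacobson_eq_bot, Submodule.map_bot]
  exact absurd (hM.2 h1) (by omega)

/-- As `Γ` has as many elements as `G`, the left side is `(|G| n)²`, the dimension of `End H`. -/
theorem card_mul_sq_le_finrank (hn : 2 ≤ D.n) :
    (D.skewSl2 hn).n ^ 2 * Nat.card (G × (G →* kˣ)) ≤ Module.finrank k D.Double := by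
  classical
  have : Finite (G →* kˣ) := finite_characters G
  have : Finite (G × (G →* kˣ) →* kˣ) := finite_characters (G × (G →* kˣ))
  have := Fintype.ofFinite (G × (G →* kˣ))
  have := Fintype.ofFinite (G × (G →* kˣ) →* kˣ)
  have := SkewSl2.finite_of_skewSl2 (D.skewSl2 hn)
  rw [Nat.card_prod, card_characters]
  refine le_trans (le_of_eq ?_) D.finrank_double_ge
  change D.n ^ 2 * _ = _
  ring

/-! ### Identifying the nonprojective simple modules with the `V(l, λ)`. -/

section SimpleModule

variable {D} {N : Type w} [AddCommGroup N] [Module k N] [Module D.Double N]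
  [IsScalarTower k D.Double N] {wt : D.Weight} {w : N}

/-- The map `Z(λ) → N` given by a vector of weight `λ` killed by `ξ`. -/
noncomputable def vermaLift (hw : HasWeight (k := k) (T := G × (G →* kˣ)) D.dT wt w) (hξ : D.dΞ • w = 0) :
    D.Verma wt →ₗ[D.Double] N :=
  (D.vermaIdeal wt).liftQ (LinearMap.toSpanSingleton D.Double N w) (by
    rw [vermaIdeal, Ideal.span, Submodule.span_le]
    rintro _ ((rfl | ⟨g, rfl⟩) | ⟨γ, rfl⟩)
    · exact hξ
    · change (D.dG g - algebraMap k _ _) • w = 0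
      rw [sub_smul, algebraMap_smul, ← dT_inl, hw, sub_self]
    · change (D.dΓ γ - algebraMap k _ _) • w = 0
      rw [sub_smul, algebraMap_smul, ← dT_inr, hw, sub_self])

theorem vermaLift_one (hw : HasWeight (k := k) (T := G × (G →* kˣ)) D.dT wt w) (hξ : D.dΞ • w = 0) :
    vermaLift hw hξ (Submodule.Quotient.mk 1) = w := by
  change (1 : D.Double) • w = w
  rw [one_smul]

theorem hasWeight_verma_one (wt : D.Weight) :
    HasWeight (k := k) (T := G × (G →* kˣ)) D.dT wt (Submodule.Quotient.mk 1 : D.Verma wt) := by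
  have hG : ∀ g : G, D.dG g • (Submodule.Quotient.mk 1 : D.Verma wt) =
      (wt (g, 1) : k) • Submodule.Quotient.mk 1 := fun g => by
    rw [← algebraMap_smul D.Double (wt (g, 1) : k), ← sub_eq_zero, ← sub_smul,
      ← Submodule.Quotient.mk_smul, Submodule.Quotient.mk_eq_zero, smul_eq_mul, mul_one]
    exact Ideal.subset_span (Or.inl (Or.inr ⟨g, rfl⟩))
  have hΓ : ∀ γ : G →* kˣ, D.dΓ γ • (Submodule.Quotient.mk 1 : D.Verma wt) =
      (wt (1, γ) : k) • Submodule.Quotient.mk 1 := fun γ => by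
    rw [← algebraMap_smul D.Double (wt (1, γ) : k), ← sub_eq_zero, ← sub_smul,
      ← Submodule.Quotient.mk_smul, Submodule.Quotient.mk_eq_zero, smul_eq_mul, mul_one]
    exact Ideal.subset_span (Or.inr ⟨γ, rfl⟩)
  rintro ⟨g, γ⟩
  have e : wt (g, γ) = wt (g, 1) * wt (1, γ) := by
    rw [← map_mul]
    congr 1
    ext <;> simp
  rw [dT_apply, mul_smul, hΓ, ← algebraMap_smul D.Double (wt (1, γ) : k), ← mul_smul,
    ← Algebra.commutes, mul_smul, hG, algebraMap_smul, smul_smul, e, Units.val_mul, mul_comm]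

theorem dΞ_smul_verma_one (wt : D.Weight) :
    D.dΞ • (Submodule.Quotient.mk 1 : D.Verma wt) = 0 := by
  rw [← Submodule.Quotient.mk_smul, Submodule.Quotient.mk_eq_zero, smul_eq_mul, mul_one]
  exact Ideal.subset_span (Or.inl (Or.inl rfl))

/-- A simple module generated by a vector of weight `λ` killed by `ξ` is isomorphic to `L(λ)`. -/
theorem nonempty_equiv_simpleModule (hn : 2 ≤ D.n) [IsSimpleModule D.Double N]
    (hw : HasWeight (k := k) (T := G × (G →* kˣ)) D.dT wt w) (hξ : D.dΞ • w = 0) (h0 : w ≠ 0) :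
    Nonempty (N ≃ₗ[D.Double] D.simpleModule wt) := by
  have : Finite (G →* kˣ) := finite_characters G
  have := Fintype.ofFinite (G × (G →* kˣ))
  have hspan : Submodule.span D.Double {(Submodule.Quotient.mk 1 : D.Verma wt)} = ⊤ := by
    rw [eq_top_iff]
    intro v _
    obtain ⟨d, rfl⟩ := Submodule.Quotient.mk_surjective _ v
    refine Submodule.mem_span_singleton.mpr ⟨d, ?_⟩
    rw [← Submodule.Quotient.mk_smul, smul_eq_mul, mul_one]
  have hne : vermaLift hw hξ (Submodule.Quotient.mk 1) ≠ 0 := by rwa [vermaLift_one]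
  have hker := SkewSl2.ker_eq_jacobson (S := D.skewSl2 hn) (hasWeight_verma_one wt)
    (dΞ_smul_verma_one wt) hspan (vermaLift hw hξ) hne
  have hsurj : Function.Surjective (vermaLift hw hξ) :=
    (vermaLift hw hξ).surjective_of_ne_zero fun h => hne (by rw [h]; rfl)
  exact ⟨(Submodule.quotEquivOfEq _ _ hker.symm ≪≫ₗ
    (vermaLift hw hξ).quotKerEquivOfSurjective hsurj).symm⟩

/-- Linkage reads `λ(a) = ρ^(l-1) λ(χ)`, and dividing by `λ(χ)` gives the condition on `λ(a χ⁻¹)`.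
-/
theorem mem_weightSet_of_isLinked {hn : 2 ≤ D.n} {l : ℕ} (h : (D.skewSl2 hn).IsLinked wt l) :
    wt ∈ D.weightSet l := by
  have hρ : (D.skewSl2 hn).ρ = D.ρ := by
    change ((D.root (1, D.χ) : kˣ) : k) = D.ρ
    rw [root_apply, map_one, inv_one, one_mul]
    rfl
  have h3 := h.2.2
  rw [hρ] at h3
  change (wt (D.a, 1) : k) = D.ρ ^ (l - 1) * (wt (1, D.χ) : k) at h3
  have e : wt (D.a, 1) = wt (D.a, D.χ⁻¹) * wt (1, D.χ) := by
    rw [← map_mul]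
    congr 1
    ext <;> simp
  rw [e, Units.val_mul] at h3
  exact mul_right_cancel₀ (Units.ne_zero _) h3

end SimpleModule

/-- A simple module that is not projective is isomorphic to some `V(l, λ)`. -/
theorem exists_nonempty_equiv_V (hn : 2 ≤ D.n) (S : ModuleCat.{max u v} D.Double)
    [IsSimpleModule D.Double S] (hS : ¬ Module.Projective D.Double S) :
    ∃ (l : ℕ) (_ : 1 ≤ l) (_ : l < D.n) (wt : D.weightSet l),
      Nonempty (S ≃ₗ[D.Double] D.V l wt) := by
  have : Finite (G →* kˣ) := finite_characters G
  have : Finite (G × (G →* kˣ) →* kˣ) := finite_characters (G × (G →* kˣ))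
  have := Fintype.ofFinite (G × (G →* kˣ))
  have := Fintype.ofFinite (G × (G →* kˣ) →* kˣ)
  let : Module k S := Module.compHom S (algebraMap k D.Double)
  have : IsScalarTower k D.Double S :=
    ⟨fun c a v => by rw [Algebra.smul_def, mul_smul]; rfl⟩
  obtain ⟨wt, l, w, hl, h0, hw, hξ⟩ :=
    SkewSl2.exists_isLinked_of_not_projective (D.card_mul_sq_le_finrank hn) hS
  exact ⟨l, hl.1, hl.2.1, ⟨wt, mem_weightSet_of_isLinked hl⟩,
    nonempty_equiv_simpleModule hn hw hξ h0⟩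

end

end GroupDatum

/-- An indecomposable finite-dimensional `D(H_D)`-module of `(s, t)`-type with `s < t` satisfies
`t = s + 1` and is isomorphic to some `Ω⁻ˢ V(l, λ)`; if `t < s`, then `s = t + 1` and it is isomorphic
to some `Ωᵗ V(l, λ)`. -/
theorem proposition4p4 {k : Type u} [Field k] [IsAlgClosed k] [CharZero k]
    {G : Type v} [CommGroup G] [Finite G] (D : GroupDatum k G)
    {M : Type w} [AddCommGroup M] [Module k M] [Module D.Double M] [IsScalarTower k D.Double M]
    [FiniteDimensional k M] (s t : ℕ) (hM : IsOfType D.Double M s t) :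
    (s < t → t = s + 1 ∧
      ∃ (l : ℕ) (_ : 1 ≤ l) (_ : l < D.n) (wt : D.weightSet l) (N : ModuleCat.{max u v} D.Double),
        IsIteratedCosyzygy (D.V l wt) s N ∧ Nonempty (M ≃ₗ[D.Double] N)) ∧
    (t < s → s = t + 1 ∧
      ∃ (l : ℕ) (_ : 1 ≤ l) (_ : l < D.n) (wt : D.weightSet l) (N : ModuleCat.{max u v} D.Double),
        IsIteratedSyzygy (D.V l wt) t N ∧ Nonempty (M ≃ₗ[D.Double] N)) := by
  -- The presentation of `sl₂` type requires `n ≥ 2`, which the existence of a module of Loewy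
  -- length two guarantees.
  have hn := D.two_le_n_of_hasLoewyLength_two hM.loewy
  have : Finite (G →* kˣ) := GroupDatum.finite_characters G
  have : Finite (G × (G →* kˣ) →* kˣ) := GroupDatum.finite_characters (G × (G →* kˣ))
  have := Fintype.ofFinite (G × (G →* kˣ))
  have := Fintype.ofFinite (G × (G →* kˣ) →* kˣ)
  have : IsArtinianRing D.Double := SkewSl2.isArtinianRing (S := D.skewSl2 hn)
  have : Module.Finite D.Double M := Module.Finite.of_restrictScalars_finite k D.Double M
  obtain ⟨h1, h2⟩ := (SkewSl2.hasDiamonds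
    (D.card_mul_sq_le_finrank hn)).isIteratedCosyzygy_or_isIteratedSyzygy s t hM
  constructor
  · intro hst
    obtain ⟨e, S, N, _, hS, hN, hMN⟩ := h1 hst
    obtain ⟨l, hl1, hl2, wt, ⟨E⟩⟩ := D.exists_nonempty_equiv_V hn S hS
    exact ⟨e, l, hl1, hl2, wt, N, isIteratedCosyzygy_of_equiv E s N hN, hMN⟩
  · intro hst
    obtain ⟨e, S, N, _, hS, hN, hMN⟩ := h2 hst
    obtain ⟨l, hl1, hl2, wt, ⟨E⟩⟩ := D.exists_nonempty_equiv_V hn S hS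
    exact ⟨e, l, hl1, hl2, wt, N, isIteratedSyzygy_of_equiv E t N hN, hMN⟩
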